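/- Write $\langle v\rangle=(1+|v|^2)^{1/2}$ for $v\in\mathbb R^3$, and let $L^1_2(\mathbb R^3)$ be the space of integrable $f$ with $\int\langle v\rangle^2|f|\,dv<\infty$. For $\varepsilon>0$ and $0\le f\le \varepsilon^{-1}$ let $$\mathcal S_\varepsilon(f)=-\frac1\varepsilon\int_{\mathbb R^3}\big[\varepsilon f\log(\varepsilon f)+(1-\varepsilon f)\log(1-\varepsilon f)\big]dv,$$ and let $\mathcal S_0(f)=-H(f)$, where $H(f)=\int_{\mathbb R^3} f\log f\,dv$. Put $\mathcal H_\varepsilon(f|g)=-\mathcal S_\varepsilon(f)+\mathcal S_\varepsilon(g)$. Let $\varepsilon_0\ge 0$ and let $0\le f_{\rm in}\in L^1_2(\mathbb R^3)$ have $|H(f_{\rm in})|<\infty$ and, if $\varepsilon_0>0$, also $\|f_{\rm in}\|_\infty=\varepsilon_0^{-1}$ and $\mathcal S_{\varepsilon_0}(f_{\rm in})>0$. Assume the normalization $\int f_{\rm in}\,dv=1$, $\int f_{\rm in}\,v\,dv=0$, $\int f_{\rm in}|v|^2dv=3$. For $\varepsilon\in[0,\varepsilon_0]$, the class $\mathcal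 Y_\varepsilon(f_{\rm in})$ consists of the $f\in L^1_2(\mathbb R^3)$ with $0\le f\le\varepsilon^{-1}$ (only $f\ge 0$ if $\varepsilon=0$), with the same mass, momentum and energy as $f_{\rm in}$, and with finite entropy $\mathcal S_\varepsilon(f)\ge\mathcal S_\varepsilon(f_{\rm in})$. Let $$\mathcal M_\varepsilon(v)=\frac{a_\varepsilon e^{-b_\varepsilon|v|^2}}{1+\varepsilon a_\varepsilon e^{-b_\varepsilon|v|^2}},\qquad a_\varepsilon,b_\varepsilon>0,$$ be the Fermi–Dirac statistics with mass $1$, momentum $0$ and energy $3$. For $\gamma\ge0$ and $g$ of class $C^1$ with $g>0$ and $\varepsilon g<1$, the entropy production is $$\mathcal D_\varepsilon(g)=\frac12\int_{\mathbb R^3\times\mathbb R^3}|v-v_*|^{\gamma+2}\,gg_*(1-\varepsilon g)(1-\varepsilon g_*)\left|\Pi(v-v_*)\left(\frac{\nabla g}{g(1-\varepsilon g)}-\frac{\nabla g_*}{g_*(1-\varepsilon g_*)}\right)\right|^2dv\,dv_*\in[0,\infty],$$ where $g=g(v)$, $g_*=g(v_*)$ and $\Pi(z)$ is the orthogonal projection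 onto $z^\perp$. **Theorem.** Let $\gamma\ge0$ and $\varepsilon\in[0,\varepsilon_0]$. Let $g\in\mathcal Y_\varepsilon(f_{\rm in})$ be of class $C^1$ and positive, and assume that $\inf_{v}(1-\varepsilon g(v))\ge\kappa_0$ for some $\kappa_0>0$. Then $$\mathcal D_\varepsilon(g)\ \ge\ 2\lambda(g)\left[b_\varepsilon-\frac{12\varepsilon^2}{\kappa_0^4}\max\big(\|g\|_\infty^2,\|\mathcal M_\varepsilon\|_\infty^2\big)\right]\mathcal H_\varepsilon(g|\mathcal M_\varepsilon)$$ (for $\varepsilon=0$ the bracket is $b_0$), where $\lambda(g)\in[0,\infty)$ is given by $$\frac1{\lambda(g)}=510\,\frac{\boldsymbol e_\gamma^3}{\kappa_0^2}\,\max(1,\boldsymbol B_\gamma)\,\max\big(1,\boldsymbol m_{2+\gamma}(g)\big)\,\mathcal I_\gamma(g)\qquad(1/\infty=0),$$ with $\boldsymbol m_{2+\gamma}(g)=\int\langle v\rangle^{2+\gamma}|g|\,dv$, $\ \mathcal I_\gamma(g)=\sup_{v}\langle v\rangle^\gamma\int g(w)|w-v|^{-\gamma}\langle w\rangle^2dw$,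 $$\frac1{\boldsymbol B_\gamma}=\min_{i\ne j}\inf_{\sigma\in\mathbb S^1}\int\left|\sigma_1\frac{v_i}{\langle v\rangle}-\sigma_2\frac{v_j}{\langle v\rangle}\right|^2g(v)\,dv,\qquad \frac1{\boldsymbol e_\gamma}=\min_i\frac13\int g(v)v_i^2\,dv.$$ Moreover $\lambda(g)>0$ whenever $\boldsymbol m_{2+\gamma}(g)$ and $\mathcal I_\gamma(g)$ are finite. -/

import Mathlib

open MeasureTheory
open scoped ENNReal

noncomputable section

namespace LFD

/-- Velocity space, with its Euclidean norm and Lebesgue measure. -/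
abbrev V := EuclideanSpace ℝ (Fin 3)

/-- The weight `⟨v⟩ = (1 + |v|²)^(1/2)`. -/
def japanese (v : V) : ℝ := Real.sqrt (1 + ‖v‖ ^ 2)

/-- The space of integrable functions with a finite moment of order `s`. -/
def MemL1 (s : ℝ) (f : V → ℝ) : Prop :=
  Integrable f ∧ Integrable (fun v => japanese v ^ s * |f v|)

/-- The density of the Fermi-Dirac entropy (up to sign) for a positive quantum parameter,
and of the Boltzmann entropy in the classical case. As `Real.log 0 = 0`, the convention
`0 log 0 = 0` is built in. -/
def entropyDensity (ε x : ℝ) : ℝ :=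
  if ε = 0 then x * Real.log x
  else ε⁻¹ * (ε * x * Real.log (ε * x) + (1 - ε * x) * Real.log (1 - ε * x))

/-- The entropy `𝓢_ε(f)`; in the classical case it is `-H(f) = -∫ f log f`. -/
def entropy (ε : ℝ) (f : V → ℝ) : ℝ := - ∫ v, entropyDensity ε (f v)

/-- The relative entropy `𝓗_ε(f|g) = -𝓢_ε(f) + 𝓢_ε(g)`. -/
def relEntropy (ε : ℝ) (f g : V → ℝ) : ℝ := - entropy ε f + entropy ε g

/-- Initial data. For `ε₀ > 0`: a nonnegative function of finite mass and energy with
`‖f‖_∞ = 1/ε₀`, `𝓢_{ε₀}(f) > 0` and finite Boltzmann entropy. For `ε₀ = 0`, the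
classical case, only finite mass, energy and Boltzmann entropy are required. -/
structure IsDatum (ε₀ : ℝ) (f : V → ℝ) : Prop where
  nonneg_param : 0 ≤ ε₀
  nonneg : ∀ᵐ v, 0 ≤ f v
  memL1 : MemL1 2 f
  finite_boltzmann : Integrable (fun v => f v * Real.log (f v))
  norm_eq : 0 < ε₀ → eLpNorm f ∞ volume = ENNReal.ofReal ε₀⁻¹
  entropy_pos : 0 < ε₀ → 0 < entropy ε₀ f

/-- Mass one, zero momentum, energy three. -/
structure IsNormalized (f : V → ℝ) : Prop where
  mass : ∫ v, f v = 1
  momentum : ∫ v, f v • v = 0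
  energy : ∫ v, f v * ‖v‖ ^ 2 = 3

/-- The class `𝓨_ε(f_in)`. The bound `f ≤ 1/ε` is written as `ε f ≤ 1`, which is void for
`ε = 0`. Integrability of the entropy density says that the entropy of `f` is a real number;
it follows from the other conditions when `ε > 0`, and from `H(f) ≤ H(f_in) < ∞` when
`ε = 0`. -/
structure MemY (ε : ℝ) (fin f : V → ℝ) : Prop where
  memL1 : MemL1 2 f
  nonneg : ∀ᵐ v, 0 ≤ f v
  le_inv : ∀ᵐ v, ε * f v ≤ 1
  mass_eq : ∫ v, f v = ∫ v, fin v
  momentum_eq : ∫ v, f v • v = ∫ v, fin v • v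
  energy_eq : ∫ v, f v * ‖v‖ ^ 2 = ∫ v, fin v * ‖v‖ ^ 2
  finite_entropy : Integrable (fun v => entropyDensity ε (f v))
  entropy_ge : entropy ε fin ≤ entropy ε f

/-- The kinetic potential `Ψ(z) = |z|^(γ+2)`. -/
def kineticPotential (γ : ℝ) (z : V) : ℝ := ‖z‖ ^ (γ + 2)

/-- The orthogonal projection `Π(z)` onto the orthogonal complement of `z`, applied to `y`. -/
def proj (z y : V) : V := y - (inner ℝ z y / ‖z‖ ^ 2) • z

/-- The vector field `∇g / (g (1 - ε g))`. -/
def score (ε : ℝ) (g : V → ℝ) (v : V) : V := (g v * (1 - ε * g v))⁻¹ • gradient g v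

/-- The integrand `Ξ_ε[g](v, v_*)`. -/
def dissipationDensity (ε : ℝ) (g : V → ℝ) (v w : V) : ℝ :=
  g v * g w * (1 - ε * g v) * (1 - ε * g w) *
    ‖proj (v - w) (score ε g v - score ε g w)‖ ^ 2

/-- The entropy production `𝓓_ε(g)`, an element of `[0, ∞]`. -/
def entropyProduction (γ ε : ℝ) (g : V → ℝ) : ℝ≥0∞ :=
  2⁻¹ * ∫⁻ p : V × V,
    ENNReal.ofReal (kineticPotential γ (p.1 - p.2) * dissipationDensity ε g p.1 p.2)

/-- The Fermi-Dirac statistics `a exp(-b|v|²) / (1 + ε a exp(-b|v|²))`. -/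
def fermiDirac (ε a b : ℝ) (v : V) : ℝ :=
  a * Real.exp (-b * ‖v‖ ^ 2) / (1 + ε * (a * Real.exp (-b * ‖v‖ ^ 2)))

/-- `(a, b)` are the parameters `(a_ε, b_ε)`: those for which the Fermi-Dirac statistics has
mass one, zero momentum and energy three. -/
structure IsFermiDiracParam (ε a b : ℝ) : Prop where
  a_pos : 0 < a
  b_pos : 0 < b
  normalized : IsNormalized (fermiDirac ε a b)

/-- The norm of `L^∞`, as a real number. -/
def supNorm (f : V → ℝ) : ℝ := (eLpNorm f ∞ volume).toReal

/-- The moment `m_s(g) = ∫ ⟨v⟩^s |g(v)| dv`, possibly infinite. -/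
def moment (s : ℝ) (g : V → ℝ) : ℝ≥0∞ := ∫⁻ v, ENNReal.ofReal (japanese v ^ s * |g v|)

/-- `𝓘_γ(g) = sup_v ⟨v⟩^γ ∫ g(w) |w - v|^(-γ) ⟨w⟩² dw`, possibly infinite. -/
def supI (γ : ℝ) (g : V → ℝ) : ℝ≥0∞ :=
  ⨆ v : V, ENNReal.ofReal (japanese v ^ γ) *
    ∫⁻ w, ENNReal.ofReal (g w * ‖w - v‖ ^ (-γ) * japanese w ^ 2)

/-- The constant `B_γ`, given through
`1/B_γ = min_{i ≠ j} inf_{σ ∈ S¹} ∫ |σ₁ v_i/⟨v⟩ - σ₂ v_j/⟨v⟩|² g(v) dv`. -/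
def constB (g : V → ℝ) : ℝ≥0∞ :=
  (⨅ (i : Fin 3) (j : Fin 3) (_ : i ≠ j)
    (σ : Metric.sphere (0 : EuclideanSpace ℝ (Fin 2)) 1),
    ∫⁻ v, ENNReal.ofReal
      (|σ.1 0 * (v i / japanese v) - σ.1 1 * (v j / japanese v)| ^ 2 * g v))⁻¹

/-- The constant `e_γ`, given through `1/e_γ = min_i (1/3) ∫ g(v) v_i² dv`. -/
def constE (g : V → ℝ) : ℝ≥0∞ :=
  (⨅ i : Fin 3, 3⁻¹ * ∫⁻ v, ENNReal.ofReal (g v * v i ^ 2))⁻¹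

/-- The constant `λ(g)`, given through
`1/λ(g) = 510 (e_γ³/κ₀²) max(1, B_γ) max(1, m_{2+γ}(g)) 𝓘_γ(g)`, with `1/∞ = 0`. -/
def lam (γ κ₀ : ℝ) (g : V → ℝ) : ℝ≥0∞ :=
  (510 * (constE g ^ 3 / ENNReal.ofReal (κ₀ ^ 2)) * max 1 (constB g) *
    max 1 (moment (2 + γ) g) * supI γ g)⁻¹

end LFD

end

/-! ### Monotone transport on the line and Gaussian densities -/

namespace LFD

open Filter Topology Set
open scoped NNReal

/-! Write `h` for the score `∇g / (g(1 - εg))`, `D` for the entropy production and `I` for `supI γ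
g`. The proof bounds a Fisher information of `g` relative to an isotropic Gaussian by `D`, converts
it into entropy by the Gaussian logarithmic Sobolev inequality, and uses the bracket only to select
a regime.

Dissipation to Fisher information. The kernel of `D` controls every component of the cross product
of `v - w` and `h v - h w` (`crossDissipation_le`). Fix an orthonormal pair `u, u'` of principal
directions of the second moment tensor, multiply the component by `g(w) ⟪u', w⟫` and integrate in
`w`. Since `g h` is the gradient of the pressure `P(g) = -ε⁻¹ log(1 - εg)`, integration by parts
leaves `T ⟪u, h v⟫ + K ⟪u, v⟫ + C`, where `T` is the second moment along `u'` and `K = ∫ P(g) ≥ 1`.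
Cauchy-Schwarz with the weights `|v - w|^(±γ)` bounds its weighted `L²` norm, and centring removes
`C`. With principal moments `T₀ ≥ T₁ ≥ T₂`, all three directions can be given the slope `K / T₁`:
the second direction serves as partner of the other two, and for the second direction itself this
slope is the least squares one. Hence `∫ g |h + (K / T₁) v|² ≤ 3X / T₁²` with `X = 2 D I / κ₀²`
(`lintegral_score_le`). Moreover `1 / B_γ ≤ T₁`, because a coordinate plane always meets the span of
the last two principal directions (`inv_constB_le`).

Fisher information to entropy. Put `φ = g / (1 - εg)`, so that `∇ log φ = h`. The Fermi-Dirac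
relative entropy of `g` is at most the Boltzmann relative entropy of `φ` with respect to any
isotropic centred Gaussian (`relEntropy_le_lintegral_relEnt`), since the logarithm of a Gaussian
only sees mass and energy. The logarithmic Sobolev inequality with variance `T₁ / K` then applies.
It is proved on the line by monotone transport and extended to three dimensions by subadditivity of
entropy.

The bracket. If it is not positive, the right side is zero. If it is positive, virial identities and
a comparison of `g` with the Fermi-Dirac statistics give `b ≤ 1` and `εg ≤ 1/2` (`of_bracket_pos`).
Then the bracket is at most `1` and `φ ≤ 2g`, so the previous steps give the relative entropy at
most `6 D I B_γ / κ₀²`, well within the constant `510`. -/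

theorem hasDerivAt_integral_Iic {f : ℝ → ℝ} (hc : Continuous f) (hi : Integrable f) (x : ℝ) :
    HasDerivAt (fun y => ∫ t in Iic y, f t) (f x) x := by
  have h : (fun y => ∫ t in Iic y, f t) = fun y => (∫ t in Iic x, f t) + ∫ t in x..y, f t := by
    funext y
    rw [← intervalIntegral.integral_Iic_sub_Iic hi.integrableOn hi.integrableOn]
    ring
  rw [h]
  simpa using (intervalIntegral.integral_hasDerivAt_right (hc.intervalIntegrable x x)
    (hc.stronglyMeasurableAtFilter _ _) hc.continuousAt).const_add (∫ t in Iic x, f t)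

theorem strictMono_integral_Iic {f : ℝ → ℝ} (hc : Continuous f) (hi : Integrable f)
    (hpos : ∀ x, 0 < f x) : StrictMono (fun y => ∫ t in Iic y, f t) :=
  strictMono_of_hasDerivAt_pos (hasDerivAt_integral_Iic hc hi) hpos

theorem tendsto_integral_Iic_atTop {f : ℝ → ℝ} (hi : Integrable f) :
    Tendsto (fun y => ∫ t in Iic y, f t) atTop (𝓝 (∫ t, f t)) :=
  (aecover_Iic tendsto_id).integral_tendsto_of_countably_generated hi

theorem tendsto_integral_Iic_atBot {f : ℝ → ℝ} (hi : Integrable f) :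
    Tendsto (fun y => ∫ t in Iic y, f t) atBot (𝓝 0) := by
  have h : (fun y => ∫ t in Iic y, f t) = fun y => (∫ t, f t) - ∫ t in Ioi y, f t := by
    funext y
    rw [← intervalIntegral.integral_Iic_add_Ioi hi.integrableOn hi.integrableOn (b := y)]
    ring
  rw [h]
  have := (aecover_Ioi (μ := volume) (α := ℝ) tendsto_id).integral_tendsto_of_countably_generated hi
  simpa using (tendsto_const_nhds (x := ∫ t, f t)).sub this

theorem range_integral_Iic {f : ℝ → ℝ} (hc : Continuous f) (hi : Integrable f)
    (hpos : ∀ x, 0 < f x) : range (fun y => ∫ t in Iic y, f t) = Ioo 0 (∫ t, f t) := by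
  have hm := strictMono_integral_Iic hc hi hpos
  have hcont : Continuous (fun y => ∫ t in Iic y, f t) :=
    continuous_iff_continuousAt.2 fun x => (hasDerivAt_integral_Iic hc hi x).continuousAt
  apply Subset.antisymm
  · rintro _ ⟨x, rfl⟩
    constructor
    · have h1 : 0 ≤ ∫ t in Iic (x - 1), f t := integral_nonneg fun t => (hpos t).le
      exact h1.trans_lt (hm (by linarith))
    · have h1 := hm (show x < x + 1 by linarith)
      have h2 : ∫ t in Iic (x + 1), f t ≤ ∫ t, f t :=
        setIntegral_le_integral hi (Eventually.of_forall fun t => (hpos t).le)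
      exact h1.trans_le h2
  · rintro p ⟨hp0, hp1⟩
    obtain ⟨x, hx⟩ := ((tendsto_integral_Iic_atBot hi).eventually (gt_mem_nhds hp0)).exists
    obtain ⟨y, hy⟩ := ((tendsto_integral_Iic_atTop hi).eventually (lt_mem_nhds hp1)).exists
    exact mem_range_of_exists_le_of_exists_ge hcont ⟨x, hx.le⟩ ⟨y, hy.le⟩

/-- The monotone transport between two positive continuous densities of equal mass. -/
theorem exists_monotone_transport {p q : ℝ → ℝ} (hp : Continuous p) (hq : Continuous q)
    (hpi : Integrable p) (hqi : Integrable q) (hp0 : ∀ x, 0 < p x) (hq0 : ∀ x, 0 < q x)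
    (hpq : ∫ x, p x = ∫ x, q x) :
    ∃ T : ℝ → ℝ, ∀ x, HasDerivAt T (p x / q (T x)) x := by
  set F := fun y => ∫ t in Iic y, p t
  set G := fun y => ∫ t in Iic y, q t
  have hG : StrictMono G := strictMono_integral_Iic hq hqi hq0
  have hFr : range F = Ioo 0 (∫ t, q t) := by rw [← hpq]; exact range_integral_Iic hp hpi hp0
  have hGr : range G = Ioo 0 (∫ t, q t) := range_integral_Iic hq hqi hq0
  set Q := Function.invFun G
  have hQG : ∀ x, Q (G x) = x := Function.leftInverse_invFun hG.injective
  have hGQ : ∀ y ∈ Ioo 0 (∫ t, q t), G (Q y) = y := fun y hy =>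
    Function.invFun_eq (by rw [← hGr] at hy; exact hy)
  have hQm : MonotoneOn Q (Ioo 0 (∫ t, q t)) := by
    intro a ha b hb hab
    rwa [← hG.le_iff_le, hGQ a ha, hGQ b hb]
  have hQim : Q '' Ioo 0 (∫ t, q t) = univ := by
    rw [← hGr, ← range_comp]
    exact eq_univ_of_forall fun x => ⟨x, hQG x⟩
  refine ⟨fun x => Q (F x), fun x => ?_⟩
  have hFx : F x ∈ Ioo 0 (∫ t, q t) := by rw [← hFr]; exact mem_range_self x
  have hnhds : Ioo 0 (∫ t, q t) ∈ 𝓝 (F x) := isOpen_Ioo.mem_nhds hFx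
  -- A monotone function whose image is the whole line cannot jump, so the inverse is continuous
  -- before anything is known about its derivative.
  have hQc : ContinuousAt Q (F x) :=
    continuousAt_of_monotoneOn_of_image_mem_nhds hQm hnhds (by rw [hQim]; exact univ_mem)
  have hQd : HasDerivAt Q (q (Q (F x)))⁻¹ (F x) :=
    HasDerivAt.of_local_left_inverse hQc (hasDerivAt_integral_Iic hq hqi _) (hq0 _).ne'
      (Filter.mem_of_superset hnhds hGQ)
  have := hQd.comp x (hasDerivAt_integral_Iic hp hpi x)
  rw [div_eq_inv_mul]
  exact this

/-- The density of the relative entropy, including the mass terms. -/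
noncomputable def relEnt (a b : ℝ) : ℝ := a * Real.log (a / b) - a + b

theorem relEnt_nonneg {a b : ℝ} (ha : 0 < a) (hb : 0 < b) : 0 ≤ relEnt a b := by
  have h := Real.log_le_sub_one_of_pos (div_pos hb ha)
  have h2 : Real.log (a / b) = - Real.log (b / a) := by
    rw [← Real.log_inv, inv_div]
  have h3 : a * (b / a) = b := by field_simp
  unfold relEnt
  rw [h2]
  nlinarith

theorem gaussian_log_div (v : ℝ≥0) (hv : v ≠ 0) (x y : ℝ) :
    Real.log (ProbabilityTheory.gaussianPDFReal 0 v y) -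
      Real.log (ProbabilityTheory.gaussianPDFReal 0 v x) = (x ^ 2 - y ^ 2) / (2 * v) := by
  have hv' : (0 : ℝ) < v := by positivity
  have hs : (√(2 * Real.pi * v))⁻¹ ≠ 0 := by positivity
  unfold ProbabilityTheory.gaussianPDFReal
  rw [Real.log_mul hs (Real.exp_pos _).ne', Real.log_mul hs (Real.exp_pos _).ne', Real.log_exp,
    Real.log_exp]
  ring

theorem hasDerivAt_gaussianPDFReal (v : ℝ≥0) (hv : v ≠ 0) (x : ℝ) :
    HasDerivAt (ProbabilityTheory.gaussianPDFReal 0 v)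
      (-(x / v) * ProbabilityTheory.gaussianPDFReal 0 v x) x := by
  have hv' : (v : ℝ) ≠ 0 := by positivity
  unfold ProbabilityTheory.gaussianPDFReal
  have h : HasDerivAt (fun x : ℝ => -(x - 0) ^ 2 / (2 * (v : ℝ))) (-(x / v)) x := by
    refine (((((hasDerivAt_id x).sub_const 0).pow 2).neg).div_const (2 * (v : ℝ))).congr_deriv ?_
    simp only [id, sub_zero]
    field_simp
    norm_num
  refine ((h.exp).const_mul ((√(2 * Real.pi * v))⁻¹)).congr_deriv ?_
  ring

end LFD

/-! ### Logarithmic Sobolev inequality on the line -/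

namespace LFD

open Filter Topology Set ProbabilityTheory
open scoped NNReal

/-- A function whose derivative is `p * T`, bounded above and below, prevents `p * T` from staying
above a positive constant near `+∞`. -/
theorem frequently_deriv_lt_atTop {W W' : ℝ → ℝ} {C : ℝ} (hW : ∀ x, HasDerivAt W (W' x) x)
    (hb : ∀ x, |W x| ≤ C) {ε : ℝ} (hε : 0 < ε) : ∃ᶠ x in atTop, W' x < ε := by
  rw [Filter.frequently_atTop]
  intro A
  by_contra! hcon
  have hd : Differentiable ℝ W := fun x => (hW x).differentiableAt
  have hC : 0 ≤ C := (abs_nonneg _).trans (hb 0)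
  have h := Convex.mul_sub_le_image_sub_of_le_deriv (convex_Ici A) hd.continuous.continuousOn
    hd.differentiableOn (C := ε) (fun x hx => by
      rw [interior_Ici] at hx
      rw [(hW x).deriv]; exact hcon x (le_of_lt hx)) A (self_mem_Ici) (A + (2 * C + 1) / ε)
      (by simp only [mem_Ici, le_add_iff_nonneg_right]; positivity)
      (by simp only [le_add_iff_nonneg_right]; positivity)
  have h1 := abs_le.1 (hb A)
  have h2 := abs_le.1 (hb (A + (2 * C + 1) / ε))
  have h3 : ε * (A + (2 * C + 1) / ε - A) = 2 * C + 1 := by field_simp; ring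
  linarith

theorem frequently_lt_deriv_atBot {W W' : ℝ → ℝ} {C : ℝ} (hW : ∀ x, HasDerivAt W (W' x) x)
    (hb : ∀ x, |W x| ≤ C) {ε : ℝ} (hε : 0 < ε) : ∃ᶠ x in atBot, -ε < W' x := by
  have h := frequently_deriv_lt_atTop (W := fun x => W (-x)) (W' := fun x => - W' (-x)) (C := C)
    (fun x => ((hW (-x)).comp x (hasDerivAt_neg x)).congr_deriv (by ring)) (fun x => hb _) hε
  rw [Filter.frequently_atTop] at h
  rw [Filter.frequently_atBot]
  intro A
  obtain ⟨x, hx, hx'⟩ := h (-A)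
  exact ⟨-x, by linarith, by linarith⟩

theorem gaussianPDFReal_le (v : ℝ≥0) (x : ℝ) :
    gaussianPDFReal 0 v x ≤ (√(2 * Real.pi * v))⁻¹ := by
  unfold gaussianPDFReal
  refine mul_le_of_le_one_right (by positivity) (Real.exp_le_one_iff.2 ?_)
  rw [neg_div]
  exact neg_nonpos.2 (by positivity)

theorem continuous_gaussianPDFReal (v : ℝ≥0) (hv : v ≠ 0) : Continuous (gaussianPDFReal 0 v) :=
  continuous_iff_continuousAt.2 fun x => (hasDerivAt_gaussianPDFReal v hv x).continuousAt

/-- The pointwise inequality behind the transport proof of the logarithmic Sobolev inequality. -/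
theorem transport_pointwise (v : ℝ≥0) (hv : v ≠ 0) {m p p' x t : ℝ} (hm : 0 < m) (hp : 0 < p) :
    p * Real.log (p / (m * gaussianPDFReal 0 v x)) ≤
      (p' * (t - x) + p * (p / (m * gaussianPDFReal 0 v t) - 1)) +
        v / 2 * p * (p' / p + x / v) ^ 2 := by
  have hv' : (0 : ℝ) < v := by positivity
  have hgx := gaussianPDFReal_pos 0 v x hv
  have hgt := gaussianPDFReal_pos 0 v t hv
  have h1 : Real.log (p / (m * gaussianPDFReal 0 v x)) =
      Real.log (p / (m * gaussianPDFReal 0 v t)) + (x ^ 2 - t ^ 2) / (2 * v) := by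
    rw [← gaussian_log_div v hv x t, Real.log_div hp.ne' (by positivity),
      Real.log_div hp.ne' (by positivity), Real.log_mul hm.ne' hgx.ne', Real.log_mul hm.ne' hgt.ne']
    ring
  have h2 := Real.log_le_sub_one_of_pos (show 0 < p / (m * gaussianPDFReal 0 v t) by positivity)
  -- Completing the square: the right side minus the left side is `(p v / 2) (p'/p + t/v)²`.
  have h3 : p * (x ^ 2 - t ^ 2) / (2 * v) ≤ p' * (t - x) + v / 2 * p * (p' / p + x / v) ^ 2 := by
    have : p' * (t - x) + v / 2 * p * (p' / p + x / v) ^ 2 - p * (x ^ 2 - t ^ 2) / (2 * v) =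
        p * v / 2 * (p' / p + t / v) ^ 2 - p' * (t - x) * 0 := by
      field_simp
      ring
    have h4 : 0 ≤ p * v / 2 * (p' / p + t / v) ^ 2 := by positivity
    linarith
  rw [h1]
  have h5 := mul_le_mul_of_nonneg_left h2 hp.le
  rw [mul_add, ← mul_div_assoc]
  linarith

/-- **Gaussian logarithmic Sobolev inequality** on the line. -/
theorem logSobolev_real (v : ℝ≥0) (hv : v ≠ 0) {p p' : ℝ → ℝ} (hp : ∀ x, HasDerivAt p (p' x) x)
    (hp' : Continuous p') (hpos : ∀ x, 0 < p x) (hpi : Integrable p) :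
    ∫⁻ x, ENNReal.ofReal (relEnt (p x) ((∫ t, p t) * gaussianPDFReal 0 v x)) ≤
      ∫⁻ x, ENNReal.ofReal (v / 2 * p x * (p' x / p x + x / v) ^ 2) := by
  have hv' : (0 : ℝ) < v := by positivity
  have hpc : Continuous p := continuous_iff_continuousAt.2 fun x => (hp x).continuousAt
  set m := ∫ t, p t with hmdef
  have hm : 0 < m := (range_integral_Iic hpc hpi hpos ▸ mem_range_self (0 : ℝ) :
    (∫ t in Iic (0 : ℝ), p t) ∈ Ioo 0 m).1.trans
      (range_integral_Iic hpc hpi hpos ▸ mem_range_self (0 : ℝ) :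
        (∫ t in Iic (0 : ℝ), p t) ∈ Ioo 0 m).2
  set γ := gaussianPDFReal 0 v with hγ
  have hγ0 : ∀ x, 0 < γ x := fun x => gaussianPDFReal_pos 0 v x hv
  have hγc : Continuous γ := continuous_gaussianPDFReal v hv
  set q := fun x => m * γ x with hq
  have hq0 : ∀ x, 0 < q x := fun x => mul_pos hm (hγ0 x)
  have hqc : Continuous q := hγc.const_mul m
  have hqi : Integrable q := (integrable_gaussianPDFReal 0 v).const_mul m
  have hqm : ∫ x, q x = m := by
    rw [hq, integral_const_mul, integral_gaussianPDFReal_eq_one 0 hv, mul_one]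
  obtain ⟨T, hT⟩ := exists_monotone_transport hpc hqc hpi hqi hpos hq0 hqm.symm
  have hTc : Continuous T := continuous_iff_continuousAt.2 fun x => (hT x).continuousAt
  -- the function `W` has derivative `p T` and is bounded
  have hW : ∀ x, HasDerivAt (fun x => -v * q (T x)) (p x * T x) x := by
    intro x
    have h1 : HasDerivAt q (-(T x / v) * q (T x)) (T x) := by
      refine ((hasDerivAt_gaussianPDFReal v hv (T x)).const_mul m).congr_deriv ?_
      simp only [hq, hγ]; ring
    refine ((h1.comp x (hT x)).const_mul (-(v : ℝ))).congr_deriv ?_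
    have := (hq0 (T x)).ne'
    field_simp
  have hWb : ∀ x, |-v * q (T x)| ≤ v * (m * (√(2 * Real.pi * v))⁻¹) := by
    intro x
    rw [abs_mul, abs_neg, abs_of_pos hv', abs_of_pos (hq0 _)]
    exact mul_le_mul_of_nonneg_left (mul_le_mul_of_nonneg_left (gaussianPDFReal_le v _) hm.le) hv'.le
  set S := fun x => v / 2 * p x * (p' x / p x + x / v) ^ 2 with hS
  have hSc : Continuous S := by
    have : ∀ x, p x ≠ 0 := fun x => (hpos x).ne'
    fun_prop (disch := assumption)
  have hS0 : ∀ x, 0 ≤ S x := fun x => by have := hpos x; positivity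
  set E := fun x => relEnt (p x) (q x) with hE
  have hEc : Continuous E := by
    have h1 : ∀ x, q x ≠ 0 := fun x => (hq0 x).ne'
    have h2 : ∀ x, p x / q x ≠ 0 := fun x => (div_pos (hpos x) (hq0 x)).ne'
    unfold E relEnt
    fun_prop (disch := assumption)
  have hE0 : ∀ x, 0 ≤ E x := fun x => relEnt_nonneg (hpos x) (hq0 x)
  -- Since `T' = p / q(T)`, this is the derivative of `p (T - id)`: it contributes only boundary
  -- terms.
  set D' := fun x => p' x * (T x - x) + p x * (p x / q (T x) - 1) with hD'
  have hD'c : Continuous D' := by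
    have h1 : ∀ x, q (T x) ≠ 0 := fun x => (hq0 _).ne'
    fun_prop (disch := assumption)
  have hD : ∀ x, HasDerivAt (fun x => p x * (T x - x)) (D' x) x := fun x =>
    (hp x).mul ((hT x).sub (hasDerivAt_id x))
  have hpt : ∀ x, E x ≤ D' x + S x + (q x - p x) := by
    intro x
    have := transport_pointwise v hv (p' := p' x) (x := x) (t := T x) hm (hpos x)
    simp only [hE, relEnt, hD', hS, hq]
    linarith
  refine ENNReal.le_of_forall_pos_le_add fun ε hε hfin => ?_
  have hε' : (0 : ℝ) < ε / 3 := by positivity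
  have hSi : Integrable S := ⟨hSc.aestronglyMeasurable, by
    rw [hasFiniteIntegral_iff_ofReal (Eventually.of_forall hS0)]; exact hfin⟩
  have hmeas : AEMeasurable (fun x => ENNReal.ofReal (E x)) volume :=
    (hEc.measurable.ennreal_ofReal).aemeasurable
  -- The bound is proved on each `(-n, n]`. As the entropy integrand is nonnegative, the interval
  -- may be enlarged to endpoints `R1 ≤ -n` and `R2 ≥ n` chosen so that the boundary terms are
  -- small.
  have hlim := (aecover_Ioc (μ := volume) (α := ℝ) (a := fun n : ℕ => -(n : ℝ))
    (b := fun n : ℕ => (n : ℝ)) (tendsto_neg_atTop_atBot.comp tendsto_natCast_atTop_atTop)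
    tendsto_natCast_atTop_atTop).lintegral_tendsto_of_nat hmeas
  refine le_of_tendsto' hlim fun n => ?_
  have hqp : Tendsto (fun z : ℝ × ℝ => ∫ x in z.1..z.2, (q x - p x)) (atBot ×ˢ atTop) (𝓝 0) := by
    have := intervalIntegral_tendsto_integral (hqi.sub hpi) (tendsto_fst (f := atBot (α := ℝ))
      (g := atTop (α := ℝ))) tendsto_snd
    simp only [Pi.sub_apply] at this
    rwa [integral_sub hqi hpi, hqm, sub_self] at this
  have hev := hqp.eventually (gt_mem_nhds hε')
  rw [Filter.eventually_prod_iff] at hev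
  obtain ⟨P1, hP1, P2, hP2, hP⟩ := hev
  -- No decay of `p T` is known, but it is the derivative of a bounded function, so it is frequently
  -- below `ε / 3` at `+∞` and frequently above `-ε / 3` at `-∞`.
  obtain ⟨R2, hR2, hR2P, hR2n⟩ := ((frequently_deriv_lt_atTop hW hWb hε').and_eventually
    (hP2.and (eventually_ge_atTop (n : ℝ)))).exists
  obtain ⟨R1, hR1, hR1P, hR1n⟩ := ((frequently_lt_deriv_atBot hW hWb hε').and_eventually
    (hP1.and (eventually_le_atBot (-n : ℝ)))).exists
  have hn0 : (0 : ℝ) ≤ n := Nat.cast_nonneg n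
  have hR : R1 ≤ R2 := by linarith
  have key : ∫ x in R1..R2, E x ≤ (∫ x, S x) + ε := by
    have h1 : ∫ x in R1..R2, E x ≤ ∫ x in R1..R2, (D' x + S x + (q x - p x)) :=
      intervalIntegral.integral_mono_on hR (hEc.intervalIntegrable _ _)
        (((hD'c.add hSc).add (hqc.sub hpc)).intervalIntegrable _ _) fun x _ => hpt x
    have i1 : IntervalIntegrable (fun x => D' x + S x) volume R1 R2 :=
      (hD'c.add hSc).intervalIntegrable _ _
    have i2 : IntervalIntegrable (fun x => q x - p x) volume R1 R2 :=
      (hqc.sub hpc).intervalIntegrable _ _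
    rw [intervalIntegral.integral_add i1 i2, intervalIntegral.integral_add
      (hD'c.intervalIntegrable _ _) (hSc.intervalIntegrable _ _),
      intervalIntegral.integral_eq_sub_of_hasDerivAt (fun x _ => hD x)
        (hD'c.intervalIntegrable _ _)] at h1
    have h2 : ∫ x in R1..R2, S x ≤ ∫ x, S x := by
      rw [intervalIntegral.integral_of_le hR]
      exact setIntegral_le_integral hSi (Eventually.of_forall hS0)
    have h3 := hP hR1P hR2P
    -- Because `R1 ≤ 0 ≤ R2`, the parts `-p R2 * R2` and `p R1 * R1` of the boundary terms have the
    -- favourable sign.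
    have h4 : p R2 * (T R2 - R2) ≤ ε / 3 := by nlinarith [hpos R2]
    have h5 : -(p R1 * (T R1 - R1)) ≤ ε / 3 := by nlinarith [hpos R1]
    simp only at h3
    linarith
  calc ∫⁻ x in Ioc (-n : ℝ) n, ENNReal.ofReal (E x)
      ≤ ∫⁻ x in Ioc R1 R2, ENNReal.ofReal (E x) :=
        lintegral_mono_set (Ioc_subset_Ioc hR1n hR2n)
    _ = ENNReal.ofReal (∫ x in Ioc R1 R2, E x) := by
        rw [ofReal_integral_eq_lintegral_ofReal _ (Eventually.of_forall hE0)]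
        exact (hEc.integrableOn_Icc).mono_set Ioc_subset_Icc_self
    _ ≤ ENNReal.ofReal ((∫ x, S x) + ε) := by
        rw [← intervalIntegral.integral_of_le hR]
        exact ENNReal.ofReal_le_ofReal key
    _ ≤ _ := by
        rw [ENNReal.ofReal_add (integral_nonneg hS0) ε.coe_nonneg,
          ofReal_integral_eq_lintegral_ofReal hSi (Eventually.of_forall hS0),
          ENNReal.ofReal_coe_nnreal]

end LFD

/-! ### Tensorization of entropy -/

namespace LFD

open Filter Topology Set ProbabilityTheory
open scoped NNReal

/-- Passes from a pointwise bound by a possibly non-integrable `r` to integrals, while `k` may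
change sign; in later uses the entropy on the right may be infinite. -/
theorem ofReal_integral_le_lintegral {α : Type*} [MeasurableSpace α] {μ : Measure α} {k r : α → ℝ}
    (hk : Integrable k μ) (hkr : ∀ᵐ x ∂μ, k x ≤ r x) :
    ENNReal.ofReal (∫ x, k x ∂μ) ≤ ∫⁻ x, ENNReal.ofReal (r x) ∂μ := by
  have h1 : ∫ x, k x ∂μ ≤ ∫ x, max (k x) 0 ∂μ :=
    integral_mono hk hk.pos_part fun x => le_max_left _ _
  calc ENNReal.ofReal (∫ x, k x ∂μ) ≤ ENNReal.ofReal (∫ x, max (k x) 0 ∂μ) :=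
        ENNReal.ofReal_le_ofReal h1
    _ = ∫⁻ x, ENNReal.ofReal (max (k x) 0) ∂μ :=
        ofReal_integral_eq_lintegral_ofReal hk.pos_part
          (Eventually.of_forall fun x => le_max_right _ _)
    _ ≤ _ := by
        refine lintegral_mono_ae (hkr.mono fun x hx => ?_)
        rw [ENNReal.ofReal_max, ENNReal.ofReal_zero, max_eq_left zero_le]
        exact ENNReal.ofReal_le_ofReal hx

/-- The three-point identity of a Bregman divergence. Its last term is linear in `a - b`, hence
integrates to zero when `b` is the mean of `a`. -/
theorem relEnt_chain {a b c : ℝ} (ha : 0 < a) (hb : 0 < b) (hc : 0 < c) :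
    relEnt a c = relEnt a b + relEnt b c + (a - b) * Real.log (b / c) := by
  unfold relEnt
  rw [Real.log_div ha.ne' hc.ne', Real.log_div ha.ne' hb.ne', Real.log_div hb.ne' hc.ne']
  ring

/-- The relative entropy density is convex and homogeneous: it lies above its tangents. -/
theorem tangent_le_relEnt {a b a₀ b₀ : ℝ} (ha : 0 < a) (hb : 0 < b) (ha₀ : 0 < a₀) (hb₀ : 0 < b₀) :
    a * Real.log (a₀ / b₀) + b * (1 - a₀ / b₀) ≤ relEnt a b := by
  have h := Real.log_le_sub_one_of_pos (show 0 < (a₀ / b₀) * (b / a) by positivity)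
  rw [Real.log_mul (by positivity) (by positivity)] at h
  have h2 : Real.log (a / b) = - Real.log (b / a) := by rw [← Real.log_inv, inv_div]
  have h3 := mul_le_mul_of_nonneg_left h ha.le
  have h4 : a * (a₀ / b₀ * (b / a) - 1) = b * (a₀ / b₀) - a := by field_simp
  unfold relEnt
  rw [h2]
  linarith

theorem relEnt_mul {a b c : ℝ} (hc : c ≠ 0) : relEnt (c * a) (c * b) = c * relEnt a b := by
  unfold relEnt
  rw [mul_div_mul_left _ _ hc]
  ring

theorem measurable_relEnt {α : Type*} [MeasurableSpace α] {f g : α → ℝ} (hf : Measurable f)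
    (hg : Measurable g) : Measurable fun x => relEnt (f x) (g x) := by
  unfold relEnt
  fun_prop

theorem integral_pos_of_pos {α : Type*} [MeasurableSpace α] {μ : Measure α} [NeZero μ] {f : α → ℝ}
    (hpos : ∀ x, 0 < f x) (hi : Integrable f μ) : 0 < ∫ x, f x ∂μ := by
  rw [integral_pos_iff_support_of_nonneg (fun x => (hpos x).le) hi]
  have : Function.support f = univ := eq_univ_of_forall fun x => (hpos x).ne'
  rw [this]
  exact NeZero.pos _

/-- Chain rule through the mean of `f`: the cross term of `relEnt_chain` has zero integral. -/
theorem lintegral_relEnt_le_add {X : Type*} [MeasurableSpace X] {μ : Measure X}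
    [IsProbabilityMeasure μ] {f : X → ℝ} (hf : Measurable f) (hpos : ∀ x, 0 < f x)
    (hi : Integrable f μ) {c : ℝ} (hc : 0 < c) :
    ∫⁻ x, ENNReal.ofReal (relEnt (f x) c) ∂μ ≤
      (∫⁻ x, ENNReal.ofReal (relEnt (f x) (∫ x, f x ∂μ)) ∂μ) +
        ENNReal.ofReal (relEnt (∫ x, f x ∂μ) c) := by
  set m := ∫ x, f x ∂μ with hmdef
  have hm : 0 < m := integral_pos_of_pos hpos hi
  rcases eq_or_ne (∫⁻ x, ENNReal.ofReal (relEnt (f x) m) ∂μ) ⊤ with htop | htop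
  · rw [htop, top_add]; exact le_top
  have h0 : ∀ x, 0 ≤ relEnt (f x) m := fun x => relEnt_nonneg (hpos x) hm
  have hi1 : Integrable (fun x => relEnt (f x) m) μ :=
    ⟨(measurable_relEnt hf measurable_const).aestronglyMeasurable, by
      rw [hasFiniteIntegral_iff_ofReal (Eventually.of_forall h0)]; exact htop.lt_top⟩
  have hi2 : Integrable (fun x => (f x - m) * Real.log (m / c)) μ :=
    (hi.sub (integrable_const m)).mul_const _
  have heq : ∀ x, relEnt (f x) c = relEnt (f x) m + relEnt m c + (f x - m) * Real.log (m / c) :=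
    fun x => relEnt_chain (hpos x) hm hc
  have hi3 : Integrable (fun x => relEnt (f x) c) μ := by
    simp_rw [heq]
    exact (hi1.add (integrable_const _)).add hi2
  rw [← ofReal_integral_eq_lintegral_ofReal hi3
      (Eventually.of_forall fun x => relEnt_nonneg (hpos x) hc),
    ← ofReal_integral_eq_lintegral_ofReal hi1 (Eventually.of_forall h0),
    ← ENNReal.ofReal_add (integral_nonneg h0) (relEnt_nonneg hm hc)]
  refine ENNReal.ofReal_le_ofReal (le_of_eq ?_)
  simp_rw [heq]
  have hi12 : Integrable (fun x => relEnt (f x) m + relEnt m c) μ := hi1.add (integrable_const _)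
  rw [integral_add hi12 hi2, integral_add hi1 (integrable_const _),
    integral_mul_const, integral_sub hi (integrable_const m)]
  simp [← hmdef]

/-- Subadditivity of the entropy on a product of two probability spaces. -/
theorem lintegral_relEnt_prod_le {X Y : Type*} [MeasurableSpace X] [MeasurableSpace Y]
    {μ : Measure X} {ν : Measure Y} [IsProbabilityMeasure μ] [IsProbabilityMeasure ν]
    {F : X × Y → ℝ} (hF : Measurable F) (hpos : ∀ z, 0 < F z) (hint : Integrable F (μ.prod ν)) :
    ∫⁻ z, ENNReal.ofReal (relEnt (F z) (∫ z, F z ∂(μ.prod ν))) ∂(μ.prod ν) ≤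
      (∫⁻ y, ∫⁻ x, ENNReal.ofReal (relEnt (F (x, y)) (∫ x, F (x, y) ∂μ)) ∂μ ∂ν) +
      ∫⁻ x, ∫⁻ y, ENNReal.ofReal (relEnt (F (x, y)) (∫ y, F (x, y) ∂ν)) ∂ν ∂μ := by
  set Z := ∫ z, F z ∂(μ.prod ν) with hZdef
  have hZ : 0 < Z := integral_pos_of_pos hpos hint
  set A := fun x => ∫ y, F (x, y) ∂ν with hA
  set B := fun y => ∫ x, F (x, y) ∂μ with hB
  have hAm : Measurable A := (hF.stronglyMeasurable.integral_prod_right').measurable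
  have hBm : Measurable B := (hF.stronglyMeasurable.integral_prod_left').measurable
  have hAi : Integrable A μ := hint.integral_prod_left
  have hAZ : ∫ x, A x ∂μ = Z := (integral_prod F hint).symm
  have hBi : ∀ᵐ y ∂ν, Integrable (fun x => F (x, y)) μ := hint.prod_left_ae
  have hAi' : ∀ᵐ x ∂μ, Integrable (fun y => F (x, y)) ν := hint.prod_right_ae
  have hBpos : ∀ᵐ y ∂ν, 0 < B y := hBi.mono fun y hy => integral_pos_of_pos (fun x => hpos _) hy
  have hApos : ∀ᵐ x ∂μ, 0 < A x := hAi'.mono fun y hy => integral_pos_of_pos (fun x => hpos _) hy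
  have h1 : ∫⁻ z, ENNReal.ofReal (relEnt (F z) Z) ∂(μ.prod ν) ≤
      ∫⁻ y, ((∫⁻ x, ENNReal.ofReal (relEnt (F (x, y)) (B y)) ∂μ) +
        ENNReal.ofReal (relEnt (B y) Z)) ∂ν := by
    rw [lintegral_prod_symm' _ (measurable_relEnt hF measurable_const).ennreal_ofReal]
    refine lintegral_mono_ae (hBi.mono fun y hy => ?_)
    exact lintegral_relEnt_le_add (hF.comp measurable_prodMk_right) (fun x => hpos _) hy hZ
  have hEm : Measurable fun y => ENNReal.ofReal (relEnt (B y) Z) :=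
    (measurable_relEnt hBm measurable_const).ennreal_ofReal
  rw [lintegral_add_right _ hEm] at h1
  refine h1.trans (add_le_add_right ?_ _)
  have hswap : ∫⁻ x, ∫⁻ y, ENNReal.ofReal (relEnt (F (x, y)) (A x)) ∂ν ∂μ =
      ∫⁻ y, ∫⁻ x, ENNReal.ofReal (relEnt (F (x, y)) (A x)) ∂μ ∂ν := by
    refine lintegral_lintegral_swap ?_
    exact (measurable_relEnt hF (hAm.comp measurable_fst)).ennreal_ofReal.aemeasurable
  change _ ≤ ∫⁻ x, ∫⁻ y, ENNReal.ofReal (relEnt (F (x, y)) (A x)) ∂ν ∂μ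
  rw [hswap]
  refine lintegral_mono_ae ?_
  filter_upwards [hBi, hBpos] with y hy hBy
  -- Jensen's inequality for the jointly convex `relEnt`: this is its tangent at `(B y, Z)`,
  -- evaluated at `(F (x, y), A x)`. Since the means in `x` are `B y` and `Z`, its integral is
  -- exactly `relEnt (B y) Z`.
  have hk : Integrable (fun x => F (x, y) * Real.log (B y / Z) + A x * (1 - B y / Z)) μ :=
    (hy.mul_const _).add (hAi.mul_const _)
  have heq : relEnt (B y) Z =
      ∫ x, (F (x, y) * Real.log (B y / Z) + A x * (1 - B y / Z)) ∂μ := by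
    rw [integral_add (hy.mul_const _) (hAi.mul_const _), integral_mul_const, integral_mul_const,
      hAZ]
    change _ = B y * _ + _
    unfold relEnt
    field_simp
    ring
  rw [heq]
  refine ofReal_integral_le_lintegral hk ?_
  filter_upwards [hApos] with x hx
  exact tangent_le_relEnt (hpos _) hx hBy hZ

/-- Gaussian logarithmic Sobolev inequality on the line, for densities with respect to the
Gaussian measure. -/
theorem logSobolev_gaussianReal (v : ℝ≥0) (hv : v ≠ 0) {F F' : ℝ → ℝ}
    (hF : ∀ x, HasDerivAt F (F' x) x) (hF' : Continuous F') (hpos : ∀ x, 0 < F x)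
    (hi : Integrable F (gaussianReal 0 v)) :
    ∫⁻ x, ENNReal.ofReal (relEnt (F x) (∫ t, F t ∂(gaussianReal 0 v))) ∂(gaussianReal 0 v) ≤
      ∫⁻ x, ENNReal.ofReal (v / 2 * (F' x ^ 2 / F x)) ∂(gaussianReal 0 v) := by
  have hFc : Continuous F := continuous_iff_continuousAt.2 fun x => (hF x).continuousAt
  have hγ0 : ∀ x, 0 < gaussianPDFReal 0 v x := fun x => gaussianPDFReal_pos 0 v x hv
  have hγc := continuous_gaussianPDFReal v hv
  have hlint : ∀ f : ℝ → ℝ, Measurable f → ∫⁻ x, ENNReal.ofReal (f x) ∂(gaussianReal 0 v) =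
      ∫⁻ x, ENNReal.ofReal (gaussianPDFReal 0 v x * f x) := by
    intro f hf
    rw [gaussianReal_of_var_ne_zero _ hv, lintegral_withDensity_eq_lintegral_mul _
      (measurable_gaussianPDF 0 v) hf.ennreal_ofReal]
    refine lintegral_congr fun x => ?_
    rw [ENNReal.ofReal_mul (hγ0 x).le]
    rfl
  have hne : ∀ x, F x ≠ 0 := fun x => (hpos x).ne'
  have hpi : Integrable (fun x => gaussianPDFReal 0 v x * F x) := by
    rw [gaussianReal_of_var_ne_zero _ hv, integrable_withDensity_iff_integrable_smul'
      (measurable_gaussianPDF 0 v) (Eventually.of_forall fun x => gaussianPDF_lt_top)] at hi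
    simpa only [toReal_gaussianPDF, smul_eq_mul] using hi
  have hm : ∫ t, F t ∂(gaussianReal 0 v) = ∫ t, gaussianPDFReal 0 v t * F t := by
    rw [integral_gaussianReal_eq_integral_smul hv]
    rfl
  have hd : ∀ x, HasDerivAt (fun x => gaussianPDFReal 0 v x * F x)
      (-(x / v) * gaussianPDFReal 0 v x * F x + gaussianPDFReal 0 v x * F' x) x := fun x =>
    (hasDerivAt_gaussianPDFReal v hv x).mul (hF x)
  -- For `p` equal to the Gaussian density times `F`, the drift cancels: `p'/p + x/v = F'/F`.
  have h := logSobolev_real v hv hd (by fun_prop) (fun x => mul_pos (hγ0 x) (hpos x)) hpi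
  rw [hlint _ (measurable_relEnt hFc.measurable measurable_const), hlint _ (by fun_prop)]
  convert h using 4 with x x
  · rw [hm, mul_comm (∫ t, _), relEnt_mul (hγ0 x).ne']
  · have h1 := (hγ0 x).ne'
    have h2 := hne x
    have h3 : (v : ℝ) ≠ 0 := by positivity
    field_simp
    ring

end LFD

/-! ### From the line to three dimensions -/

namespace LFD

open Filter Topology Set ProbabilityTheory
open scoped NNReal

/-- Gaussian logarithmic Sobolev inequality in the plane. -/
theorem logSobolev_gaussian_prod (v : ℝ≥0) (hv : v ≠ 0) {F F₁ F₂ : ℝ × ℝ → ℝ} (hF : Continuous F)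
    (hF₁ : Continuous F₁) (hF₂ : Continuous F₂)
    (hd₁ : ∀ x y, HasDerivAt (fun t => F (t, y)) (F₁ (x, y)) x)
    (hd₂ : ∀ x y, HasDerivAt (fun t => F (x, t)) (F₂ (x, y)) y)
    (hpos : ∀ z, 0 < F z) (hi : Integrable F ((gaussianReal 0 v).prod (gaussianReal 0 v))) :
    ∫⁻ z, ENNReal.ofReal (relEnt (F z) (∫ z, F z ∂((gaussianReal 0 v).prod (gaussianReal 0 v))))
        ∂((gaussianReal 0 v).prod (gaussianReal 0 v)) ≤
      ∫⁻ z, ENNReal.ofReal (v / 2 * ((F₁ z ^ 2 + F₂ z ^ 2) / F z))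
        ∂((gaussianReal 0 v).prod (gaussianReal 0 v)) := by
  set γ := gaussianReal 0 v
  have hne : ∀ z, F z ≠ 0 := fun z => (hpos z).ne'
  refine (lintegral_relEnt_prod_le hF.measurable hpos hi).trans ?_
  have h1 : ∫⁻ y, ∫⁻ x, ENNReal.ofReal (relEnt (F (x, y)) (∫ x, F (x, y) ∂γ)) ∂γ ∂γ ≤
      ∫⁻ z, ENNReal.ofReal (v / 2 * (F₁ z ^ 2 / F z)) ∂(γ.prod γ) := by
    rw [lintegral_prod_symm' _ (by fun_prop)]
    refine lintegral_mono_ae (hi.prod_left_ae.mono fun y hy => ?_)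
    exact logSobolev_gaussianReal v hv (fun x => hd₁ x y) (by fun_prop) (fun x => hpos _) hy
  have h2 : ∫⁻ x, ∫⁻ y, ENNReal.ofReal (relEnt (F (x, y)) (∫ y, F (x, y) ∂γ)) ∂γ ∂γ ≤
      ∫⁻ z, ENNReal.ofReal (v / 2 * (F₂ z ^ 2 / F z)) ∂(γ.prod γ) := by
    rw [lintegral_prod _ (by fun_prop)]
    refine lintegral_mono_ae (hi.prod_right_ae.mono fun x hx => ?_)
    exact logSobolev_gaussianReal v hv (fun y => hd₂ x y) (by fun_prop) (fun x => hpos _) hx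
  refine (add_le_add h1 h2).trans (le_of_eq ?_)
  rw [← lintegral_add_right _ (by fun_prop)]
  refine lintegral_congr fun z => ?_
  have := hpos z
  rw [← ENNReal.ofReal_add (by positivity) (by positivity)]
  congr 1
  ring

/-- Gaussian logarithmic Sobolev inequality in three dimensions. -/
theorem logSobolev_gaussian_prod_prod (v : ℝ≥0) (hv : v ≠ 0) {F F₁ F₂ F₃ : ℝ × ℝ × ℝ → ℝ}
    (hF : Continuous F) (hF₁ : Continuous F₁) (hF₂ : Continuous F₂) (hF₃ : Continuous F₃)
    (hd₁ : ∀ x y z, HasDerivAt (fun t => F (t, y, z)) (F₁ (x, y, z)) x)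
    (hd₂ : ∀ x y z, HasDerivAt (fun t => F (x, t, z)) (F₂ (x, y, z)) y)
    (hd₃ : ∀ x y z, HasDerivAt (fun t => F (x, y, t)) (F₃ (x, y, z)) z)
    (hpos : ∀ z, 0 < F z)
    (hi : Integrable F ((gaussianReal 0 v).prod ((gaussianReal 0 v).prod (gaussianReal 0 v)))) :
    ∫⁻ p, ENNReal.ofReal (relEnt (F p)
        (∫ p, F p ∂((gaussianReal 0 v).prod ((gaussianReal 0 v).prod (gaussianReal 0 v)))))
        ∂((gaussianReal 0 v).prod ((gaussianReal 0 v).prod (gaussianReal 0 v))) ≤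
      ∫⁻ p, ENNReal.ofReal (v / 2 * ((F₁ p ^ 2 + F₂ p ^ 2 + F₃ p ^ 2) / F p))
        ∂((gaussianReal 0 v).prod ((gaussianReal 0 v).prod (gaussianReal 0 v))) := by
  set γ := gaussianReal 0 v
  have hne : ∀ z, F z ≠ 0 := fun z => (hpos z).ne'
  refine (lintegral_relEnt_prod_le hF.measurable hpos hi).trans ?_
  have h1 : ∫⁻ y, ∫⁻ x, ENNReal.ofReal (relEnt (F (x, y)) (∫ x, F (x, y) ∂γ)) ∂γ ∂(γ.prod γ) ≤
      ∫⁻ z, ENNReal.ofReal (v / 2 * (F₁ z ^ 2 / F z)) ∂(γ.prod (γ.prod γ)) := by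
    rw [lintegral_prod_symm' (fun z => ENNReal.ofReal (v / 2 * (F₁ z ^ 2 / F z))) (by fun_prop)]
    refine lintegral_mono_ae (hi.prod_left_ae.mono fun y hy => ?_)
    exact logSobolev_gaussianReal v hv (fun x => hd₁ x y.1 y.2) (by fun_prop) (fun x => hpos _) hy
  have h2 : ∫⁻ x, ∫⁻ y, ENNReal.ofReal (relEnt (F (x, y)) (∫ y, F (x, y) ∂(γ.prod γ))) ∂(γ.prod γ) ∂γ ≤
      ∫⁻ z, ENNReal.ofReal (v / 2 * ((F₂ z ^ 2 + F₃ z ^ 2) / F z)) ∂(γ.prod (γ.prod γ)) := by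
    rw [lintegral_prod _ (by fun_prop)]
    refine lintegral_mono_ae (hi.prod_right_ae.mono fun x hx => ?_)
    exact logSobolev_gaussian_prod v hv (F := fun p => F (x, p)) (F₁ := fun p => F₂ (x, p))
      (F₂ := fun p => F₃ (x, p)) (by fun_prop) (by fun_prop) (by fun_prop)
      (fun y z => hd₂ x y z) (fun y z => hd₃ x y z) (fun x => hpos _) hx
  refine (add_le_add h1 h2).trans (le_of_eq ?_)
  rw [← lintegral_add_right _ (by fun_prop)]
  refine lintegral_congr fun z => ?_
  have := hpos z
  rw [← ENNReal.ofReal_add (by positivity) (by positivity)]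
  congr 1
  ring

theorem measurePreserving_coords :
    MeasurePreserving (fun v : V => ((v 0, v 1, v 2) : ℝ × ℝ × ℝ)) volume volume := by
  have h1 := EuclideanSpace.volume_preserving_symm_measurableEquiv_toLp (Fin 3)
  have h2 := volume_preserving_piFinSuccAbove (fun _ : Fin 3 => ℝ) 0
  have h3 := (MeasurePreserving.id (volume : Measure ℝ)).prod (volume_preserving_finTwoArrow ℝ)
  exact (h3.comp h2).comp h1

/-- The isotropic centred Gaussian density of variance `θ` in three dimensions. -/
noncomputable def gaussDensity (θ : ℝ≥0) (x : V) : ℝ :=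
  gaussianPDFReal 0 θ (x 0) * (gaussianPDFReal 0 θ (x 1) * gaussianPDFReal 0 θ (x 2))

theorem gaussDensity_pos {θ : ℝ≥0} (hθ : θ ≠ 0) (x : V) : 0 < gaussDensity θ x :=
  mul_pos (gaussianPDFReal_pos 0 θ _ hθ)
    (mul_pos (gaussianPDFReal_pos 0 θ _ hθ) (gaussianPDFReal_pos 0 θ _ hθ))

theorem norm_sq_eq (x : V) : ‖x‖ ^ 2 = x 0 ^ 2 + x 1 ^ 2 + x 2 ^ 2 := by
  rw [EuclideanSpace.norm_sq_eq, Fin.sum_univ_three]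
  simp

theorem log_gaussDensity {θ : ℝ≥0} (hθ : θ ≠ 0) (x : V) :
    Real.log (gaussDensity θ x) =
      3 * Real.log ((√(2 * Real.pi * θ))⁻¹) - ‖x‖ ^ 2 / (2 * θ) := by
  have hθ' : (0 : ℝ) < θ := by positivity
  have hs : (√(2 * Real.pi * θ))⁻¹ ≠ 0 := by positivity
  have h : ∀ t, Real.log (gaussianPDFReal 0 θ t) =
      Real.log ((√(2 * Real.pi * θ))⁻¹) - t ^ 2 / (2 * θ) := by
    intro t
    unfold gaussianPDFReal
    rw [Real.log_mul hs (Real.exp_pos _).ne', Real.log_exp]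
    ring
  have hp := fun t => (gaussianPDFReal_pos 0 θ t hθ).ne'
  unfold gaussDensity
  rw [Real.log_mul (hp _) (mul_ne_zero (hp _) (hp _)), Real.log_mul (hp _) (hp _), h, h, h,
    norm_sq_eq]
  ring

theorem lintegral_gaussian_prod {θ : ℝ≥0} (hθ : θ ≠ 0) {f : ℝ × ℝ × ℝ → ℝ≥0∞} (hf : Measurable f) :
    ∫⁻ p, f p ∂((gaussianReal 0 θ).prod ((gaussianReal 0 θ).prod (gaussianReal 0 θ))) =
      ∫⁻ x : V, ENNReal.ofReal (gaussDensity θ x) * f (x 0, x 1, x 2) := by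
  have hm : Measurable (gaussianPDF 0 θ) := measurable_gaussianPDF 0 θ
  rw [gaussianReal_of_var_ne_zero _ hθ, prod_withDensity hm hm,
    prod_withDensity hm (by fun_prop), lintegral_withDensity_eq_lintegral_mul _ (by fun_prop) hf]
  change ∫⁻ p, _ ∂(volume : Measure (ℝ × ℝ × ℝ)) = _
  rw [← measurePreserving_coords.lintegral_comp (by fun_prop)]
  refine lintegral_congr fun x => ?_
  have hp := fun t => gaussianPDFReal_nonneg 0 θ t
  simp only [Pi.mul_apply, gaussDensity, gaussianPDF]
  rw [ENNReal.ofReal_mul (hp _), ENNReal.ofReal_mul (hp _)]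

end LFD

/-! ### Logarithmic Sobolev inequality with respect to Lebesgue measure -/

namespace LFD

open Filter Topology Set ProbabilityTheory
open scoped NNReal

theorem inner_gradient {φ : V → ℝ} (x y : V) : inner ℝ y (gradient φ x) = fderiv ℝ φ x y := by
  rw [real_inner_comm, gradient, InnerProductSpace.toDual_symm_apply]

theorem gradient_apply {φ : V → ℝ} (x : V) (i : Fin 3) :
    gradient φ x i = fderiv ℝ φ x (EuclideanSpace.single i 1) := by
  rw [← inner_gradient, EuclideanSpace.inner_single_left]
  simp

/-- **Gaussian logarithmic Sobolev inequality** in three dimensions, with respect to Lebesgue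
measure. -/
theorem logSobolev {θ : ℝ≥0} (hθ : θ ≠ 0) {φ : V → ℝ} (hφ : ContDiff ℝ 1 φ) (hpos : ∀ x, 0 < φ x)
    (hi : Integrable φ) :
    ∫⁻ x, ENNReal.ofReal (relEnt (φ x) ((∫ y, φ y) * gaussDensity θ x)) ≤
      ∫⁻ x, ENNReal.ofReal
        (θ / 2 * (φ x * ‖(φ x)⁻¹ • gradient φ x + (θ : ℝ)⁻¹ • x‖ ^ 2)) := by
  have hθ' : (θ : ℝ) ≠ 0 := by positivity
  set γ := gaussianReal 0 θ with hγ
  set mk : ℝ × ℝ × ℝ → V := fun p => !₂[p.1, p.2.1, p.2.2] with hmk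
  have hmkx : ∀ x : V, mk (x 0, x 1, x 2) = x := by
    intro x
    ext i
    fin_cases i <;> simp [hmk]
  have hmkc : Continuous mk := by
    refine (PiLp.continuous_toLp 2 _).comp (continuous_pi fun i => ?_)
    fin_cases i <;> simp <;> fun_prop
  set q : ℝ → ℝ := fun t => (gaussianPDFReal 0 θ t)⁻¹ with hq
  have hg0 : ∀ t, 0 < gaussianPDFReal 0 θ t := fun t => gaussianPDFReal_pos 0 θ t hθ
  have hq0 : ∀ t, 0 < q t := fun t => inv_pos.2 (hg0 t)
  have hqd : ∀ t, HasDerivAt q (t / θ * q t) t := by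
    intro t
    refine ((hasDerivAt_gaussianPDFReal θ hθ t).inv (hg0 t).ne').congr_deriv ?_
    have := (hg0 t).ne'
    simp only [hq]
    field_simp
  have hqc : Continuous q := continuous_iff_continuousAt.2 fun x => (hqd x).continuousAt
  set Q : ℝ × ℝ × ℝ → ℝ := fun p => q p.1 * (q p.2.1 * q p.2.2) with hQ
  have hQc : Continuous Q := by fun_prop
  have hQ0 : ∀ p, 0 < Q p := fun p => mul_pos (hq0 _) (mul_pos (hq0 _) (hq0 _))
  have hQG : ∀ x : V, Q (x 0, x 1, x 2) = (gaussDensity θ x)⁻¹ := by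
    intro x
    simp only [hQ, hq, gaussDensity, mul_inv]
  have hfc : ∀ y : V, Continuous fun x => fderiv ℝ φ x y := fun y =>
    (hφ.continuous_fderiv one_ne_zero).clm_apply continuous_const
  have hφd : ∀ x, HasFDerivAt φ (fderiv ℝ φ x) x := fun x =>
    (hφ.differentiable one_ne_zero x).hasFDerivAt
  set d : Fin 3 → ℝ × ℝ × ℝ → ℝ := fun i p => fderiv ℝ φ (mk p) (EuclideanSpace.single i 1) with hd
  have hdc : ∀ i, Continuous (d i) := fun i => (hfc _).comp hmkc
  -- The density of `φ` relative to the Gaussian, in coordinates. Each partial derivative gains `x_i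
  -- / θ` from the reciprocal Gaussian `Q`, which produces the shift `x / θ` in the Fisher
  -- information.
  set F : ℝ × ℝ × ℝ → ℝ := fun p => φ (mk p) * Q p with hF
  set F' : Fin 3 → (ℝ × ℝ × ℝ → ℝ) → ℝ × ℝ × ℝ → ℝ :=
    fun i c p => (d i p + c p / θ * φ (mk p)) * Q p with hF'
  have hφmk : Continuous fun p => φ (mk p) := hφ.continuous.comp hmkc
  have hF'c : ∀ i c, Continuous c → Continuous (F' i c) := by
    intro i c hc
    have := hdc i
    simp only [hF', div_eq_mul_inv]
    fun_prop
  have hcurve : ∀ (i : Fin 3) (c : ℝ → ℝ × ℝ × ℝ) (s : ℝ),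
      (∀ t, mk (c t) = mk (c s) + (t - s) • EuclideanSpace.single i (1 : ℝ)) →
      HasDerivAt (fun t => φ (mk (c t))) (d i (c s)) s := by
    intro i c s h
    have h1 : HasDerivAt (fun t => mk (c t)) (EuclideanSpace.single i (1 : ℝ)) s := by
      rw [funext h]
      simpa using (((hasDerivAt_id s).sub_const s).smul_const
        (EuclideanSpace.single i (1 : ℝ))).const_add (mk (c s))
    exact (hφd (mk (c s))).comp_hasDerivAt s h1
  have hpos' : ∀ p, 0 < F p := fun p => mul_pos (hpos _) (hQ0 p)
  have hFx : ∀ x : V, gaussDensity θ x * F (x 0, x 1, x 2) = φ x := by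
    intro x
    have := (gaussDensity_pos hθ x).ne'
    simp only [hF, hmkx, hQG]
    field_simp
  have hFc : Continuous F := by fun_prop
  have hlF : ∫⁻ p, ENNReal.ofReal (F p) ∂(γ.prod (γ.prod γ)) = ∫⁻ x, ENNReal.ofReal (φ x) := by
    rw [lintegral_gaussian_prod hθ (by fun_prop)]
    refine lintegral_congr fun x => ?_
    rw [← ENNReal.ofReal_mul (gaussDensity_pos hθ x).le, hFx]
  have hFi : Integrable F (γ.prod (γ.prod γ)) := by
    refine ⟨hFc.aestronglyMeasurable, ?_⟩
    rw [hasFiniteIntegral_iff_ofReal (Eventually.of_forall fun p => (hpos' p).le), hlF,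
      ← hasFiniteIntegral_iff_ofReal (Eventually.of_forall fun p => (hpos p).le)]
    exact hi.2
  have hZ : ∫ p, F p ∂(γ.prod (γ.prod γ)) = ∫ x, φ x := by
    rw [integral_eq_lintegral_of_nonneg_ae (Eventually.of_forall fun p => (hpos' p).le)
      hFc.aestronglyMeasurable, hlF, ← integral_eq_lintegral_of_nonneg_ae
      (Eventually.of_forall fun p => (hpos p).le) hi.1]
  have key := logSobolev_gaussian_prod_prod θ hθ (F := F) (F₁ := F' 0 fun p => p.1)
    (F₂ := F' 1 fun p => p.2.1) (F₃ := F' 2 fun p => p.2.2) hFc (hF'c _ _ (by fun_prop))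
    (hF'c _ _ (by fun_prop)) (hF'c _ _ (by fun_prop))
    (fun x y z => by
      refine ((hcurve 0 (fun t => (t, y, z)) x fun t => ?_).mul
        ((hqd x).mul_const (q y * q z))).congr_deriv ?_
      · ext i; fin_cases i <;> simp [hmk]
      · simp only [hF', hQ]; ring)
    (fun x y z => by
      refine ((hcurve 1 (fun t => (x, t, z)) y fun t => ?_).mul
        (((hqd y).mul_const (q z)).const_mul (q x))).congr_deriv ?_
      · ext i; fin_cases i <;> simp [hmk]
      · simp only [hF', hQ]; ring)
    (fun x y z => by
      refine ((hcurve 2 (fun t => (x, y, t)) z fun t => ?_).mul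
        (((hqd z).const_mul (q y)).const_mul (q x))).congr_deriv ?_
      · ext i; fin_cases i <;> simp [hmk]
      · simp only [hF', hQ]; ring) hpos' hFi
  rw [lintegral_gaussian_prod hθ (measurable_relEnt hFc.measurable measurable_const).ennreal_ofReal,
    lintegral_gaussian_prod hθ (by
      have h0 := hF'c 0 (fun p => p.1) (by fun_prop)
      have h1 := hF'c 1 (fun p => p.2.1) (by fun_prop)
      have h2 := hF'c 2 (fun p => p.2.2) (by fun_prop)
      fun_prop), hZ] at key
  convert key using 3 with x x
  · rw [← ENNReal.ofReal_mul (gaussDensity_pos hθ x).le, ← relEnt_mul (gaussDensity_pos hθ x).ne',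
      hFx, mul_comm (∫ y, φ y)]
  · rw [← ENNReal.ofReal_mul (gaussDensity_pos hθ x).le]
    congr 1
    have h1 := (gaussDensity_pos hθ x).ne'
    have h2 := (hpos x).ne'
    rw [norm_sq_eq]
    simp only [hF', hF, hd, hmkx, hQG, PiLp.add_apply, PiLp.smul_apply, smul_eq_mul,
      gradient_apply]
    field_simp

end LFD

/-! ### Fermi-Dirac entropy against Boltzmann relative entropy -/

namespace LFD

open Filter Topology Set ProbabilityTheory
open scoped NNReal

theorem entropyDensity_of_pos {ε x : ℝ} (hε : 0 < ε) (hx : 0 < x) (hx1 : ε * x < 1) :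
    entropyDensity ε x = x * Real.log ε + x * Real.log (x / (1 - ε * x)) +
      ε⁻¹ * Real.log (1 - ε * x) := by
  have h1 : 0 < 1 - ε * x := by linarith
  unfold entropyDensity
  rw [if_neg hε.ne', Real.log_mul hε.ne' hx.ne', Real.log_div hx.ne' h1.ne']
  field_simp
  ring

/-- Gibbs' inequality for the Fermi-Dirac entropy density. -/
theorem affine_le_entropyDensity {ε y N : ℝ} (hε : 0 < ε) (hy : 0 < y) (hy1 : ε * y < 1)
    (hN : 0 < N) :
    y * Real.log ε + y * Real.log N - ε⁻¹ * Real.log (1 + ε * N) ≤ entropyDensity ε y := by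
  have h1 : 0 < 1 - ε * y := by linarith
  have h2 : 0 < 1 + ε * N := by positivity
  -- Two-state Gibbs inequality: the occupation probabilities `εy, 1 - εy` are compared with `εN /
  -- (1 + εN), 1 / (1 + εN)`. The linear remainders cancel in `he1` because both pairs sum to one.
  have hl1 := Real.log_le_sub_one_of_pos (show 0 < N / y / (1 + ε * N) by positivity)
  have hl2 := Real.log_le_sub_one_of_pos (show 0 < 1 / (1 - ε * y) / (1 + ε * N) by positivity)
  rw [Real.log_div (by positivity) h2.ne', Real.log_div hN.ne' hy.ne'] at hl1
  rw [Real.log_div (by positivity) h2.ne', Real.log_div one_ne_zero h1.ne', Real.log_one] at hl2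
  rw [entropyDensity_of_pos hε hy hy1, Real.log_div hy.ne' h1.ne']
  have hm1 := mul_le_mul_of_nonneg_left hl1 hy.le
  have hm2 := mul_le_mul_of_nonneg_left hl2 (show 0 ≤ ε⁻¹ * (1 - ε * y) by positivity)
  have he1 : y * (N / y / (1 + ε * N) - 1) + ε⁻¹ * (1 - ε * y) * (1 / (1 - ε * y) / (1 + ε * N) - 1)
      = 0 := by
    have key : ∀ s : ℝ, 0 < s → s = 1 - ε * y →
        y * (N / y / (1 + ε * N) - 1) + ε⁻¹ * s * (1 / s / (1 + ε * N) - 1) = 0 := by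
      intro s hs h
      field_simp
      linear_combination -(1 + ε * N) * h
    exact key _ h1 rfl
  have he2 : ε⁻¹ * (1 - ε * y) * (0 - Real.log (1 - ε * y) - Real.log (1 + ε * N)) =
      - (ε⁻¹ * Real.log (1 - ε * y)) - ε⁻¹ * Real.log (1 + ε * N) + y * Real.log (1 - ε * y)
      + y * Real.log (1 + ε * N) := by
    field_simp
    ring
  rw [he2] at hm2
  linarith

/-- The affine part is the tangent of the entropy density at `N / (1 + εN)`, so the claim says that
`u ↦ u / (1 + εu)` does not increase relative entropy. With `u = x / (1 - εx)`, it is the sum of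
`log s ≤ s - 1` for `s = N / u`, with weight `u - x ≥ 0`, and for `s = (1 + εN) / (1 + εu)`, with
weight `1/ε`. -/
theorem entropyDensity_le_affine_add_relEnt {ε x N : ℝ} (hε : 0 < ε) (hx : 0 < x) (hx1 : ε * x < 1)
    (hN : 0 < N) :
    entropyDensity ε x ≤ x * Real.log ε + x * Real.log N - ε⁻¹ * Real.log (1 + ε * N) +
      relEnt (x / (1 - ε * x)) N := by
  have h1 : 0 < 1 - ε * x := by linarith
  have h2 : 0 < 1 + ε * N := by positivity
  rw [entropyDensity_of_pos hε hx hx1]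
  set u := x / (1 - ε * x) with hu
  have hu0 : 0 < u := by positivity
  have hux : u * (1 - ε * x) = x := div_mul_cancel₀ _ h1.ne'
  have hxu : x = u / (1 + ε * u) := by
    rw [eq_div_iff (by positivity)]
    linear_combination -hux
  have h3 : 1 - ε * x = (1 + ε * u)⁻¹ :=
    eq_inv_of_mul_eq_one_left (by linear_combination ε * hux)
  have h4 : 0 < 1 + ε * u := by positivity
  have hl1 := Real.log_le_sub_one_of_pos (show 0 < N / u by positivity)
  have hl2 := Real.log_le_sub_one_of_pos (show 0 < (1 + ε * N) / (1 + ε * u) by positivity)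
  rw [Real.log_div hN.ne' hu0.ne'] at hl1
  rw [Real.log_div h2.ne' h4.ne'] at hl2
  unfold relEnt
  rw [h3, Real.log_inv, Real.log_div hu0.ne' hN.ne']
  have hm1 := mul_le_mul_of_nonneg_left hl1 (show 0 ≤ u - x by
    rw [hxu, sub_nonneg]; exact div_le_self hu0.le (by linarith [mul_pos hε hu0]))
  have hm2 := mul_le_mul_of_nonneg_left hl2 (inv_pos.2 hε).le
  have he : (u - x) * (N / u - 1) + ε⁻¹ * ((1 + ε * N) / (1 + ε * u) - 1) = N - u := by
    rw [hxu]; field_simp; ring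
  linarith

/-- The entropy difference is controlled by an affine function of `log N` and a Boltzmann relative
entropy with respect to `N`. -/
theorem entropyDensity_sub_le {ε : ℝ} (hε : 0 ≤ ε) : ∃ c : ℝ, ∀ x y N : ℝ, 0 < x → ε * x < 1 →
    0 < y → ε * y < 1 → 0 < N →
    entropyDensity ε x - entropyDensity ε y ≤
      (x - y) * (Real.log N + c) + relEnt (x / (1 - ε * x)) N := by
  rcases hε.eq_or_lt with rfl | hε
  -- The constant `1` compensates the term `-x` in `relEnt`; what remains is `y log (N / y) ≤ N -
  -- y`.
  · refine ⟨1, fun x y N hx _ hy _ hN => ?_⟩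
    have hl := mul_le_mul_of_nonneg_left (Real.log_le_sub_one_of_pos (div_pos hN hy)) hy.le
    rw [Real.log_div hN.ne' hy.ne'] at hl
    have he : y * (N / y - 1) = N - y := by field_simp
    simp only [entropyDensity, if_true, zero_mul, sub_zero, div_one, relEnt]
    rw [Real.log_div hx.ne' hN.ne']
    linarith
  · refine ⟨Real.log ε, fun x y N hx hx1 hy hy1 hN => ?_⟩
    have h1 := affine_le_entropyDensity hε hy hy1 hN
    have h2 := entropyDensity_le_affine_add_relEnt hε hx hx1 hN
    linarith

section FermiDirac

variable {ε a b : ℝ}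

theorem fermiDirac_pos (hε : 0 ≤ ε) (ha : 0 < a) (v : V) : 0 < fermiDirac ε a b v := by
  unfold fermiDirac; positivity

theorem mul_fermiDirac_lt_one (hε : 0 ≤ ε) (ha : 0 < a) (v : V) : ε * fermiDirac ε a b v < 1 := by
  unfold fermiDirac
  have : 0 < a * Real.exp (-b * ‖v‖ ^ 2) := by positivity
  rw [← mul_div_assoc, div_lt_one (by positivity)]
  linarith

theorem fermiDirac_div (hε : 0 ≤ ε) (ha : 0 < a) (v : V) :
    fermiDirac ε a b v / (1 - ε * fermiDirac ε a b v) = a * Real.exp (-b * ‖v‖ ^ 2) := by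
  unfold fermiDirac
  have : 0 < a * Real.exp (-b * ‖v‖ ^ 2) := by positivity
  have h2 : 0 < 1 + ε * (a * Real.exp (-b * ‖v‖ ^ 2)) := by positivity
  field_simp
  ring

theorem contDiff_fermiDirac (hε : 0 ≤ ε) (ha : 0 < a) : ContDiff ℝ 1 (fermiDirac ε a b) := by
  have h : ∀ v : V, 1 + ε * (a * Real.exp (-b * ‖v‖ ^ 2)) ≠ 0 := fun v => by positivity
  have h2 : ContDiff ℝ 1 fun v : V => a * Real.exp (-b * ‖v‖ ^ 2) :=
    contDiff_const.mul ((contDiff_const.mul (contDiff_norm_sq ℝ)).exp)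
  unfold fermiDirac
  exact h2.div (contDiff_const.add (contDiff_const.mul h2)) h

theorem IsFermiDiracParam.integrable (h : IsFermiDiracParam ε a b) :
    Integrable (fermiDirac ε a b) := by
  by_contra hn
  have := h.normalized.mass
  rw [integral_undef hn] at this
  exact one_ne_zero this.symm

theorem IsFermiDiracParam.integrable_energy (h : IsFermiDiracParam ε a b) :
    Integrable fun v => fermiDirac ε a b v * ‖v‖ ^ 2 := by
  by_contra hn
  have := h.normalized.energy
  rw [integral_undef hn] at this
  norm_num at this

theorem integrable_exp_neg_mul_norm_sq (hb : 0 < b) :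
    Integrable fun v : V => Real.exp (-b * ‖v‖ ^ 2) := by
  have h := GaussianFourier.integrable_cexp_neg_mul_sq_norm_add (V := V) (b := (b : ℂ))
    (by simpa using hb) 0 0
  refine h.re.congr (Eventually.of_forall fun v => ?_)
  simp only [zero_mul, add_zero]
  rw [← Complex.ofReal_pow, ← Complex.ofReal_neg, ← Complex.ofReal_mul, ← Complex.ofReal_exp]
  rfl

theorem IsFermiDiracParam.integrable_entropyDensity (hε : 0 ≤ ε) (h : IsFermiDiracParam ε a b) :
    Integrable fun v => entropyDensity ε (fermiDirac ε a b v) := by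
  have ha := h.a_pos
  have hlog : ∀ v : V, Real.log (a * Real.exp (-b * ‖v‖ ^ 2)) = Real.log a + -b * ‖v‖ ^ 2 :=
    fun v => by rw [Real.log_mul ha.ne' (Real.exp_pos _).ne', Real.log_exp]
  have hi := h.integrable
  have hi2 := h.integrable_energy
  rcases hε.eq_or_lt with rfl | hε
  · have : ∀ v : V, entropyDensity 0 (fermiDirac 0 a b v) =
        Real.log a * fermiDirac 0 a b v + -b * (fermiDirac 0 a b v * ‖v‖ ^ 2) := by
      intro v
      simp only [entropyDensity, if_true, fermiDirac, zero_mul, add_zero, div_one]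
      rw [hlog]
      ring
    simp_rw [this]
    exact (hi.const_mul _).add (hi2.const_mul _)
  -- As `1 - εM = (1 + εG)⁻¹` with `G` the Gaussian `a exp(-b|v|²)`, this term is bounded in
  -- absolute value by `G`.
  · have hP : Integrable fun v : V => ε⁻¹ * Real.log (1 - ε * fermiDirac ε a b v) := by
      refine ((integrable_exp_neg_mul_norm_sq h.b_pos).const_mul a).mono' ?_
        (Eventually.of_forall fun v => ?_)
      · have := (contDiff_fermiDirac (b := b) hε.le ha).continuous.measurable
        exact Measurable.aestronglyMeasurable (by fun_prop)
      · have hx : 0 < a * Real.exp (-b * ‖v‖ ^ 2) := by positivity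
        have h1 : 1 - ε * fermiDirac ε a b v = (1 + ε * (a * Real.exp (-b * ‖v‖ ^ 2)))⁻¹ := by
          unfold fermiDirac
          have h2 : 0 < 1 + ε * (a * Real.exp (-b * ‖v‖ ^ 2)) := by positivity
          field_simp
          ring
        have h3 : 1 ≤ 1 + ε * (a * Real.exp (-b * ‖v‖ ^ 2)) := by
          have := mul_pos hε hx; linarith
        rw [h1, Real.log_inv, mul_neg, norm_neg, Real.norm_of_nonneg
          (mul_nonneg (inv_pos.2 hε).le (Real.log_nonneg h3))]
        have h4 := Real.log_le_sub_one_of_pos (zero_lt_one.trans_le h3)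
        rw [inv_mul_le_iff₀ hε]
        linarith
    have : ∀ v : V, entropyDensity ε (fermiDirac ε a b v) =
        (Real.log ε + Real.log a) * fermiDirac ε a b v + -b * (fermiDirac ε a b v * ‖v‖ ^ 2) +
          ε⁻¹ * Real.log (1 - ε * fermiDirac ε a b v) := by
      intro v
      rw [entropyDensity_of_pos hε (fermiDirac_pos hε.le ha v) (mul_fermiDirac_lt_one hε.le ha v),
        fermiDirac_div hε.le ha, hlog]
      ring
    simp_rw [this]
    exact ((hi.const_mul _).add (hi2.const_mul _)).add hP

/-- The Fermi-Dirac relative entropy is bounded by the Boltzmann relative entropy of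
`g / (1 - ε g)` with respect to any isotropic centred Gaussian. -/
theorem relEntropy_le_lintegral_relEnt (hε : 0 ≤ ε) (h : IsFermiDiracParam ε a b) {g : V → ℝ}
    (hgpos : ∀ v, 0 < g v) (hg1 : ∀ v, ε * g v < 1) (hgi : Integrable g)
    (hge : Integrable fun v => g v * ‖v‖ ^ 2) (hmass : ∫ v, g v = 1)
    (henergy : ∫ v, g v * ‖v‖ ^ 2 = 3) (hent : Integrable fun v => entropyDensity ε (g v))
    {Z : ℝ} (hZ : 0 < Z) {θ : ℝ≥0} (hθ : θ ≠ 0) :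
    ENNReal.ofReal (relEntropy ε g (fermiDirac ε a b)) ≤
      ∫⁻ v, ENNReal.ofReal (relEnt (g v / (1 - ε * g v)) (Z * gaussDensity θ v)) := by
  obtain ⟨c, hc⟩ := entropyDensity_sub_le hε
  set M := fermiDirac ε a b with hM
  set A := Real.log Z + 3 * Real.log ((√(2 * Real.pi * θ))⁻¹) + c with hA
  set B := 1 / (2 * (θ : ℝ)) with hB
  have hlog : ∀ v, Real.log (Z * gaussDensity θ v) + c = A - B * ‖v‖ ^ 2 := by
    intro v
    rw [Real.log_mul hZ.ne' (gaussDensity_pos hθ v).ne', log_gaussDensity hθ, hA, hB]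
    ring
  have hMi := h.integrable
  have hMe := h.integrable_energy
  have hMent := h.integrable_entropyDensity hε
  have hlin : ∀ v, (g v - M v) * (Real.log (Z * gaussDensity θ v) + c) =
      A * (g v - M v) - B * (g v * ‖v‖ ^ 2 - M v * ‖v‖ ^ 2) := by
    intro v; rw [hlog]; ring
  have i1 : Integrable fun v => A * (g v - M v) := (hgi.sub hMi).const_mul A
  have i2 : Integrable fun v => B * (g v * ‖v‖ ^ 2 - M v * ‖v‖ ^ 2) := (hge.sub hMe).const_mul B
  have i3 : Integrable fun v => entropyDensity ε (g v) - entropyDensity ε (M v) := hent.sub hMent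
  have i4 : Integrable fun v => A * (g v - M v) - B * (g v * ‖v‖ ^ 2 - M v * ‖v‖ ^ 2) := i1.sub i2
  -- The subtracted term integrates to zero because `g` and `M` share mass and energy. This is why
  -- any variance `θ` and any factor `Z` are admissible.
  have heq : relEntropy ε g M = ∫ v, ((entropyDensity ε (g v) - entropyDensity ε (M v)) -
      (A * (g v - M v) - B * (g v * ‖v‖ ^ 2 - M v * ‖v‖ ^ 2))) := by
    rw [integral_sub i3 i4, integral_sub i1 i2, integral_const_mul, integral_const_mul,
      integral_sub hgi hMi, integral_sub hge hMe, integral_sub hent hMent, hmass, henergy,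
      h.normalized.mass, h.normalized.energy]
    simp only [relEntropy, entropy]
    ring
  rw [heq]
  refine ofReal_integral_le_lintegral (i3.sub i4) (Eventually.of_forall fun v => ?_)
  have := hc (g v) (M v) (Z * gaussDensity θ v) (hgpos v) (hg1 v) (fermiDirac_pos hε h.a_pos v)
    (mul_fermiDirac_lt_one hε h.a_pos v) (mul_pos hZ (gaussDensity_pos hθ v))
  rw [hlin] at this
  linarith

end FermiDirac

end LFD

/-! ### Virial identities and the regime of a positive bracket -/

namespace LFD

open Filter Topology Set ProbabilityTheory
open scoped NNReal

/-- The set where `f` exceeds its essential supremum is null and, by continuity, open, hence empty.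
The bound `C` keeps the real-valued norm from collapsing to the default value `0`. -/
theorem le_supNorm {f : V → ℝ} (hf : Continuous f) {C : ℝ} (hC : ∀ v, |f v| ≤ C) (v : V) :
    |f v| ≤ supNorm f := by
  have hfin : eLpNorm f ∞ volume ≠ ⊤ :=
    ((memLp_top_of_bound hf.aestronglyMeasurable C (Eventually.of_forall hC)).2).ne
  have hae : ∀ᵐ v, ‖f v‖ₑ ≤ eLpNorm f ∞ volume := by
    rw [eLpNorm_exponent_top]
    exact ae_le_eLpNormEssSup
  have hopen : IsOpen {v | ¬ ‖f v‖ₑ ≤ eLpNorm f ∞ volume} := by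
    simp only [not_le]
    exact isOpen_lt continuous_const hf.enorm
  have hempty := hopen.eq_empty_of_measure_zero (μ := volume) (ae_iff.1 hae)
  have hv : ‖f v‖ₑ ≤ eLpNorm f ∞ volume := by
    by_contra hcon
    have : v ∈ {v | ¬ ‖f v‖ₑ ≤ eLpNorm f ∞ volume} := hcon
    rw [hempty] at this
    exact this
  have := ENNReal.toReal_mono hfin hv
  simpa [supNorm] using this

theorem integral_fderiv_apply_eq_zero {ψ : V → ℝ} (hψ : Differentiable ℝ ψ) (hi : Integrable ψ)
    (w : V) (hd : Integrable fun v => fderiv ℝ ψ v w) : ∫ v, fderiv ℝ ψ v w = 0 := by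
  have h := integral_mul_fderiv_eq_neg_fderiv_mul_of_integrable (μ := (volume : Measure V))
    (f := fun _ => (1 : ℝ)) (g := ψ) (v := w) (by simp) (by simpa using hd) (by simpa using hi)
    (fun x _ => differentiableAt_const _) (fun x _ => hψ x)
  simpa using h

theorem integral_inner_mul_fderiv {ψ : V → ℝ} (hψ : Differentiable ℝ ψ) (hi : Integrable ψ)
    (u w : V) (hui : Integrable fun v => inner ℝ u v * ψ v)
    (hd : Integrable fun v => inner ℝ u v * fderiv ℝ ψ v w) :
    ∫ v, inner ℝ u v * fderiv ℝ ψ v w = -(inner ℝ u w * ∫ v, ψ v) := by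
  have hf : ∀ v : V, fderiv ℝ (fun v : V => inner ℝ u v) v w = inner ℝ u w := by
    intro v
    have : HasFDerivAt (fun v : V => inner ℝ u v) (innerSL ℝ u) v := (innerSL ℝ u).hasFDerivAt
    rw [this.fderiv]
    rfl
  have h := integral_mul_fderiv_eq_neg_fderiv_mul_of_integrable (μ := (volume : Measure V))
    (f := fun v => inner ℝ u v) (g := ψ) (v := w) (by simpa only [hf] using hi.const_mul _) hd hui
    (fun x _ => (innerSL ℝ u).differentiableAt) (fun x _ => hψ x)
  rw [h]
  simp only [hf]
  rw [integral_const_mul]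

theorem integrable_inner_mul {f : V → ℝ} (hf : Integrable f)
    (hf2 : Integrable fun v => f v * ‖v‖ ^ 2) (u : V) : Integrable fun v => inner ℝ u v * f v := by
  refine ((hf.norm.add hf2.norm).const_mul ‖u‖).mono'
    ((by fun_prop : Continuous fun v : V => inner ℝ u v).aestronglyMeasurable.mul hf.1)
    (Eventually.of_forall fun v => ?_)
  simp only [norm_mul, Pi.add_apply, norm_pow, norm_norm]
  have h1 := norm_inner_le_norm (𝕜 := ℝ) u v
  have h2 : ‖v‖ ≤ 1 + ‖v‖ ^ 2 := by nlinarith [sq_nonneg (‖v‖ - 1), norm_nonneg v]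
  calc ‖inner ℝ u v‖ * ‖f v‖ ≤ (‖u‖ * ‖v‖) * ‖f v‖ := by gcongr
    _ ≤ (‖u‖ * (1 + ‖v‖ ^ 2)) * ‖f v‖ := by gcongr
    _ = _ := by ring

theorem integrable_inner_mul_inner_mul {f : V → ℝ} (hf : Integrable f)
    (hf2 : Integrable fun v => f v * ‖v‖ ^ 2) (u w : V) :
    Integrable fun v => inner ℝ u v * (inner ℝ w v * f v) := by
  refine (hf2.norm.const_mul (‖u‖ * ‖w‖)).mono'
    ((by fun_prop : Continuous fun v : V => inner ℝ u v).aestronglyMeasurable.mul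
    ((by fun_prop : Continuous fun v : V => inner ℝ w v).aestronglyMeasurable.mul hf.1))
    (Eventually.of_forall fun v => ?_)
  simp only [norm_mul, norm_pow, norm_norm]
  have h1 := norm_inner_le_norm (𝕜 := ℝ) u v
  have h2 := norm_inner_le_norm (𝕜 := ℝ) w v
  calc ‖inner ℝ u v‖ * (‖inner ℝ w v‖ * ‖f v‖) ≤ (‖u‖ * ‖v‖) * ((‖w‖ * ‖v‖) * ‖f v‖) := by
        gcongr
    _ = _ := by ring

/-- The virial identity for a function with radial gradient. -/
theorem integral_eq_of_radial_gradient {ψ k : V → ℝ} (hψ : Differentiable ℝ ψ)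
    (hk : ∀ v w, fderiv ℝ ψ v w = -(k v * inner ℝ v w)) (hi : Integrable ψ)
    (hi2 : Integrable fun v => ψ v * ‖v‖ ^ 2) (hki : Integrable k)
    (hki2 : Integrable fun v => k v * ‖v‖ ^ 2) :
    3 * ∫ v, ψ v = ∫ v, k v * ‖v‖ ^ 2 := by
  have h : ∀ i : Fin 3, ∫ v, ψ v = ∫ v, k v * (v i) ^ 2 := by
    intro i
    set e : V := EuclideanSpace.single i 1 with he
    have hev : ∀ v : V, inner ℝ e v = v i := fun v => by
      rw [he, EuclideanSpace.inner_single_left]; simp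
    have hd : Integrable fun v => inner ℝ e v * fderiv ℝ ψ v e := by
      refine (integrable_inner_mul_inner_mul hki hki2 e e).neg.congr
        (Eventually.of_forall fun v => ?_)
      simp only [Pi.neg_apply, hk, real_inner_comm e v]
      ring
    have h1 := integral_inner_mul_fderiv hψ hi e e (integrable_inner_mul hi hi2 e) hd
    have h2 : inner ℝ e e = (1 : ℝ) := by rw [hev]; simp [he]
    rw [h2, one_mul] at h1
    rw [← neg_eq_iff_eq_neg.2 h1, ← integral_neg]
    refine integral_congr_ae (Eventually.of_forall fun v => ?_)
    simp only [hk, real_inner_comm e v, hev]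
    ring
  have hsum : ∫ v, k v * ‖v‖ ^ 2 = ∑ i : Fin 3, ∫ v, k v * (v i) ^ 2 := by
    rw [← integral_finsetSum]
    · refine integral_congr_ae (Eventually.of_forall fun v => ?_)
      simp only [norm_sq_eq, Fin.sum_univ_three]
      ring
    · intro i _
      refine (integrable_inner_mul_inner_mul hki hki2 (EuclideanSpace.single i 1)
        (EuclideanSpace.single i 1)).congr (Eventually.of_forall fun v => ?_)
      simp only [EuclideanSpace.inner_single_left]
      simp
      ring
  rw [hsum, Fin.sum_univ_three, ← h 0, ← h 1, ← h 2]
  ring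

/-- With occupation `p = t / (1 + t)`, the difference `log (1 + t) - p log t` is the binary entropy
of `p`. Its empty-state part is at most `p`. Its occupied part is at most `p` for `t ≥ 1`; for `t ≤
1` one has `1 - p ≥ 1/2` and `-log t ≤ r`, so the excess is absorbed by `2 r p (1 - p)`. -/
theorem log_one_add_le {t μ r : ℝ} (ht : 0 < t) (hμ : 0 ≤ μ) (hr : 0 ≤ r)
    (hlog : Real.log t = μ - r) :
    Real.log (1 + t) ≤ t / (1 + t) * Real.log t + 2 * (t / (1 + t)) +
      2 * r * (t / (1 + t) * (1 - t / (1 + t))) := by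
  set p := t / (1 + t) with hp
  have hp0 : 0 < p := by positivity
  have hq : 1 - p = 1 / (1 + t) := by rw [hp]; field_simp; ring
  have h1 : Real.log (1 + t) * (1 - p) ≤ p := by
    have := Real.log_le_sub_one_of_pos (show 0 < 1 + t by positivity)
    rw [hq, hp, mul_one_div]
    gcongr
    linarith
  have h2 : p * (Real.log (1 + t) - Real.log t) ≤ p + 2 * r * (p * (1 - p)) := by
    have hr' : 0 ≤ 2 * r * (p * (1 - p)) := by rw [hq]; positivity
    rcases le_total 1 t with h | h
    · have h3 : Real.log (1 + t) - Real.log t ≤ 1 := by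
        rw [← Real.log_div (by positivity) ht.ne']
        have := Real.log_le_sub_one_of_pos (show 0 < (1 + t) / t by positivity)
        have h4 : (1 + t) / t - 1 = 1 / t := by field_simp; ring
        have h5 : 1 / t ≤ 1 := by rw [div_le_one ht]; exact h
        linarith
      nlinarith
    · have h3 : Real.log (1 + t) ≤ 1 := by
        have := Real.log_le_sub_one_of_pos (show 0 < 1 + t by positivity)
        linarith
      have h4 : 1 / 2 ≤ 1 - p := by
        rw [hq]
        exact one_div_le_one_div_of_le (by positivity) (by linarith)
      have h5 : r * p ≤ 2 * r * (p * (1 - p)) := by nlinarith [mul_nonneg hr hp0.le]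
      have h6 : - Real.log t ≤ r := by linarith
      nlinarith
  linarith

section FermiDirac

variable {ε a b : ℝ}

theorem hasFDerivAt_gaussian (v : V) :
    HasFDerivAt (fun v : V => a * Real.exp (-b * ‖v‖ ^ 2))
      ((a * (Real.exp (-b * ‖v‖ ^ 2) * (-b * 2))) • innerSL ℝ v) v := by
  have h := (((hasStrictFDerivAt_norm_sq v).hasFDerivAt.const_mul (-b)).exp).const_mul a
  refine h.congr_fderiv ?_
  ext w
  simp
  ring

theorem gaussian_le_mul_fermiDirac (hε : 0 ≤ ε) (ha : 0 < a) (hb : 0 < b) (v : V) :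
    a * Real.exp (-b * ‖v‖ ^ 2) ≤ (1 + ε * a) * fermiDirac ε a b v := by
  unfold fermiDirac
  have h1 : Real.exp (-b * ‖v‖ ^ 2) ≤ 1 := by
    rw [Real.exp_le_one_iff]
    nlinarith [sq_nonneg ‖v‖]
  have h2 : 0 < a * Real.exp (-b * ‖v‖ ^ 2) := by positivity
  have h3 : a * Real.exp (-b * ‖v‖ ^ 2) ≤ a := by nlinarith
  rw [← mul_div_assoc, le_div_iff₀ (by positivity), mul_comm]
  gcongr

theorem IsFermiDiracParam.integrable_gaussian (hε : 0 ≤ ε) (h : IsFermiDiracParam ε a b) :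
    Integrable fun v : V => a * Real.exp (-b * ‖v‖ ^ 2) := by
  have ha := h.a_pos
  refine (h.integrable.const_mul (1 + ε * a)).mono' (by fun_prop) (Eventually.of_forall fun v => ?_)
  rw [Real.norm_of_nonneg (by positivity)]
  exact gaussian_le_mul_fermiDirac hε h.a_pos h.b_pos v

theorem IsFermiDiracParam.integrable_gaussian_energy (hε : 0 ≤ ε) (h : IsFermiDiracParam ε a b) :
    Integrable fun v : V => a * Real.exp (-b * ‖v‖ ^ 2) * ‖v‖ ^ 2 := by
  have ha := h.a_pos
  refine (h.integrable_energy.const_mul (1 + ε * a)).mono' (by fun_prop)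
    (Eventually.of_forall fun v => ?_)
  rw [Real.norm_of_nonneg (by positivity), ← mul_assoc]
  exact mul_le_mul_of_nonneg_right (gaussian_le_mul_fermiDirac hε h.a_pos h.b_pos v) (sq_nonneg _)

theorem fermiDirac_le_gaussian (hε : 0 ≤ ε) (ha : 0 < a) (v : V) :
    fermiDirac ε a b v ≤ a * Real.exp (-b * ‖v‖ ^ 2) := by
  unfold fermiDirac
  have h2 : 0 < a * Real.exp (-b * ‖v‖ ^ 2) := by positivity
  exact div_le_self h2.le (by nlinarith [mul_nonneg hε h2.le])

/-- Virial identity for the Gaussian `G = a exp(-b|v|²)`: `3 ∫ G = 2b ∫ G |v|²`, and `G` dominates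
the Fermi-Dirac statistics, whose energy is `3`. -/
theorem IsFermiDiracParam.two_mul_b_le (hε : 0 ≤ ε) (h : IsFermiDiracParam ε a b) :
    2 * b ≤ ∫ v : V, a * Real.exp (-b * ‖v‖ ^ 2) := by
  have ha := h.a_pos
  have hb := h.b_pos
  have hi := h.integrable_gaussian hε
  have hi2 := h.integrable_gaussian_energy hε
  have hv := integral_eq_of_radial_gradient (k := fun v => 2 * b * (a * Real.exp (-b * ‖v‖ ^ 2)))
    (fun v => (hasFDerivAt_gaussian (a := a) (b := b) v).differentiableAt) (fun v w => by
      rw [(hasFDerivAt_gaussian v).fderiv]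
      simp only [smul_apply, innerSL_apply_apply, smul_eq_mul]
      ring) hi hi2 (hi.const_mul _) (by
        refine (hi2.const_mul (2 * b)).congr (Eventually.of_forall fun v => ?_)
        simp only; ring)
  have h1 : ∫ v : V, 2 * b * (fermiDirac ε a b v * ‖v‖ ^ 2) ≤
      ∫ v : V, 2 * b * (a * Real.exp (-b * ‖v‖ ^ 2)) * ‖v‖ ^ 2 := by
    refine integral_mono (h.integrable_energy.const_mul _) ?_ fun v => ?_
    · refine (hi2.const_mul (2 * b)).congr (Eventually.of_forall fun v => ?_)
      simp only; ring
    · simp only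
      have := fermiDirac_le_gaussian (b := b) hε ha v
      rw [← mul_assoc]
      gcongr
  rw [integral_const_mul, h.normalized.energy, ← hv] at h1
  linarith

/-- For `εa ≤ 1` the Gaussian is at most twice the Fermi-Dirac statistics, so its mass is at most
`2`. -/
theorem IsFermiDiracParam.b_le_one (hε : 0 ≤ ε) (h : IsFermiDiracParam ε a b) (hεa : ε * a ≤ 1) :
    b ≤ 1 := by
  have h1 := h.two_mul_b_le hε
  have h2 : ∫ v : V, a * Real.exp (-b * ‖v‖ ^ 2) ≤ ∫ v : V, 2 * fermiDirac ε a b v := by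
    refine integral_mono (h.integrable_gaussian hε) (h.integrable.const_mul _) fun v => ?_
    refine (gaussian_le_mul_fermiDirac hε h.a_pos h.b_pos v).trans ?_
    have := fermiDirac_pos (b := b) hε h.a_pos v
    gcongr
    linarith
  rw [integral_const_mul 2, h.normalized.mass] at h2
  linarith

/-- The pressure of the Fermi-Dirac statistics. -/
noncomputable def fermiPressure (ε a b : ℝ) (v : V) : ℝ :=
  ε⁻¹ * Real.log (1 + ε * (a * Real.exp (-b * ‖v‖ ^ 2)))

theorem hasFDerivAt_fermiPressure (hε : 0 < ε) (ha : 0 < a) (v : V) :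
    HasFDerivAt (fermiPressure ε a b) ((-(2 * b * fermiDirac ε a b v)) • innerSL ℝ v) v := by
  have hx : 0 < a * Real.exp (-b * ‖v‖ ^ 2) := by positivity
  have h1 : 1 + ε * (a * Real.exp (-b * ‖v‖ ^ 2)) ≠ 0 := by positivity
  have h := ((((hasFDerivAt_gaussian (a := a) (b := b) v).const_mul ε).const_add 1).log h1).const_mul
    ε⁻¹
  refine h.congr_fderiv ?_
  ext w
  simp only [fermiDirac, smul_apply, innerSL_apply_apply, smul_eq_mul]
  field_simp

theorem hasFDerivAt_fermiDirac (hε : 0 ≤ ε) (ha : 0 < a) (v : V) :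
    HasFDerivAt (fermiDirac ε a b)
      ((-(2 * b * (fermiDirac ε a b v * (1 - ε * fermiDirac ε a b v)))) • innerSL ℝ v) v := by
  have hx : 0 < a * Real.exp (-b * ‖v‖ ^ 2) := by positivity
  have h1 : 1 + ε * (a * Real.exp (-b * ‖v‖ ^ 2)) ≠ 0 := by positivity
  have hd : HasDerivAt (fun x : ℝ => x / (1 + ε * x))
      (1 / (1 + ε * (a * Real.exp (-b * ‖v‖ ^ 2))) ^ 2) (a * Real.exp (-b * ‖v‖ ^ 2)) := by
    refine ((hasDerivAt_id _).div (((hasDerivAt_id _).const_mul ε).const_add 1) h1).congr_deriv ?_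
    simp only [id]
    congr 1
    ring
  refine (hd.comp_hasFDerivAt v (hasFDerivAt_gaussian (a := a) (b := b) v)).congr_fderiv ?_
  ext w
  simp only [fermiDirac, smul_apply, innerSL_apply_apply, smul_eq_mul]
  field_simp
  ring

/-- If the quantum parameter is so large that the bracket in the entropy inequality could be
positive only for a strongly degenerate Fermi-Dirac statistics, then `κ b` is bounded. -/
theorem IsFermiDiracParam.kappa_mul_b_le (hε : 0 < ε) (h : IsFermiDiracParam ε a b)
    (hεa : 1 ≤ ε * a) {g : V → ℝ} (hgpos : ∀ v, 0 < g v) {κ : ℝ} (hκ : ∀ v, κ ≤ 1 - ε * g v)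
    (hgi : Integrable g) (hge : Integrable fun v => g v * ‖v‖ ^ 2) (hmass : ∫ v, g v = 1)
    (henergy : ∫ v, g v * ‖v‖ ^ 2 = 3) : 2 * (κ * b) ≤ 5 := by
  have ha := h.a_pos
  have hb := h.b_pos
  set M := fermiDirac ε a b with hM
  set Q := fermiPressure ε a b with hQ
  set μ := Real.log (ε * a) with hμ
  have hμ0 : 0 ≤ μ := Real.log_nonneg hεa
  have hMi := h.integrable
  have hMe := h.integrable_energy
  have hM0 : ∀ v, 0 < M v := fermiDirac_pos hε.le ha
  have hM1 : ∀ v, ε * M v < 1 := mul_fermiDirac_lt_one hε.le ha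
  have hMd := hasFDerivAt_fermiDirac (b := b) hε.le ha
  have hQd := hasFDerivAt_fermiPressure (b := b) hε ha
  have hMc : Continuous M := (contDiff_fermiDirac hε.le ha).continuous
  have hQc : Continuous Q := continuous_iff_continuousAt.2 fun v => (hQd v).continuousAt
  have hx : ∀ v : V, 0 < a * Real.exp (-b * ‖v‖ ^ 2) := fun v => by positivity
  have hQ0 : ∀ v, 0 ≤ Q v := fun v => mul_nonneg (inv_pos.2 hε).le
    (Real.log_nonneg (by have := mul_pos hε (hx v); linarith))
  have hQle : ∀ v, Q v ≤ a * Real.exp (-b * ‖v‖ ^ 2) := by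
    intro v
    have h1 := Real.log_le_sub_one_of_pos
      (show 0 < 1 + ε * (a * Real.exp (-b * ‖v‖ ^ 2)) by have := mul_pos hε (hx v); linarith)
    simp only [hQ, fermiPressure]
    rw [inv_mul_le_iff₀ hε]
    linarith
  have hQi : Integrable Q := (h.integrable_gaussian hε.le).mono' hQc.aestronglyMeasurable
    (Eventually.of_forall fun v => by rw [Real.norm_of_nonneg (hQ0 v)]; exact hQle v)
  have hQe : Integrable fun v => Q v * ‖v‖ ^ 2 := by
    refine (h.integrable_gaussian_energy hε.le).mono' (by fun_prop) (Eventually.of_forall fun v => ?_)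
    rw [Real.norm_of_nonneg (mul_nonneg (hQ0 v) (sq_nonneg _))]
    exact mul_le_mul_of_nonneg_right (hQle v) (sq_nonneg _)
  set k := fun v => 2 * b * (M v * (1 - ε * M v)) with hk
  have hkM : ∀ v, 0 ≤ k v ∧ k v ≤ 2 * b * M v := by
    intro v
    have h1 := hM0 v
    have h2 : 0 ≤ 1 - ε * M v := by linarith [hM1 v]
    refine ⟨by positivity, ?_⟩
    simp only [hk]
    gcongr
    exact mul_le_of_le_one_right h1.le (by linarith [mul_pos hε h1])
  have hki : Integrable k := (hMi.const_mul (2 * b)).mono' (by fun_prop) (Eventually.of_forall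
    fun v => by rw [Real.norm_of_nonneg (hkM v).1]; exact (hkM v).2)
  have hke : Integrable fun v => k v * ‖v‖ ^ 2 := by
    refine (hMe.const_mul (2 * b)).mono' (by fun_prop) (Eventually.of_forall fun v => ?_)
    rw [Real.norm_of_nonneg (mul_nonneg (hkM v).1 (sq_nonneg _)), ← mul_assoc]
    exact mul_le_mul_of_nonneg_right (hkM v).2 (sq_nonneg _)
  have vir1 : 3 * ∫ v, Q v = ∫ v, (2 * b * M v) * ‖v‖ ^ 2 := by
    refine integral_eq_of_radial_gradient (fun v => (hQd v).differentiableAt) (fun v w => ?_) hQi hQe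
      (hMi.const_mul _) ?_
    · rw [(hQd v).fderiv]
      simp only [smul_apply, innerSL_apply_apply, smul_eq_mul]
      ring
    · simpa only [mul_assoc] using hMe.const_mul (2 * b)
  have vir2 : 3 * ∫ v, M v = ∫ v, k v * ‖v‖ ^ 2 := by
    refine integral_eq_of_radial_gradient (fun v => (hMd v).differentiableAt) (fun v w => ?_) hMi hMe
      hki hke
    rw [(hMd v).fderiv]
    simp only [smul_apply, innerSL_apply_apply, smul_eq_mul, hk]
    ring
  -- The gradient of the pressure is `-2bMv`, so the virial identity expresses its integral through
  -- the energy `3` of `M`.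
  have hQint : ∫ v, Q v = 2 * b := by
    have : ∫ v, (2 * b * M v) * ‖v‖ ^ 2 = 2 * b * 3 := by
      rw [← h.normalized.energy, ← integral_const_mul]
      simp only [mul_assoc, hM]
    linarith
  have hlog : ∀ v : V, Real.log (ε * (a * Real.exp (-b * ‖v‖ ^ 2))) = μ - b * ‖v‖ ^ 2 := by
    intro v
    rw [← mul_assoc, Real.log_mul (by positivity) (Real.exp_pos _).ne', Real.log_exp]
    ring
  have hεM : ∀ v, ε * M v = ε * (a * Real.exp (-b * ‖v‖ ^ 2)) /
      (1 + ε * (a * Real.exp (-b * ‖v‖ ^ 2))) := by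
    intro v
    simp only [hM, fermiDirac]
    ring
  -- Integrated, this gives `2b ≤ (μ - 3b) + 2 + 3`, where the `3` is the virial identity `vir2`;
  -- and `pt2` gives `μ - 3b ≤ (1 - κ) 2b`, since `g` has the same mass and energy as `M` but
  -- occupation at most `1 - κ`. Together they yield `2κb ≤ 5`.
  have pt1 : ∀ v, Q v ≤ (μ * M v - b * (M v * ‖v‖ ^ 2)) + 2 * M v + k v * ‖v‖ ^ 2 := by
    intro v
    have h1 := log_one_add_le (mul_pos hε (hx v)) hμ0 (show 0 ≤ b * ‖v‖ ^ 2 by positivity) (hlog v)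
    rw [← hεM, hlog] at h1
    simp only [hQ, fermiPressure]
    rw [inv_mul_le_iff₀ hε]
    refine h1.trans (le_of_eq ?_)
    simp only [hk]
    ring
  have pt2 : ∀ v, μ * g v - b * (g v * ‖v‖ ^ 2) ≤ (1 - κ) * Q v := by
    intro v
    have hg := hgpos v
    have h1 : ε * g v ≤ 1 - κ := by linarith [hκ v]
    have h2 : 0 < ε * g v := mul_pos hε hg
    have h3 : μ - b * ‖v‖ ^ 2 ≤ ε * Q v := by
      rw [← hlog]
      simp only [hQ, fermiPressure]
      rw [mul_inv_cancel_left₀ hε.ne']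
      exact Real.log_le_log (mul_pos hε (hx v)) (by linarith)
    calc μ * g v - b * (g v * ‖v‖ ^ 2) = g v * (μ - b * ‖v‖ ^ 2) := by ring
      _ ≤ g v * (ε * Q v) := by gcongr
      _ = (ε * g v) * Q v := by ring
      _ ≤ (1 - κ) * Q v := mul_le_mul_of_nonneg_right h1 (hQ0 v)
  have i1 : Integrable fun v => μ * M v - b * (M v * ‖v‖ ^ 2) :=
    (hMi.const_mul μ).sub (hMe.const_mul b)
  have i2 : Integrable fun v => (μ * M v - b * (M v * ‖v‖ ^ 2)) + 2 * M v :=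
    i1.add (hMi.const_mul 2)
  have int1 := integral_mono hQi (i2.add hke) pt1
  have int2 := integral_mono ((hgi.const_mul μ).sub (hge.const_mul b)) (hQi.const_mul (1 - κ)) pt2
  simp only [Pi.add_apply, Pi.sub_apply] at int1 int2
  rw [integral_add i2 hke, integral_add i1 (hMi.const_mul 2), integral_sub (hMi.const_mul μ)
    (hMe.const_mul b), integral_const_mul, integral_const_mul, integral_const_mul,
    h.normalized.mass, h.normalized.energy, ← vir2, h.normalized.mass, hQint] at int1
  rw [integral_sub (hgi.const_mul μ) (hge.const_mul b), integral_const_mul, integral_const_mul,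
    integral_const_mul, hmass, henergy, hQint] at int2
  linarith

/-- If the bracket in the entropy inequality is positive, then the regime is moderately quantum. -/
theorem IsFermiDiracParam.of_bracket_pos (hε : 0 ≤ ε) (h : IsFermiDiracParam ε a b) {g : V → ℝ}
    (hgc : Continuous g) (hgpos : ∀ v, 0 < g v) {κ : ℝ} (hκ0 : 0 < κ) (hκ : ∀ v, κ ≤ 1 - ε * g v)
    (hgi : Integrable g) (hge : Integrable fun v => g v * ‖v‖ ^ 2) (hmass : ∫ v, g v = 1)
    (henergy : ∫ v, g v * ‖v‖ ^ 2 = 3)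
    (hbr : 0 < b - 12 * ε ^ 2 / κ ^ 4 *
      max (supNorm g ^ 2) (supNorm (fermiDirac ε a b) ^ 2)) :
    b ≤ 1 ∧ ∀ v, ε * g v ≤ 1 / 2 := by
  rcases hε.eq_or_lt with rfl | hε
  · exact ⟨h.b_le_one le_rfl (by simp), fun v => by simp⟩
  have ha := h.a_pos
  have hκ1 : κ ≤ 1 := by linarith [hκ 0, mul_pos hε (hgpos 0)]
  -- An occupation of at least `1/2` makes the term subtracted from `b` at least `12 · (1/4) / κ⁴ ≥
  -- 3 / κ`, so a positive bracket would force `κb > 3`. This contradicts `κb ≤ 5/2` when `εa ≥ 1`,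
  -- and `b, κ ≤ 1` otherwise.
  have key : ∀ s, 0 ≤ s → 1 / 2 ≤ ε * s → s ^ 2 ≤ max (supNorm g ^ 2)
      (supNorm (fermiDirac ε a b) ^ 2) → 3 / κ < b := by
    intro s hs hs2 hmax
    have h1 : 1 / 4 ≤ ε ^ 2 * s ^ 2 := by nlinarith
    have h2 : 3 / κ ≤ 3 / κ ^ 4 := by
      refine div_le_div_of_nonneg_left (by norm_num) (by positivity) ?_
      calc κ ^ 4 ≤ κ ^ 1 := pow_le_pow_of_le_one hκ0.le hκ1 (by norm_num)
        _ = κ := pow_one κ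
    have h3 : 3 / κ ^ 4 ≤ 12 * ε ^ 2 / κ ^ 4 * max (supNorm g ^ 2)
        (supNorm (fermiDirac ε a b) ^ 2) := by
      calc 3 / κ ^ 4 ≤ 12 * (ε ^ 2 * s ^ 2) / κ ^ 4 := by gcongr; linarith
        _ = 12 * ε ^ 2 / κ ^ 4 * s ^ 2 := by ring
        _ ≤ _ := by gcongr
    linarith
  have hεa : ε * a < 1 := by
    by_contra! hcon
    have h1 := h.kappa_mul_b_le hε hcon hgpos hκ hgi hge hmass henergy
    have hM0 : fermiDirac ε a b 0 = a / (1 + ε * a) := by simp [fermiDirac]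
    have hMc : Continuous (fermiDirac ε a b) := (contDiff_fermiDirac hε.le ha).continuous
    have hMs := le_supNorm hMc (C := ε⁻¹) (fun v => by
      rw [abs_of_pos (fermiDirac_pos hε.le ha v), ← one_div, le_div_iff₀ hε, mul_comm]
      exact (mul_fermiDirac_lt_one hε.le ha v).le) 0
    rw [abs_of_pos (fermiDirac_pos hε.le ha 0)] at hMs
    -- At the origin the occupation is `εa / (1 + εa)`, which is at least `1/2` precisely when `εa ≥
    -- 1`.
    have h2 : 3 / κ < b := key (fermiDirac ε a b 0) (fermiDirac_pos hε.le ha 0).le (by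
      rw [hM0, ← mul_div_assoc, div_le_div_iff₀ (by norm_num) (by positivity)]
      linarith) ((pow_le_pow_left₀ (fermiDirac_pos hε.le ha 0).le hMs 2).trans (le_max_right _ _))
    rw [div_lt_iff₀ hκ0] at h2
    linarith
  have hb1 := h.b_le_one hε.le hεa.le
  refine ⟨hb1, fun v => ?_⟩
  by_contra! hcon
  have hgs := le_supNorm hgc (C := ε⁻¹) (fun v => by
      rw [abs_of_pos (hgpos v), ← one_div, le_div_iff₀ hε, mul_comm]
      linarith [hκ v]) v
  rw [abs_of_pos (hgpos v)] at hgs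
  have h2 := key (g v) (hgpos v).le hcon.le
    ((pow_le_pow_left₀ (hgpos v).le hgs 2).trans (le_max_left _ _))
  rw [div_lt_iff₀ hκ0] at h2
  nlinarith

end FermiDirac

end LFD

/-! ### Cross differences and their integrability -/

namespace LFD

open Filter Topology Set ProbabilityTheory
open scoped NNReal

/-- Cauchy-Schwarz for lower integrals. -/
theorem lintegral_mul_sq_le {α : Type*} [MeasurableSpace α] {μ : Measure α} {f g : α → ℝ≥0∞}
    (hf : AEMeasurable f μ) (hg : AEMeasurable g μ) :
    (∫⁻ x, f x * g x ∂μ) ^ 2 ≤ (∫⁻ x, f x ^ 2 ∂μ) * ∫⁻ x, g x ^ 2 ∂μ := by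
  have h := ENNReal.lintegral_mul_le_Lp_mul_Lq μ Real.HolderConjugate.two_two hf hg
  simp only [Pi.mul_apply, ENNReal.rpow_two] at h
  calc (∫⁻ x, f x * g x ∂μ) ^ 2
      ≤ ((∫⁻ x, f x ^ 2 ∂μ) ^ (1 / 2 : ℝ) * (∫⁻ x, g x ^ 2 ∂μ) ^ (1 / 2 : ℝ)) ^ 2 := by gcongr
    _ = _ := by
      rw [mul_pow, ← ENNReal.rpow_two, ← ENNReal.rpow_mul, ← ENNReal.rpow_two, ← ENNReal.rpow_mul]
      norm_num

/-- The component of the cross product of `v - w` and `h v - h w` along a pair of directions. -/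
noncomputable def crossDiff (h : V → V) (u u' v w : V) : ℝ :=
  inner ℝ u (v - w) * inner ℝ u' (h v - h w) - inner ℝ u' (v - w) * inner ℝ u (h v - h w)

theorem crossDiff_self (h : V → V) (u u' v : V) : crossDiff h u u' v v = 0 := by
  simp [crossDiff]

theorem crossDiff_swap (h : V → V) (u u' v w : V) :
    crossDiff h u' u v w = - crossDiff h u u' v w := by
  unfold crossDiff; ring

/-- Bessel's inequality for an orthonormal pair. -/
theorem inner_sq_add_inner_sq_le {u u' : V} (hu : ‖u‖ = 1) (hu' : ‖u'‖ = 1) (huu : inner ℝ u u' = 0)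
    (z : V) : inner ℝ u z ^ 2 + inner ℝ u' z ^ 2 ≤ ‖z‖ ^ 2 := by
  have h := sq_nonneg ‖z - inner ℝ u z • u - inner ℝ u' z • u'‖
  have e : ‖z - inner ℝ u z • u - inner ℝ u' z • u'‖ ^ 2 =
      ‖z‖ ^ 2 - inner ℝ u z ^ 2 - inner ℝ u' z ^ 2 := by
    have h1 : inner ℝ u u = (1 : ℝ) := by rw [real_inner_self_eq_norm_sq, hu]; norm_num
    have h2 : inner ℝ u' u' = (1 : ℝ) := by rw [real_inner_self_eq_norm_sq, hu']; norm_num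
    have h3 : inner ℝ u' u = (0 : ℝ) := by rw [real_inner_comm, huu]
    rw [← real_inner_self_eq_norm_sq, ← real_inner_self_eq_norm_sq]
    simp only [inner_sub_left, inner_sub_right, inner_smul_left, inner_smul_right, h1, h2, huu, h3,
      real_inner_comm u z, real_inner_comm u' z, conj_trivial]
    ring
  linarith

/-- The determinant ignores the part of `y` along `z`, so `y` may be replaced by `proj z y`; then
Cauchy-Schwarz in the plane and Bessel's inequality apply. -/
theorem cross_sq_le_proj {u u' : V} (hu : ‖u‖ = 1) (hu' : ‖u'‖ = 1) (huu : inner ℝ u u' = 0)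
    (z y : V) :
    (inner ℝ u z * inner ℝ u' y - inner ℝ u' z * inner ℝ u y) ^ 2 ≤ ‖z‖ ^ 2 * ‖proj z y‖ ^ 2 := by
  have h1 := inner_sq_add_inner_sq_le hu hu' huu z
  have h2 := inner_sq_add_inner_sq_le hu hu' huu (proj z y)
  have e : inner ℝ u z * inner ℝ u' y - inner ℝ u' z * inner ℝ u y =
      inner ℝ u z * inner ℝ u' (proj z y) - inner ℝ u' z * inner ℝ u (proj z y) := by
    simp only [proj, inner_sub_right, inner_smul_right]
    ring
  rw [e]
  calc _ ≤ (inner ℝ u z ^ 2 + inner ℝ u' z ^ 2) *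
        (inner ℝ u (proj z y) ^ 2 + inner ℝ u' (proj z y) ^ 2) := by
        nlinarith [sq_nonneg (inner ℝ u z * inner ℝ u (proj z y) +
          inner ℝ u' z * inner ℝ u' (proj z y))]
    _ ≤ _ := by gcongr

theorem norm_rpow_mul_cross_sq_le {u u' : V} (hu : ‖u‖ = 1) (hu' : ‖u'‖ = 1)
    (huu : inner ℝ u u' = 0) (γ : ℝ) (z y : V) :
    ‖z‖ ^ γ * (inner ℝ u z * inner ℝ u' y - inner ℝ u' z * inner ℝ u y) ^ 2 ≤
      kineticPotential γ z * ‖proj z y‖ ^ 2 := by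
  rcases eq_or_ne z 0 with rfl | hz
  · simp only [inner_zero_right, zero_mul, sub_zero, ne_eq, OfNat.ofNat_ne_zero, not_false_eq_true,
      zero_pow, mul_zero]
    exact mul_nonneg (Real.rpow_nonneg (norm_nonneg _) _) (sq_nonneg _)
  · have hz' : 0 < ‖z‖ := norm_pos_iff.2 hz
    unfold kineticPotential
    rw [Real.rpow_add hz', Real.rpow_two, mul_assoc]
    exact mul_le_mul_of_nonneg_left (cross_sq_le_proj hu hu' huu z y)
      (Real.rpow_nonneg hz'.le _)

theorem japanese_pos (v : V) : 0 < japanese v := Real.sqrt_pos.2 (by positivity)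

theorem one_le_japanese (v : V) : 1 ≤ japanese v := by
  unfold japanese
  rw [Real.one_le_sqrt]
  nlinarith [sq_nonneg ‖v‖]

theorem japanese_sq (v : V) : japanese v ^ 2 = 1 + ‖v‖ ^ 2 := Real.sq_sqrt (by positivity)

theorem norm_le_japanese (v : V) : ‖v‖ ≤ japanese v :=
  Real.le_sqrt_of_sq_le (by linarith)

theorem continuous_japanese : Continuous japanese := by unfold japanese; fun_prop

/-- The part of the entropy production seen by a pair of directions. -/
noncomputable def crossDissipation (γ : ℝ) (g : V → ℝ) (h : V → V) (u u' : V) : ℝ≥0∞ :=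
  ∫⁻ v, ENNReal.ofReal (g v) *
    ∫⁻ w, ENNReal.ofReal (g w * ‖v - w‖ ^ γ * crossDiff h u u' v w ^ 2)

section

variable {γ : ℝ} {g : V → ℝ} {h : V → V} {u u' : V}

theorem continuous_crossDiff_right (hh : Continuous h) (v : V) :
    Continuous fun w => crossDiff h u u' v w := by
  unfold crossDiff; fun_prop

theorem continuous_crossDiff (hh : Continuous h) :
    Continuous fun p : V × V => crossDiff h u u' p.1 p.2 := by
  unfold crossDiff; fun_prop

theorem measurable_crossKernel (hg : Continuous g) (hh : Continuous h) : Measurable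
    fun p : V × V => ENNReal.ofReal (g p.2 * ‖p.1 - p.2‖ ^ γ * crossDiff h u u' p.1 p.2 ^ 2) := by
  have h1 := (continuous_crossDiff (u := u) (u' := u') hh).measurable
  have h2 : Measurable fun p : V × V => ‖p.1 - p.2‖ ^ γ := by fun_prop
  exact (((hg.measurable.comp measurable_snd).mul h2).mul (h1.pow_const 2)).ennreal_ofReal

/-- Cauchy-Schwarz with the weights `|v - w|^(γ/2)` and `|v - w|^(-γ/2)`. The second factor is
bounded by `supI γ g` because `⟨v⟩^γ ≥ 1`. -/
theorem lintegral_crossDiff_sq_le (hγ : 0 ≤ γ) (hg : Continuous g) (hpos : ∀ v, 0 < g v)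
    (hh : Continuous h) (v : V) :
    (∫⁻ w, ENNReal.ofReal (g w * japanese w * |crossDiff h u u' v w|)) ^ 2 ≤
      (∫⁻ w, ENNReal.ofReal (g w * ‖v - w‖ ^ γ * crossDiff h u u' v w ^ 2)) * supI γ g := by
  have hc := continuous_crossDiff_right (u := u) (u' := u') hh v
  have hj := continuous_japanese
  set f₁ : V → ℝ≥0∞ := fun w =>
    ENNReal.ofReal (√(g w) * ‖v - w‖ ^ (γ / 2) * |crossDiff h u u' v w|)
  set f₂ : V → ℝ≥0∞ := fun w => ENNReal.ofReal (√(g w) * ‖w - v‖ ^ (-γ / 2) * japanese w)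
  have hf₁ : Measurable f₁ := by
    have := hc.measurable; have := hg.measurable
    fun_prop
  have hf₂ : Measurable f₂ := by
    have := hj.measurable; have := hg.measurable
    fun_prop
  have hle : ∀ w, ENNReal.ofReal (g w * japanese w * |crossDiff h u u' v w|) ≤ f₁ w * f₂ w := by
    intro w
    simp only [f₁, f₂]
    rw [← ENNReal.ofReal_mul (by positivity)]
    refine ENNReal.ofReal_le_ofReal ?_
    -- On the diagonal the two powers need not multiply to `1`, but the cross difference vanishes
    -- there.
    rcases eq_or_ne w v with rfl | hwv
    · rw [crossDiff_self]; simp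
    · have hz : 0 < ‖w - v‖ := norm_pos_iff.2 (sub_ne_zero.2 hwv)
      have h1 : ‖v - w‖ = ‖w - v‖ := norm_sub_rev _ _
      have h2 : ‖w - v‖ ^ (γ / 2) * ‖w - v‖ ^ (-γ / 2) = 1 := by
        rw [← Real.rpow_add hz]; simp [neg_div]
      have h3 : √(g w) * √(g w) = g w := Real.mul_self_sqrt (hpos w).le
      refine le_of_eq ?_
      rw [h1]
      calc g w * japanese w * |crossDiff h u u' v w|
          = (√(g w) * √(g w)) * (‖w - v‖ ^ (γ / 2) * ‖w - v‖ ^ (-γ / 2)) *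
            (japanese w * |crossDiff h u u' v w|) := by rw [h2, h3]; ring
        _ = _ := by ring
  have hsq₁ : ∀ w, f₁ w ^ 2 = ENNReal.ofReal (g w * ‖v - w‖ ^ γ * crossDiff h u u' v w ^ 2) := by
    intro w
    simp only [f₁]
    rw [← ENNReal.ofReal_pow (by positivity), mul_pow, mul_pow, Real.sq_sqrt (hpos w).le, sq_abs,
      ← Real.rpow_two (‖v - w‖ ^ (γ / 2)), ← Real.rpow_mul (norm_nonneg _)]
    norm_num
  have hsq₂ : ∀ w, f₂ w ^ 2 = ENNReal.ofReal (g w * ‖w - v‖ ^ (-γ) * japanese w ^ 2) := by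
    intro w
    simp only [f₂]
    have := japanese_pos w
    rw [← ENNReal.ofReal_pow (by positivity), mul_pow, mul_pow, Real.sq_sqrt (hpos w).le,
      ← Real.rpow_two (‖w - v‖ ^ (-γ / 2)), ← Real.rpow_mul (norm_nonneg _)]
    norm_num
  have hI : ∫⁻ w, f₂ w ^ 2 ≤ supI γ g := by
    simp_rw [hsq₂]
    refine le_trans ?_ (le_iSup (fun v : V => ENNReal.ofReal (japanese v ^ γ) *
      ∫⁻ w, ENNReal.ofReal (g w * ‖w - v‖ ^ (-γ) * japanese w ^ 2)) v)
    refine le_mul_of_one_le_left zero_le ?_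
    rw [ENNReal.one_le_ofReal]
    exact Real.one_le_rpow (one_le_japanese v) hγ
  calc _ ≤ (∫⁻ w, f₁ w * f₂ w) ^ 2 := by gcongr with w; exact hle w
    _ ≤ (∫⁻ w, f₁ w ^ 2) * ∫⁻ w, f₂ w ^ 2 :=
      lintegral_mul_sq_le hf₁.aemeasurable hf₂.aemeasurable
    _ ≤ _ := by
      simp_rw [hsq₁]
      gcongr

theorem integrable_mul_japanese (hg : Continuous g) (hpos : ∀ v, 0 < g v) (hgi : Integrable g)
    (hge : Integrable fun v => g v * ‖v‖ ^ 2) : Integrable fun w => g w * japanese w := by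
  have hj := continuous_japanese
  refine (hgi.add hge).mono' (by fun_prop) (Eventually.of_forall fun w => ?_)
  have h1 := japanese_pos w
  have h2 := hpos w
  rw [Real.norm_of_nonneg (by positivity)]
  have h3 := japanese_sq w
  have h4 := one_le_japanese w
  simp only [Pi.add_apply]
  nlinarith [mul_le_mul_of_nonneg_left (show japanese w ≤ 1 + ‖w‖ ^ 2 by nlinarith) h2.le]

theorem integrable_mul_japanese_mul_inner (hg : Continuous g) (hpos : ∀ v, 0 < g v)
    (hgi : Integrable g) (hge : Integrable fun v => g v * ‖v‖ ^ 2) (x : V) :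
    Integrable fun w => g w * japanese w * inner ℝ x w := by
  have hj := continuous_japanese
  refine ((hgi.add hge).const_mul ‖x‖).mono' (by fun_prop) (Eventually.of_forall fun w => ?_)
  have h1 := japanese_pos w
  have h2 := hpos w
  rw [norm_mul, Real.norm_of_nonneg (by positivity)]
  have h3 := japanese_sq w
  have h4 := norm_le_japanese w
  have h5 := norm_inner_le_norm (𝕜 := ℝ) x w
  simp only [Pi.add_apply]
  calc g w * japanese w * ‖inner ℝ x w‖ ≤ g w * japanese w * (‖x‖ * japanese w) := by
        gcongr; exact h5.trans (by gcongr)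
    _ = ‖x‖ * (g w * japanese w ^ 2) := by ring
    _ = _ := by rw [h3]; ring

/-- Finite dissipation makes the cross differences integrable for almost every base point. -/
theorem ae_integrable_crossDiff (hγ : 0 ≤ γ) (hg : Continuous g) (hpos : ∀ v, 0 < g v)
    (hh : Continuous h) (hD : crossDissipation γ g h u u' ≠ ⊤) (hI : supI γ g ≠ ⊤) :
    ∀ᵐ v, Integrable fun w => g w * japanese w * crossDiff h u u' v w := by
  have hm : Measurable fun v => ∫⁻ w, ENNReal.ofReal (g w * ‖v - w‖ ^ γ * crossDiff h u u' v w ^ 2) :=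
    Measurable.lintegral_prod_right' (measurable_crossKernel hg hh)
  have hae := ae_lt_top ((hg.measurable.ennreal_ofReal).mul hm) hD
  filter_upwards [hae] with v hv
  have hc := continuous_crossDiff_right (u := u) (u' := u') hh v
  have hj := continuous_japanese
  have hA : ∫⁻ w, ENNReal.ofReal (g w * ‖v - w‖ ^ γ * crossDiff h u u' v w ^ 2) < ⊤ := by
    by_contra hcon
    rw [not_lt, top_le_iff] at hcon
    simp only [Pi.mul_apply] at hv
    rw [hcon, ENNReal.mul_top (by simpa using hpos v)] at hv
    exact lt_irrefl _ hv
  have hle := lintegral_crossDiff_sq_le (u := u) (u' := u') hγ hg hpos hh v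
  have hfin : ∫⁻ w, ENNReal.ofReal (g w * japanese w * |crossDiff h u u' v w|) < ⊤ := by
    have h1 := hle.trans_lt (ENNReal.mul_lt_top hA hI.lt_top)
    rw [ENNReal.pow_lt_top_iff] at h1
    simpa using h1
  refine ⟨by fun_prop, ?_⟩
  rw [hasFiniteIntegral_iff_norm]
  refine (lintegral_congr fun w => ?_).trans_lt hfin
  have h1 := japanese_pos w
  have h2 := hpos w
  rw [norm_mul, Real.norm_of_nonneg (by positivity), Real.norm_eq_abs]

/-- Subtract the cross differences at base points `v` and `v + u`: the coefficient `⟪u, v - w⟫`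
changes by `1` and `⟪u', v - w⟫` not at all, so what remains is `-⟪u', h w⟫` plus a function affine
in `w`. Both base points can be chosen good by translation invariance of null sets. -/
theorem integrable_mul_japanese_mul_inner_score_right (hg : Continuous g) (hpos : ∀ v, 0 < g v)
    (hgi : Integrable g) (hge : Integrable fun v => g v * ‖v‖ ^ 2) (hu : ‖u‖ = 1)
    (huu : inner ℝ u u' = 0)
    (hae : ∀ᵐ v, Integrable fun w => g w * japanese w * crossDiff h u u' v w) :
    Integrable fun w => g w * japanese w * inner ℝ u' (h w) := by
  have hae' : ∀ᵐ v, Integrable fun w => g w * japanese w * crossDiff h u u' (v + u) w :=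
    (measurePreserving_add_right (volume : Measure V) u).quasiMeasurePreserving.ae hae
  obtain ⟨v, hv, hv'⟩ := (hae.and hae').exists
  have i0 := integrable_mul_japanese hg hpos hgi hge
  have i1 := integrable_mul_japanese_mul_inner hg hpos hgi hge u
  have i2 := integrable_mul_japanese_mul_inner hg hpos hgi hge u'
  have h1 : inner ℝ u u = (1 : ℝ) := by rw [real_inner_self_eq_norm_sq, hu]; norm_num
  have h3 : inner ℝ u' u = (0 : ℝ) := by rw [real_inner_comm, huu]
  set α := inner ℝ u' (h (v + u)) - inner ℝ u' (h v) with hα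
  set β := inner ℝ u (h (v + u)) - inner ℝ u (h v) with hβ
  refine (((i0.const_mul (inner ℝ u v * α + inner ℝ u' (h (v + u)) - inner ℝ u' v * β)).sub
    (i1.const_mul α)).add (i2.const_mul β) |>.sub (hv'.sub hv)).congr
    (Eventually.of_forall fun w => ?_)
  simp only [Pi.sub_apply, Pi.add_apply, crossDiff, inner_sub_right, inner_add_right, h1, h3, hα, hβ]
  ring

end

end LFD

/-! ### Averaging the cross differences -/

namespace LFD

open Filter Topology Set ProbabilityTheory
open scoped NNReal

section

variable {γ : ℝ} {g : V → ℝ} {h : V → V} {u u' : V}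

theorem integrable_of_japanese {f ψ : V → ℝ} (hg : Continuous g) (hpos : ∀ v, 0 < g v)
    (hf : Integrable fun w => g w * japanese w * f w) (hfc : Continuous f) (hψc : Continuous ψ)
    (hψ : ∀ w, |ψ w| ≤ japanese w) : Integrable fun w => g w * ψ w * f w := by
  refine hf.norm.mono' (by fun_prop) (Eventually.of_forall fun w => ?_)
  have h1 := japanese_pos w
  have h2 := hpos w
  rw [norm_mul, norm_mul, norm_mul, norm_mul, Real.norm_of_nonneg h2.le, Real.norm_of_nonneg h1.le]
  gcongr
  exact hψ w

theorem abs_inner_le_japanese (hu : ‖u‖ = 1) (w : V) : |inner ℝ u w| ≤ japanese w := by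
  refine (abs_real_inner_le_norm u w).trans ?_
  rw [hu, one_mul]
  exact norm_le_japanese w

/-- Averaging the cross differences against `⟪u', w⟫` isolates `⟪u, h⟫` up to affine terms. -/
theorem exists_integral_crossDiff_eq (hg : Continuous g) (hpos : ∀ v, 0 < g v)
    (hh : Continuous h) (hgi : Integrable g)
    (hge : Integrable fun v => g v * ‖v‖ ^ 2) (hmom : ∀ x : V, ∫ w, g w * inner ℝ x w = 0)
    (hu : ‖u‖ = 1) (hu' : ‖u'‖ = 1) (huu : inner ℝ u u' = 0)
    (hae : ∀ᵐ v, Integrable fun w => g w * japanese w * crossDiff h u u' v w)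
    {T K : ℝ} (hT : ∫ w, g w * inner ℝ u' w * inner ℝ u' w = T)
    (hT0 : ∫ w, g w * inner ℝ u' w * inner ℝ u w = 0)
    (hK : (Integrable fun w => g w * inner ℝ u' w * inner ℝ u' (h w)) →
      ∫ w, g w * inner ℝ u' w * inner ℝ u' (h w) = -K)
    (hK0 : (Integrable fun w => g w * inner ℝ u' w * inner ℝ u (h w)) →
      ∫ w, g w * inner ℝ u' w * inner ℝ u (h w) = 0) :
    ∃ C : ℝ, ∀ v, ∫ w, g w * inner ℝ u' w * crossDiff h u u' v w =
      T * inner ℝ u (h v) + K * inner ℝ u v + C := by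
  have hae' : ∀ᵐ v, Integrable fun w => g w * japanese w * crossDiff h u' u v w := by
    filter_upwards [hae] with v hv
    refine hv.neg.congr (Eventually.of_forall fun w => ?_)
    simp only [Pi.neg_apply, crossDiff_swap h u u', mul_neg]
  have huu' : inner ℝ u' u = (0 : ℝ) := by rw [real_inner_comm, huu]
  have j1 := integrable_mul_japanese_mul_inner_score_right hg hpos hgi hge hu huu hae
  have j2 := integrable_mul_japanese_mul_inner_score_right hg hpos hgi hge hu' huu' hae'
  have c0 : ∀ x : V, Continuous fun w : V => inner ℝ x w := fun x => by fun_prop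
  have ch : ∀ x : V, Continuous fun w : V => inner ℝ x (h w) := fun x => by fun_prop
  have hψ := abs_inner_le_japanese hu'
  have i1 := integrable_of_japanese hg hpos j1 (ch u') (c0 u') hψ
  have i2 := integrable_of_japanese hg hpos j2 (ch u) (c0 u') hψ
  have k0 : Integrable fun w => g w * inner ℝ u' w := by
    refine (integrable_inner_mul hgi hge u').congr (Eventually.of_forall fun w => ?_)
    simp only; ring
  have k1 : Integrable fun w => g w * inner ℝ u' w * inner ℝ u' w := by
    refine (integrable_inner_mul_inner_mul hgi hge u' u').congr (Eventually.of_forall fun w => ?_)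
    simp only; ring
  have k2 : Integrable fun w => g w * inner ℝ u' w * inner ℝ u w := by
    refine (integrable_inner_mul_inner_mul hgi hge u' u).congr (Eventually.of_forall fun w => ?_)
    simp only; ring
  obtain ⟨v₀, hv₀⟩ := hae.exists
  have i3 := integrable_of_japanese hg hpos hv₀ (continuous_crossDiff_right hh v₀) (c0 u') hψ
  set f : V → ℝ := fun w => g w * inner ℝ u' w *
    (inner ℝ u w * inner ℝ u' (h w) - inner ℝ u' w * inner ℝ u (h w)) with hf
  -- Every term but `f` is a function of `v` times a function of `w`. After integration, zero
  -- momentum, the diagonal moments and the integrations by parts remove all but two of them, and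
  -- `f` becomes the constant `C`.
  have hexp : ∀ v w, g w * inner ℝ u' w * crossDiff h u u' v w =
      (inner ℝ u v * inner ℝ u' (h v) - inner ℝ u' v * inner ℝ u (h v)) * (g w * inner ℝ u' w)
      + inner ℝ u (h v) * (g w * inner ℝ u' w * inner ℝ u' w)
      + (-inner ℝ u' (h v)) * (g w * inner ℝ u' w * inner ℝ u w)
      + (-inner ℝ u v) * (g w * inner ℝ u' w * inner ℝ u' (h w))
      + inner ℝ u' v * (g w * inner ℝ u' w * inner ℝ u (h w)) + f w := by
    intro v w
    simp only [crossDiff, inner_sub_right, hf]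
    ring
  have s : ∀ v, Integrable fun w =>
      (inner ℝ u v * inner ℝ u' (h v) - inner ℝ u' v * inner ℝ u (h v)) * (g w * inner ℝ u' w)
      + inner ℝ u (h v) * (g w * inner ℝ u' w * inner ℝ u' w)
      + (-inner ℝ u' (h v)) * (g w * inner ℝ u' w * inner ℝ u w)
      + (-inner ℝ u v) * (g w * inner ℝ u' w * inner ℝ u' (h w))
      + inner ℝ u' v * (g w * inner ℝ u' w * inner ℝ u (h w)) := fun v =>
    ((((k0.const_mul _).add (k1.const_mul _)).add (k2.const_mul _)).add (i1.const_mul _)).add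
      (i2.const_mul _)
  -- The products in `f` are quadratic in `w` times the score and are not integrable by the linear
  -- weights alone; their combination is, by solving the expansion for `f` at one good base point.
  have hfi : Integrable f := by
    refine (i3.sub (s v₀)).congr (Eventually.of_forall fun w => ?_)
    simp only [Pi.sub_apply]
    rw [hexp]
    ring
  refine ⟨∫ w, f w, fun v => ?_⟩
  simp_rw [hexp]
  have s4 : Integrable fun w =>
      (inner ℝ u v * inner ℝ u' (h v) - inner ℝ u' v * inner ℝ u (h v)) * (g w * inner ℝ u' w)
      + inner ℝ u (h v) * (g w * inner ℝ u' w * inner ℝ u' w)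
      + (-inner ℝ u' (h v)) * (g w * inner ℝ u' w * inner ℝ u w)
      + (-inner ℝ u v) * (g w * inner ℝ u' w * inner ℝ u' (h w)) :=
    (((k0.const_mul _).add (k1.const_mul _)).add (k2.const_mul _)).add (i1.const_mul _)
  have s3 : Integrable fun w =>
      (inner ℝ u v * inner ℝ u' (h v) - inner ℝ u' v * inner ℝ u (h v)) * (g w * inner ℝ u' w)
      + inner ℝ u (h v) * (g w * inner ℝ u' w * inner ℝ u' w)
      + (-inner ℝ u' (h v)) * (g w * inner ℝ u' w * inner ℝ u w) :=
    ((k0.const_mul _).add (k1.const_mul _)).add (k2.const_mul _)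
  have s2 : Integrable fun w =>
      (inner ℝ u v * inner ℝ u' (h v) - inner ℝ u' v * inner ℝ u (h v)) * (g w * inner ℝ u' w)
      + inner ℝ u (h v) * (g w * inner ℝ u' w * inner ℝ u' w) :=
    (k0.const_mul _).add (k1.const_mul _)
  rw [integral_add (s v) hfi, integral_add s4 (i2.const_mul _), integral_add s3 (i1.const_mul _),
    integral_add s2 (k2.const_mul _), integral_add (k0.const_mul _) (k1.const_mul _)]
  simp only [integral_const_mul]
  rw [hmom, hT, hT0, hK i1, hK0 i2]
  ring

theorem lintegral_integral_crossDiff_sq_le (hγ : 0 ≤ γ) (hg : Continuous g) (hpos : ∀ v, 0 < g v)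
    (hh : Continuous h) (hu' : ‖u'‖ = 1) :
    ∫⁻ v, ENNReal.ofReal (g v * (∫ w, g w * inner ℝ u' w * crossDiff h u u' v w) ^ 2) ≤
      crossDissipation γ g h u u' * supI γ g := by
  have hm : Measurable fun v => ∫⁻ w, ENNReal.ofReal (g w * ‖v - w‖ ^ γ * crossDiff h u u' v w ^ 2) :=
    Measurable.lintegral_prod_right' (measurable_crossKernel hg hh)
  have hm' : Measurable fun v => ENNReal.ofReal (g v) *
      ∫⁻ w, ENNReal.ofReal (g w * ‖v - w‖ ^ γ * crossDiff h u u' v w ^ 2) :=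
    hg.measurable.ennreal_ofReal.mul hm
  unfold crossDissipation
  rw [← lintegral_mul_const _ hm']
  refine lintegral_mono fun v => ?_
  rw [ENNReal.ofReal_mul (hpos v).le, mul_assoc]
  gcongr
  refine le_trans ?_ (lintegral_crossDiff_sq_le hγ hg hpos hh v)
  rw [← sq_abs, ENNReal.ofReal_pow (abs_nonneg _)]
  gcongr
  rw [← Real.norm_eq_abs, ofReal_norm]
  refine (enorm_integral_le_lintegral_enorm _).trans (lintegral_mono fun w => ?_)
  rw [← ofReal_norm]
  refine ENNReal.ofReal_le_ofReal ?_
  have h1 := hpos w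
  rw [norm_mul, norm_mul, Real.norm_of_nonneg h1.le, Real.norm_eq_abs, Real.norm_eq_abs]
  gcongr
  exact abs_inner_le_japanese hu' w

/-- A weighted `L²` bound on an affine perturbation of a centred function bounds the function. -/
theorem integral_sq_le_of_affine {f : V → ℝ} (hg : Continuous g) (hpos : ∀ v, 0 < g v)
    (hgi : Integrable g) (hmass : ∫ v, g v = 1) (hf : Continuous f)
    (hf0 : Integrable (fun v => g v * f v) → ∫ v, g v * f v = 0) {C X : ℝ} (hX : 0 ≤ X)
    (hle : ∫⁻ v, ENNReal.ofReal (g v * (f v + C) ^ 2) ≤ ENNReal.ofReal X) :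
    (Integrable fun v => g v * f v ^ 2) ∧ ∫ v, g v * f v ^ 2 ≤ X := by
  have h0 : ∀ v, 0 ≤ g v * (f v + C) ^ 2 := fun v => by have := hpos v; positivity
  have i1 : Integrable fun v => g v * (f v + C) ^ 2 := by
    refine ⟨by fun_prop, ?_⟩
    rw [hasFiniteIntegral_iff_ofReal (Eventually.of_forall h0)]
    exact hle.trans_lt ENNReal.ofReal_lt_top
  have i2 : Integrable fun v => g v * f v := by
    refine ((i1.add (hgi.const_mul (1 + |C|)))).mono' (by fun_prop) (Eventually.of_forall fun v => ?_)
    have h1 := hpos v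
    rw [norm_mul, Real.norm_of_nonneg h1.le, Real.norm_eq_abs]
    simp only [Pi.add_apply]
    have h2 : |f v| ≤ |f v + C| + |C| := by
      have := abs_add_le (f v + C) (-C)
      simpa using this
    have h3 : |f v + C| ≤ (f v + C) ^ 2 + 1 := by
      rw [← sq_abs (f v + C)]; nlinarith [sq_nonneg (|f v + C| - 1), abs_nonneg (f v + C)]
    nlinarith
  -- With `f` centred and `g` of mass one, the bound for `f + C` is the bound for `f` plus `C²`.
  have heq : ∀ v, g v * f v ^ 2 = g v * (f v + C) ^ 2 - (2 * C) * (g v * f v) - C ^ 2 * g v :=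
    fun v => by ring
  have i3 : Integrable fun v => g v * (f v + C) ^ 2 - (2 * C) * (g v * f v) :=
    i1.sub (i2.const_mul _)
  refine ⟨by simp_rw [heq]; exact i3.sub (hgi.const_mul _), ?_⟩
  simp_rw [heq]
  rw [integral_sub i3 (hgi.const_mul _), integral_sub i1 (i2.const_mul _), integral_const_mul,
    integral_const_mul, hf0 i2, hmass]
  have : ∫ v, g v * (f v + C) ^ 2 ≤ X := by
    rw [← ENNReal.ofReal_le_ofReal_iff hX, ofReal_integral_eq_lintegral_ofReal i1
      (Eventually.of_forall h0)]
    exact hle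
  nlinarith [sq_nonneg C]

end

end LFD

/-! ### Pressure, score and the estimate along one direction -/

namespace LFD

open Filter Topology Set ProbabilityTheory
open scoped NNReal

/-- The pressure `-ε⁻¹ log (1 - ε x)`, equal to `x` in the classical case. -/
noncomputable def pressure (ε x : ℝ) : ℝ := if ε = 0 then x else -(ε⁻¹ * Real.log (1 - ε * x))

theorem hasDerivAt_pressure {ε x : ℝ} (hx : 0 < 1 - ε * x) :
    HasDerivAt (pressure ε) (1 - ε * x)⁻¹ x := by
  rcases eq_or_ne ε 0 with rfl | hε
  · have : pressure 0 = id := by funext x; simp [pressure]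
    rw [this]
    simpa using hasDerivAt_id x
  · have : pressure ε = fun x => -(ε⁻¹ * Real.log (1 - ε * x)) := by funext x; simp [pressure, hε]
    rw [this]
    refine ((((((hasDerivAt_id x).const_mul ε).const_sub 1).log hx.ne').const_mul ε⁻¹).neg
      ).congr_deriv ?_
    simp only [id]
    field_simp

theorem le_pressure {ε x : ℝ} (hε : 0 ≤ ε) (hx : 0 < 1 - ε * x) : x ≤ pressure ε x := by
  rcases hε.eq_or_lt with rfl | hε
  · simp [pressure]
  · rw [pressure, if_neg hε.ne']
    have := Real.log_le_sub_one_of_pos hx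
    rw [← mul_neg, le_inv_mul_iff₀ hε]
    linarith

theorem pressure_le {ε κ x : ℝ} (hε : 0 ≤ ε) (hκ : 0 < κ) (hκ1 : κ ≤ 1) (hx0 : 0 ≤ x)
    (hx : κ ≤ 1 - ε * x) : pressure ε x ≤ κ⁻¹ * x := by
  rcases hε.eq_or_lt with rfl | hε
  · simp only [pressure, if_true]
    exact le_mul_of_one_le_left hx0 ((one_le_inv₀ hκ).2 hκ1)
  · rw [pressure, if_neg hε.ne']
    have h1 : 0 < 1 - ε * x := hκ.trans_le hx
    have := Real.log_le_sub_one_of_pos (inv_pos.2 h1)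
    rw [Real.log_inv] at this
    have h2 : (1 - ε * x)⁻¹ - 1 = ε * x * (1 - ε * x)⁻¹ := by
      have := mul_inv_cancel₀ h1.ne'
      linear_combination this
    have h3 : (1 - ε * x)⁻¹ ≤ κ⁻¹ := inv_anti₀ hκ hx
    rw [← mul_neg, inv_mul_le_iff₀ hε]
    calc _ ≤ ε * x * (1 - ε * x)⁻¹ := by linarith
      _ ≤ ε * x * κ⁻¹ := by gcongr
      _ = _ := by ring

/-- A smooth positive density of mass one, momentum zero and energy three, uniformly away from
saturation. -/
structure IsRegular (ε κ : ℝ) (g : V → ℝ) : Prop where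
  nonneg_param : 0 ≤ ε
  smooth : ContDiff ℝ 1 g
  pos : ∀ v, 0 < g v
  kappa_pos : 0 < κ
  kappa_le : ∀ v, κ ≤ 1 - ε * g v
  integrable : Integrable g
  integrable_energy : Integrable fun v => g v * ‖v‖ ^ 2
  mass : ∫ v, g v = 1
  momentum : ∀ x : V, ∫ v, g v * inner ℝ x v = 0
  energy : ∫ v, g v * ‖v‖ ^ 2 = 3

namespace IsRegular

variable {ε κ γ : ℝ} {g : V → ℝ}

theorem kappa_le_one (hg : IsRegular ε κ g) : κ ≤ 1 := by
  have := hg.kappa_le 0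
  have h2 := mul_nonneg hg.nonneg_param (hg.pos 0).le
  linarith

theorem one_sub_pos (hg : IsRegular ε κ g) (v : V) : 0 < 1 - ε * g v := hg.kappa_pos.trans_le (hg.kappa_le v)

theorem continuous_score (hg : IsRegular ε κ g) : Continuous (score ε g) := by
  have h1 : Continuous (gradient g) := by
    have : gradient g = fun v => (InnerProductSpace.toDual ℝ V).symm (fderiv ℝ g v) := rfl
    rw [this]
    exact (InnerProductSpace.toDual ℝ V).symm.continuous.comp
      (hg.smooth.continuous_fderiv one_ne_zero)
  have h2 := hg.smooth.continuous
  have h3 : ∀ v, g v * (1 - ε * g v) ≠ 0 := fun v => (mul_pos (hg.pos v) (hg.one_sub_pos v)).ne'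
  unfold score
  exact Continuous.smul (Continuous.inv₀ (by fun_prop) h3) h1

theorem inner_score (x v : V) :
    inner ℝ x (score ε g v) = (g v * (1 - ε * g v))⁻¹ * fderiv ℝ g v x := by
  rw [score, inner_smul_right, inner_gradient]

theorem hasFDerivAt_pressure (hg : IsRegular ε κ g) (v : V) :
    HasFDerivAt (fun v => pressure ε (g v)) ((1 - ε * g v)⁻¹ • fderiv ℝ g v) v :=
  (LFD.hasDerivAt_pressure (hg.one_sub_pos v)).comp_hasFDerivAt v
    (hg.smooth.differentiable one_ne_zero v).hasFDerivAt

/-- The identity that makes the score integrable by parts against `g`: in the derivative of the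
pressure the factor `1 - εg` appears exactly as in the score. -/
theorem fderiv_pressure (hg : IsRegular ε κ g) (v x : V) :
    fderiv ℝ (fun v => pressure ε (g v)) v x = g v * inner ℝ x (score ε g v) := by
  rw [(hg.hasFDerivAt_pressure v).fderiv, inner_score, smul_apply, smul_eq_mul]
  have h1 := (hg.pos v).ne'
  rw [mul_inv, ← mul_assoc, ← mul_assoc, mul_inv_cancel₀ h1, one_mul]

theorem differentiable_pressure (hg : IsRegular ε κ g) : Differentiable ℝ fun v => pressure ε (g v) := fun v =>
  (hg.hasFDerivAt_pressure v).differentiableAt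

theorem integrable_pressure (hg : IsRegular ε κ g) : Integrable fun v => pressure ε (g v) := by
  refine (hg.integrable.const_mul κ⁻¹).mono'
    hg.differentiable_pressure.continuous.aestronglyMeasurable (Eventually.of_forall fun v => ?_)
  rw [Real.norm_of_nonneg ((hg.pos v).le.trans
    (le_pressure hg.nonneg_param (hg.one_sub_pos v)))]
  exact pressure_le hg.nonneg_param hg.kappa_pos hg.kappa_le_one (hg.pos v).le (hg.kappa_le v)

theorem integrable_pressure_energy (hg : IsRegular ε κ g) : Integrable fun v => pressure ε (g v) * ‖v‖ ^ 2 := by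
  have hc := hg.differentiable_pressure.continuous
  refine (hg.integrable_energy.const_mul κ⁻¹).mono' (by fun_prop) (Eventually.of_forall fun v => ?_)
  rw [Real.norm_of_nonneg (mul_nonneg ((hg.pos v).le.trans
    (le_pressure hg.nonneg_param (hg.one_sub_pos v))) (sq_nonneg _)), ← mul_assoc]
  exact mul_le_mul_of_nonneg_right
    (pressure_le hg.nonneg_param hg.kappa_pos hg.kappa_le_one (hg.pos v).le (hg.kappa_le v))
    (sq_nonneg _)

theorem one_le_integral_pressure (hg : IsRegular ε κ g) : 1 ≤ ∫ v, pressure ε (g v) := by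
  rw [← hg.mass]
  exact integral_mono hg.integrable hg.integrable_pressure fun v =>
    le_pressure hg.nonneg_param (hg.one_sub_pos v)

theorem integral_mul_inner_score_eq_zero (hg : IsRegular ε κ g) (x : V)
    (hi : Integrable fun v => g v * inner ℝ x (score ε g v)) :
    ∫ v, g v * inner ℝ x (score ε g v) = 0 := by
  simp_rw [← hg.fderiv_pressure] at hi ⊢
  exact integral_fderiv_apply_eq_zero hg.differentiable_pressure hg.integrable_pressure x hi

theorem integral_inner_mul_inner_score (hg : IsRegular ε κ g) (x y : V)
    (hi : Integrable fun v => g v * inner ℝ x v * inner ℝ y (score ε g v)) :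
    ∫ v, g v * inner ℝ x v * inner ℝ y (score ε g v) =
      -(inner ℝ x y * ∫ v, pressure ε (g v)) := by
  have he : ∀ v, g v * inner ℝ x v * inner ℝ y (score ε g v) =
      inner ℝ x v * fderiv ℝ (fun v => pressure ε (g v)) v y := by
    intro v; rw [hg.fderiv_pressure]; ring
  simp_rw [he] at hi ⊢
  exact integral_inner_mul_fderiv hg.differentiable_pressure hg.integrable_pressure x y
    (integrable_inner_mul hg.integrable_pressure hg.integrable_pressure_energy x) hi

/-- The part of the dissipation seen by an orthonormal pair is controlled by the entropy
production. -/
theorem crossDissipation_le (hg : IsRegular ε κ g) {u u' : V} (hu : ‖u‖ = 1) (hu' : ‖u'‖ = 1) (huu : inner ℝ u u' = 0) :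
    ENNReal.ofReal (κ ^ 2) * crossDissipation γ g (score ε g) u u' ≤
      2 * entropyProduction γ ε g := by
  set h := score ε g with hh
  have hc := hg.smooth.continuous
  have hm := measurable_crossKernel (γ := γ) (u := u) (u' := u') hc hg.continuous_score
  have hm' : Measurable fun p : V × V => ENNReal.ofReal (g p.1) *
      ENNReal.ofReal (g p.2 * ‖p.1 - p.2‖ ^ γ * crossDiff h u u' p.1 p.2 ^ 2) :=
    ((hc.measurable.comp measurable_fst).ennreal_ofReal).mul hm
  have h1 : crossDissipation γ g h u u' = ∫⁻ p : V × V, ENNReal.ofReal (g p.1) *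
      ENNReal.ofReal (g p.2 * ‖p.1 - p.2‖ ^ γ * crossDiff h u u' p.1 p.2 ^ 2) := by
    change _ = ∫⁻ p : V × V, _ ∂((volume : Measure V).prod volume)
    rw [lintegral_prod _ hm'.aemeasurable]
    unfold crossDissipation
    refine lintegral_congr fun v => ?_
    exact (lintegral_const_mul _ (hm.comp measurable_prodMk_left)).symm
  rw [h1, ← lintegral_const_mul _ hm', entropyProduction, ← mul_assoc,
    ENNReal.mul_inv_cancel (by norm_num) (by norm_num), one_mul]
  refine lintegral_mono fun p => ?_
  have p1 := hg.pos p.1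
  have p2 := hg.pos p.2
  rw [← ENNReal.ofReal_mul p1.le, ← ENNReal.ofReal_mul (sq_nonneg κ)]
  refine ENNReal.ofReal_le_ofReal ?_
  have hk := norm_rpow_mul_cross_sq_le hu hu' huu γ (p.1 - p.2) (h p.1 - h p.2)
  have k0 := hg.kappa_pos
  have k1 := hg.kappa_le p.1
  have k2 := hg.kappa_le p.2
  have k3 := hg.one_sub_pos p.1
  have k4 := hg.one_sub_pos p.2
  unfold dissipationDensity crossDiff
  calc _ = (g p.1 * g p.2) * (κ * κ) * (‖p.1 - p.2‖ ^ γ *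
        (inner ℝ u (p.1 - p.2) * inner ℝ u' (h p.1 - h p.2) -
          inner ℝ u' (p.1 - p.2) * inner ℝ u (h p.1 - h p.2)) ^ 2) := by ring
    _ ≤ (g p.1 * g p.2) * ((1 - ε * g p.1) * (1 - ε * g p.2)) *
        (kineticPotential γ (p.1 - p.2) * ‖proj (p.1 - p.2) (h p.1 - h p.2)‖ ^ 2) := by
        have k5 : 0 ≤ g p.1 * g p.2 * ((1 - ε * g p.1) * (1 - ε * g p.2)) := by positivity
        gcongr
    _ = _ := by ring

/-- The key estimate for one orthonormal pair of principal directions. -/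
theorem integral_inner_score_add_sq_le (hg : IsRegular ε κ g) (hγ : 0 ≤ γ) {u u' : V} (hu : ‖u‖ = 1) (hu' : ‖u'‖ = 1)
    (huu : inner ℝ u u' = 0) {T : ℝ} (hT0 : 0 < T)
    (hT : ∫ w, g w * inner ℝ u' w * inner ℝ u' w = T)
    (hTo : ∫ w, g w * inner ℝ u' w * inner ℝ u w = 0)
    {X : ℝ} (hX : 0 ≤ X) (hD : crossDissipation γ g (score ε g) u u' ≠ ⊤) (hI : supI γ g ≠ ⊤)
    (hDX : crossDissipation γ g (score ε g) u u' * supI γ g ≤ ENNReal.ofReal X) :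
    (Integrable fun v => g v *
      (inner ℝ u (score ε g v) + (∫ v, pressure ε (g v)) / T * inner ℝ u v) ^ 2) ∧
    ∫ v, g v * (inner ℝ u (score ε g v) + (∫ v, pressure ε (g v)) / T * inner ℝ u v) ^ 2 ≤
      X / T ^ 2 := by
  set K := ∫ v, pressure ε (g v) with hK
  have hc := hg.smooth.continuous
  have hs := hg.continuous_score
  have h2 : inner ℝ u' u' = (1 : ℝ) := by rw [real_inner_self_eq_norm_sq, hu']; norm_num
  have h3 : inner ℝ u' u = (0 : ℝ) := by rw [real_inner_comm, huu]
  have hae := ae_integrable_crossDiff hγ hc hg.pos hs hD hI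
  obtain ⟨C, hC⟩ := exists_integral_crossDiff_eq (K := K) hc hg.pos hs hg.integrable
    hg.integrable_energy hg.momentum hu hu' huu hae hT hTo
    (fun hi => by rw [hg.integral_inner_mul_inner_score u' u' hi, h2, one_mul])
    (fun hi => by rw [hg.integral_inner_mul_inner_score u' u hi, h3, zero_mul, neg_zero])
  have hle := (lintegral_integral_crossDiff_sq_le (u := u) hγ hc hg.pos hs hu').trans hDX
  simp_rw [hC] at hle
  have hfc : Continuous fun v => T * inner ℝ u (score ε g v) + K * inner ℝ u v := by fun_prop
  have i1 : Integrable fun v => g v * inner ℝ u v := by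
    refine (integrable_inner_mul hg.integrable hg.integrable_energy u).congr
      (Eventually.of_forall fun w => ?_)
    simp only; ring
  -- Centred, because `g` has zero momentum and `g` times the score is a gradient.
  have hmean : (Integrable fun v => g v * (T * inner ℝ u (score ε g v) + K * inner ℝ u v)) →
      ∫ v, g v * (T * inner ℝ u (score ε g v) + K * inner ℝ u v) = 0 := by
    intro hi
    have i2 : Integrable fun v => g v * inner ℝ u (score ε g v) := by
      refine ((hi.sub (i1.const_mul K)).const_mul T⁻¹).congr (Eventually.of_forall fun v => ?_)
      simp only [Pi.sub_apply]
      field_simp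
      ring
    have he : ∀ v, g v * (T * inner ℝ u (score ε g v) + K * inner ℝ u v) =
        T * (g v * inner ℝ u (score ε g v)) + K * (g v * inner ℝ u v) := fun v => by ring
    simp_rw [he]
    rw [integral_add (i2.const_mul T) (i1.const_mul K), integral_const_mul, integral_const_mul,
      hg.momentum, hg.integral_mul_inner_score_eq_zero u i2]
    ring
  obtain ⟨hi, hb⟩ := integral_sq_le_of_affine hc hg.pos hg.integrable hg.mass hfc hmean hX hle
  have he : ∀ v, g v * (inner ℝ u (score ε g v) + K / T * inner ℝ u v) ^ 2 =
      (T ^ 2)⁻¹ * (g v * (T * inner ℝ u (score ε g v) + K * inner ℝ u v) ^ 2) := by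
    intro v
    field_simp
  simp_rw [he]
  refine ⟨hi.const_mul _, ?_⟩
  rw [integral_const_mul, div_eq_inv_mul]
  gcongr

end IsRegular

end LFD

/-! ### Principal directions and relative Fisher information -/

namespace LFD

open Filter Topology Set ProbabilityTheory
open scoped NNReal

namespace IsRegular

variable {ε κ γ : ℝ} {g : V → ℝ}

theorem integrable_mul_inner_mul_inner (hg : IsRegular ε κ g) (x y : V) :
    Integrable fun w => g w * inner ℝ x w * inner ℝ y w := by
  refine (integrable_inner_mul_inner_mul hg.integrable hg.integrable_energy x y).congr
    (Eventually.of_forall fun w => ?_)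
  simp only; ring

/-- Principal directions of the second moment tensor, with decreasing principal moments. -/
theorem exists_principal_basis (hg : IsRegular ε κ g) :
    ∃ (u : OrthonormalBasis (Fin 3) ℝ V) (T : Fin 3 → ℝ), Antitone T ∧
      ∀ i j, ∫ w, g w * inner ℝ (u i) w * inner ℝ (u j) w = if i = j then T i else 0 := by
  have hi : ∀ y : V, Integrable fun w => (g w * inner ℝ y w) • w := by
    intro y
    have hc := hg.smooth.continuous
    refine (hg.integrable_energy.norm.const_mul ‖y‖).mono' (by fun_prop)
      (Eventually.of_forall fun w => ?_)
    rw [norm_smul, norm_mul, norm_mul, norm_pow, norm_norm]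
    calc ‖g w‖ * ‖inner ℝ y w‖ * ‖w‖ ≤ ‖g w‖ * (‖y‖ * ‖w‖) * ‖w‖ := by
          gcongr; exact norm_inner_le_norm y w
      _ = _ := by ring
  let A : V →ₗ[ℝ] V :=
    { toFun := fun y => ∫ w, (g w * inner ℝ y w) • w
      map_add' := fun x y => by
        rw [← integral_add (hi x) (hi y)]
        refine integral_congr_ae (Eventually.of_forall fun w => ?_)
        simp only [inner_add_left, mul_add, add_smul]
      map_smul' := fun c y => by
        rw [RingHom.id_apply, ← integral_smul]
        refine integral_congr_ae (Eventually.of_forall fun w => ?_)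
        simp only [inner_smul_left, smul_smul, conj_trivial]
        congr 1
        ring }
  have hA : ∀ x y, inner ℝ x (A y) = ∫ w, g w * inner ℝ x w * inner ℝ y w := by
    intro x y
    change inner ℝ x (∫ w, (g w * inner ℝ y w) • w) = _
    rw [← integral_inner (hi y)]
    refine integral_congr_ae (Eventually.of_forall fun w => ?_)
    simp only [inner_smul_right]
    ring
  have hsym : A.IsSymmetric := by
    intro x y
    rw [real_inner_comm, hA, hA]
    refine integral_congr_ae (Eventually.of_forall fun w => ?_)
    simp only
    ring
  have hn : Module.finrank ℝ V = 3 := by simp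
  refine ⟨hsym.eigenvectorBasis hn, hsym.eigenvalues hn, hsym.eigenvalues_antitone hn,
    fun i j => ?_⟩
  rw [← hA, hsym.apply_eigenvectorBasis, inner_smul_right,
    OrthonormalBasis.inner_eq_ite]
  split_ifs with h
  · subst h; simp
  · simp

theorem integral_mul_inner_sq_pos (hg : IsRegular ε κ g) {x : V} (hx : x ≠ 0) :
    0 < ∫ w, g w * inner ℝ x w * inner ℝ x w := by
  have hc := hg.smooth.continuous
  have hcont : Continuous fun w => g w * inner ℝ x w * inner ℝ x w := by fun_prop
  refine integral_pos_of_integrable_nonneg_nonzero hcont (hg.integrable_mul_inner_mul_inner x x)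
    (fun w => ?_) (x := x) ?_
  · have := hg.pos w
    simp only [mul_assoc, Pi.zero_apply]
    exact mul_nonneg this.le (mul_self_nonneg _)
  · have := (hg.pos x).ne'
    have h2 : inner ℝ x x ≠ (0 : ℝ) := inner_self_ne_zero.2 hx
    positivity

/-- The directional constant is at least the inverse of the middle principal moment. -/
theorem inv_constB_le (hg : IsRegular ε κ g) {u : OrthonormalBasis (Fin 3) ℝ V} {T : Fin 3 → ℝ}
    (hT : Antitone T)
    (hu : ∀ i j, ∫ w, g w * inner ℝ (u i) w * inner ℝ (u j) w = if i = j then T i else 0) :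
    (constB g)⁻¹ ≤ ENNReal.ofReal (T 1) := by
  -- A unit vector of the first coordinate plane orthogonal to the top principal direction. It lies
  -- in the span of `u 1` and `u 2`, where the second moment form is at most `T 1`.
  obtain ⟨s₀, s₁, hs, hperp⟩ : ∃ s₀ s₁ : ℝ, s₀ ^ 2 + s₁ ^ 2 = 1 ∧ s₀ * u 0 0 - s₁ * u 0 1 = 0 := by
    rcases eq_or_ne (u 0 0 ^ 2 + u 0 1 ^ 2) 0 with h0 | h0
    · refine ⟨1, 0, by norm_num, ?_⟩
      have : u 0 0 = 0 := by nlinarith [sq_nonneg (u 0 0), sq_nonneg (u 0 1)]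
      simp [this]
    · have hpos : 0 < u 0 0 ^ 2 + u 0 1 ^ 2 := lt_of_le_of_ne (by positivity) h0.symm
      refine ⟨u 0 1 / √(u 0 0 ^ 2 + u 0 1 ^ 2), u 0 0 / √(u 0 0 ^ 2 + u 0 1 ^ 2), ?_, by ring⟩
      rw [div_pow, div_pow, Real.sq_sqrt hpos.le, ← add_div, add_comm, div_self h0]
  set n : V := !₂[s₀, -s₁, 0] with hn
  have hinner : ∀ w : V, inner ℝ n w = s₀ * w 0 - s₁ * w 1 := by
    intro w
    simp [hn, PiLp.inner_apply, Fin.sum_univ_three]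
    ring
  have hn1 : ‖n‖ ^ 2 = 1 := by
    rw [norm_sq_eq, ← hs]
    simp [hn]
  have hn0 : inner ℝ (u 0) n = (0 : ℝ) := by rw [real_inner_comm, hinner, hperp]
  set a := inner ℝ (u 1) n with ha
  set b := inner ℝ (u 2) n with hb
  have hrep : n = a • u 1 + b • u 2 := by
    conv_lhs => rw [← u.sum_repr' n]
    rw [Fin.sum_univ_three, hn0, zero_smul, zero_add]
  have hab : a ^ 2 + b ^ 2 = 1 := by
    rw [← hn1, ← u.sum_sq_inner_right n, Fin.sum_univ_three, hn0]
    ring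
  have i11 := (hg.integrable_mul_inner_mul_inner (u 1) (u 1)).const_mul (a ^ 2)
  have i12 := (hg.integrable_mul_inner_mul_inner (u 1) (u 2)).const_mul (2 * a * b)
  have i22 := (hg.integrable_mul_inner_mul_inner (u 2) (u 2)).const_mul (b ^ 2)
  have hval : ∫ w, g w * inner ℝ n w * inner ℝ n w = a ^ 2 * T 1 + b ^ 2 * T 2 := by
    have he : ∀ w, g w * inner ℝ n w * inner ℝ n w =
        a ^ 2 * (g w * inner ℝ (u 1) w * inner ℝ (u 1) w) +
        2 * a * b * (g w * inner ℝ (u 1) w * inner ℝ (u 2) w) +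
        b ^ 2 * (g w * inner ℝ (u 2) w * inner ℝ (u 2) w) := by
      intro w
      rw [hrep]
      simp only [inner_add_left, inner_smul_left, conj_trivial]
      ring
    simp_rw [he]
    have i3 : Integrable fun w => a ^ 2 * (g w * inner ℝ (u 1) w * inner ℝ (u 1) w) +
        2 * a * b * (g w * inner ℝ (u 1) w * inner ℝ (u 2) w) := i11.add i12
    rw [integral_add i3 i22, integral_add i11 i12]
    simp only [integral_const_mul, hu]
    simp
  have hle : ∫ w, g w * inner ℝ n w * inner ℝ n w ≤ T 1 := by
    rw [hval]
    calc a ^ 2 * T 1 + b ^ 2 * T 2 ≤ a ^ 2 * T 1 + b ^ 2 * T 1 := by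
          gcongr
          exact hT (show (1 : Fin 3) ≤ 2 by decide)
      _ = T 1 := by rw [← add_mul, hab, one_mul]
  unfold constB
  rw [inv_inv]
  have hσ : (!₂[s₀, s₁] : EuclideanSpace ℝ (Fin 2)) ∈
      Metric.sphere (0 : EuclideanSpace ℝ (Fin 2)) 1 := by
    rw [mem_sphere_zero_iff_norm, EuclideanSpace.norm_eq, Fin.sum_univ_two]
    simp [hs]
  refine iInf_le_of_le 0 (iInf_le_of_le 1 (iInf_le_of_le (by decide)
    (iInf_le_of_le ⟨!₂[s₀, s₁], hσ⟩ ?_)))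
  refine le_trans ?_ (ENNReal.ofReal_le_ofReal hle)
  rw [ofReal_integral_eq_lintegral_ofReal (hg.integrable_mul_inner_mul_inner n n)
    (Eventually.of_forall fun w => by
      have := hg.pos w
      simp only [mul_assoc, Pi.zero_apply]
      exact mul_nonneg this.le (mul_self_nonneg _))]
  refine lintegral_mono fun w => ENNReal.ofReal_le_ofReal ?_
  have h1 := one_le_japanese w
  have h2 := hg.pos w
  have h3 : (!₂[s₀, s₁] : EuclideanSpace ℝ (Fin 2)) 0 * (w 0 / japanese w) -
      (!₂[s₀, s₁] : EuclideanSpace ℝ (Fin 2)) 1 * (w 1 / japanese w) =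
      inner ℝ n w / japanese w := by
    rw [hinner]
    simp
    ring
  rw [h3, sq_abs, div_pow]
  calc inner ℝ n w ^ 2 / japanese w ^ 2 * g w ≤ inner ℝ n w ^ 2 * g w := by
        gcongr
        exact div_le_self (sq_nonneg _) (one_le_pow₀ h1)
    _ = _ := by ring

/-- Each directional energy is at most the total energy `3`. This is all that the factor `constE g ^
3` has to provide in the final estimate. -/
theorem constE_ge_one (hg : IsRegular ε κ g) : 1 ≤ constE g := by
  unfold constE
  rw [ENNReal.one_le_inv]
  refine (iInf_le _ 0).trans ?_
  have h : ∫⁻ v, ENNReal.ofReal (g v * v 0 ^ 2) ≤ 3 := by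
    calc ∫⁻ v, ENNReal.ofReal (g v * v 0 ^ 2) ≤ ∫⁻ v, ENNReal.ofReal (g v * ‖v‖ ^ 2) := by
          refine lintegral_mono fun v => ENNReal.ofReal_le_ofReal ?_
          have := hg.pos v
          rw [norm_sq_eq]
          gcongr
          nlinarith [sq_nonneg (v 1), sq_nonneg (v 2)]
      _ = ENNReal.ofReal 3 := by
          rw [← hg.energy, ofReal_integral_eq_lintegral_ofReal hg.integrable_energy
            (Eventually.of_forall fun v => mul_nonneg (hg.pos v).le (sq_nonneg _))]
      _ = 3 := by simp
  calc (3 : ℝ≥0∞)⁻¹ * ∫⁻ v, ENNReal.ofReal (g v * v 0 ^ 2) ≤ 3⁻¹ * 3 := by gcongr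
    _ = 1 := ENNReal.inv_mul_cancel (by norm_num) (by norm_num)

/-- Changing the slope of the affine correction to the least squares one decreases the norm. -/
theorem integral_sq_le_of_slope (hg : IsRegular ε κ g) {x : V} (hx : ‖x‖ = 1) {T l : ℝ} (hT0 : 0 < T)
    (hT : ∫ w, g w * inner ℝ x w * inner ℝ x w = T)
    (hi : Integrable fun v => g v * (inner ℝ x (score ε g v) + l * inner ℝ x v) ^ 2) :
    (Integrable fun v => g v *
      (inner ℝ x (score ε g v) + (∫ v, pressure ε (g v)) / T * inner ℝ x v) ^ 2) ∧
    ∫ v, g v * (inner ℝ x (score ε g v) + (∫ v, pressure ε (g v)) / T * inner ℝ x v) ^ 2 ≤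
      ∫ v, g v * (inner ℝ x (score ε g v) + l * inner ℝ x v) ^ 2 := by
  set K := ∫ v, pressure ε (g v) with hK
  have hc := hg.smooth.continuous
  have hs := hg.continuous_score
  have j := hg.integrable_mul_inner_mul_inner x x
  have h1 : inner ℝ x x = (1 : ℝ) := by rw [real_inner_self_eq_norm_sq, hx]; norm_num
  have i2 : Integrable fun v => g v * inner ℝ x v * inner ℝ x (score ε g v) := by
    refine ((hi.add (j.const_mul (1 + |l|)))).mono' (by fun_prop) (Eventually.of_forall fun v => ?_)
    have hp := hg.pos v
    set s := inner ℝ x (score ε g v)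
    set t := inner ℝ x v
    rw [norm_mul, norm_mul, Real.norm_of_nonneg hp.le, Real.norm_eq_abs, Real.norm_eq_abs]
    simp only [Pi.add_apply]
    have h2 : |s| ≤ |s + l * t| + |l| * |t| := by
      have := abs_add_le (s + l * t) (-(l * t))
      rw [abs_neg, abs_mul] at this
      simpa using this
    have h3 : |t| * |s| ≤ (s + l * t) ^ 2 + (1 + |l|) * (t * t) := by
      rw [← sq_abs (s + l * t), ← abs_mul_abs_self t]
      nlinarith [sq_nonneg (|t| - |s + l * t|), abs_nonneg t, abs_nonneg (s + l * t), abs_nonneg l,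
        sq_nonneg |s + l * t|, sq_nonneg |t|]
    nlinarith
  have hKint := hg.integral_inner_mul_inner_score x x i2
  rw [h1, one_mul, ← hK] at hKint
  have he : ∀ v, g v * (inner ℝ x (score ε g v) + K / T * inner ℝ x v) ^ 2 =
      g v * (inner ℝ x (score ε g v) + l * inner ℝ x v) ^ 2 +
      (2 * (K / T - l)) * (g v * inner ℝ x v * inner ℝ x (score ε g v)) +
      ((K / T) ^ 2 - l ^ 2) * (g v * inner ℝ x v * inner ℝ x v) := fun v => by ring
  have i3 : Integrable fun v => g v * (inner ℝ x (score ε g v) + l * inner ℝ x v) ^ 2 +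
      (2 * (K / T - l)) * (g v * inner ℝ x v * inner ℝ x (score ε g v)) :=
    hi.add (i2.const_mul _)
  simp_rw [he]
  refine ⟨i3.add (j.const_mul _), ?_⟩
  rw [integral_add i3 (j.const_mul _), integral_add hi (i2.const_mul _), integral_const_mul,
    integral_const_mul, hT, hKint]
  -- The moment `T` and the cross moment `-K` with the score make `K / T` the minimizing slope of
  -- this quadratic.
  have : 2 * (K / T - l) * -K + ((K / T) ^ 2 - l ^ 2) * T = -(T * (K / T - l) ^ 2) := by
    field_simp
    ring
  nlinarith [mul_nonneg hT0.le (sq_nonneg (K / T - l))]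

/-- The relative Fisher information with respect to a Gaussian is controlled by the dissipation. -/
theorem lintegral_score_le (hg : IsRegular ε κ g) (hγ : 0 ≤ γ) {X : ℝ} (hX : 0 ≤ X)
    (hI : supI γ g ≠ ⊤)
    (hD : ∀ u u' : V, ‖u‖ = 1 → ‖u'‖ = 1 → inner ℝ u u' = (0 : ℝ) →
      crossDissipation γ g (score ε g) u u' ≠ ⊤ ∧
      crossDissipation γ g (score ε g) u u' * supI γ g ≤ ENNReal.ofReal X) :
    ∃ T : ℝ, 0 < T ∧ (constB g)⁻¹ ≤ ENNReal.ofReal T ∧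
      ∫⁻ v, ENNReal.ofReal
        (g v * ‖score ε g v + ((∫ v, pressure ε (g v)) / T) • v‖ ^ 2) ≤
        ENNReal.ofReal (3 * X / T ^ 2) := by
  obtain ⟨u, T, hT, hu⟩ := hg.exists_principal_basis
  set K := ∫ v, pressure ε (g v) with hK
  have hn : ∀ i, ‖u i‖ = 1 := fun i => u.orthonormal.1 i
  have ho : ∀ i j, i ≠ j → inner ℝ (u i) (u j) = (0 : ℝ) := fun i j hij => u.orthonormal.2 hij
  have hne : ∀ i, u i ≠ 0 := fun i h => by have := hn i; rw [h, norm_zero] at this; norm_num at this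
  have hdiag : ∀ i, ∫ w, g w * inner ℝ (u i) w * inner ℝ (u i) w = T i := fun i => by
    rw [hu, if_pos rfl]
  have hoff : ∀ i j, i ≠ j → ∫ w, g w * inner ℝ (u i) w * inner ℝ (u j) w = 0 := fun i j hij => by
    rw [hu, if_neg hij]
  have hTpos : ∀ i, 0 < T i := fun i => by
    rw [← hdiag]; exact hg.integral_mul_inner_sq_pos (hne i)
  have hT01 : T 1 ≤ T 0 := hT (show (0 : Fin 3) ≤ 1 by decide)
  have key : ∀ i j, i ≠ j → _ := fun i j hij =>
    hg.integral_inner_score_add_sq_le hγ (hn i) (hn j) (ho i j hij) (hTpos j) (hdiag j)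
      (hoff j i hij.symm) hX (hD _ _ (hn i) (hn j) (ho i j hij)).1 hI
      (hD _ _ (hn i) (hn j) (ho i j hij)).2
  -- Partner `1` gives directions `0` and `2` the slope `K / T 1`. Direction `1` uses partner `0`,
  -- with slope `K / T 0` and the better bound `X / T 0 ^ 2`, and is then moved to its least squares
  -- slope, which is again `K / T 1`.
  obtain ⟨i0, b0⟩ := key 0 1 (by decide)
  obtain ⟨i2, b2⟩ := key 2 1 (by decide)
  obtain ⟨i1', b1'⟩ := key 1 0 (by decide)
  obtain ⟨i1, b1⟩ := hg.integral_sq_le_of_slope (hn 1) (hTpos 1) (hdiag 1) i1'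
  refine ⟨T 1, hTpos 1, hg.inv_constB_le hT hu, ?_⟩
  have hsum : ∀ v, g v * ‖score ε g v + (K / T 1) • v‖ ^ 2 =
      g v * (inner ℝ (u 0) (score ε g v) + K / T 1 * inner ℝ (u 0) v) ^ 2 +
      g v * (inner ℝ (u 1) (score ε g v) + K / T 1 * inner ℝ (u 1) v) ^ 2 +
      g v * (inner ℝ (u 2) (score ε g v) + K / T 1 * inner ℝ (u 2) v) ^ 2 := by
    intro v
    rw [← u.sum_sq_inner_right, Fin.sum_univ_three]
    simp only [inner_add_right, inner_smul_right]
    ring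
  have i01 : Integrable fun v =>
      g v * (inner ℝ (u 0) (score ε g v) + K / T 1 * inner ℝ (u 0) v) ^ 2 +
      g v * (inner ℝ (u 1) (score ε g v) + K / T 1 * inner ℝ (u 1) v) ^ 2 := i0.add i1
  have itot : Integrable fun v => g v * ‖score ε g v + (K / T 1) • v‖ ^ 2 := by
    simp_rw [hsum]
    exact i01.add i2
  rw [← ofReal_integral_eq_lintegral_ofReal itot
    (Eventually.of_forall fun v => mul_nonneg (hg.pos v).le (sq_nonneg _))]
  refine ENNReal.ofReal_le_ofReal ?_
  simp_rw [hsum]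
  rw [integral_add i01 i2, integral_add i0 i1]
  have hfrac : X / T 0 ^ 2 ≤ X / T 1 ^ 2 := by
    have := hTpos 1
    gcongr
  have : 3 * X / T 1 ^ 2 = X / T 1 ^ 2 + X / T 1 ^ 2 + X / T 1 ^ 2 := by ring
  linarith

end IsRegular

end LFD

/-! ### Nondegeneracy of the constants and the entropy inequality -/

namespace LFD

open Filter Topology Set ProbabilityTheory
open scoped NNReal

/-- The Fermi-Dirac statistics maximizes the entropy. -/
theorem relEntropy_nonneg {ε a b : ℝ} (hε : 0 ≤ ε) (h : IsFermiDiracParam ε a b) {g : V → ℝ}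
    (hgpos : ∀ v, 0 < g v) (hg1 : ∀ v, ε * g v < 1) (hgi : Integrable g)
    (hge : Integrable fun v => g v * ‖v‖ ^ 2) (hmass : ∫ v, g v = 1)
    (henergy : ∫ v, g v * ‖v‖ ^ 2 = 3) (hent : Integrable fun v => entropyDensity ε (g v)) :
    0 ≤ relEntropy ε g (fermiDirac ε a b) := by
  obtain ⟨c, hc⟩ := entropyDensity_sub_le hε
  set M := fermiDirac ε a b with hM
  have hMi := h.integrable
  have hMe := h.integrable_energy
  have hMent := h.integrable_entropyDensity hε
  have hle : ∀ v, entropyDensity ε (M v) - entropyDensity ε (g v) ≤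
      (Real.log a + c) * (M v - g v) - b * (M v * ‖v‖ ^ 2 - g v * ‖v‖ ^ 2) := by
    intro v
    have hN : 0 < a * Real.exp (-b * ‖v‖ ^ 2) := mul_pos h.a_pos (Real.exp_pos _)
    have h1 := hc (M v) (g v) _ (fermiDirac_pos hε h.a_pos v) (mul_fermiDirac_lt_one hε h.a_pos v)
      (hgpos v) (hg1 v) hN
    rw [fermiDirac_div hε h.a_pos, Real.log_mul h.a_pos.ne' (Real.exp_pos _).ne', Real.log_exp,
      relEnt, div_self hN.ne', Real.log_one] at h1
    linarith
  have i1 : Integrable fun v => (Real.log a + c) * (M v - g v) := (hMi.sub hgi).const_mul _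
  have i2 : Integrable fun v => b * (M v * ‖v‖ ^ 2 - g v * ‖v‖ ^ 2) := (hMe.sub hge).const_mul b
  have i3 : Integrable fun v => entropyDensity ε (M v) - entropyDensity ε (g v) := hMent.sub hent
  have key := integral_mono i3 (i1.sub i2) hle
  simp only [Pi.sub_apply] at key
  rw [integral_sub i1 i2, integral_const_mul, integral_const_mul, integral_sub hMi hgi,
    integral_sub hMe hge, integral_sub hMent hent, hmass, henergy, h.normalized.mass,
    h.normalized.energy] at key
  simp only [relEntropy, entropy]
  linarith

/-- Makes `1/λ(g)` nonzero, so that `λ(g)` is finite. The point `w = 0` is set aside since the power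
of its zero norm may vanish. -/
theorem supI_ne_zero {γ : ℝ} {g : V → ℝ} (hc : Continuous g) (hpos : ∀ v, 0 < g v) :
    supI γ g ≠ 0 := by
  intro h
  have h0 : ENNReal.ofReal (japanese 0 ^ γ) *
      ∫⁻ w, ENNReal.ofReal (g w * ‖w - 0‖ ^ (-γ) * japanese w ^ 2) = 0 :=
    le_antisymm (h ▸ le_iSup (fun v : V => ENNReal.ofReal (japanese v ^ γ) *
      ∫⁻ w, ENNReal.ofReal (g w * ‖w - v‖ ^ (-γ) * japanese w ^ 2)) 0) zero_le
  rw [mul_eq_zero] at h0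
  rcases h0 with h0 | h0
  · rw [ENNReal.ofReal_eq_zero] at h0
    exact absurd h0 (not_le.2 (Real.rpow_pos_of_pos (japanese_pos 0) γ))
  · have hj := continuous_japanese
    rw [lintegral_eq_zero_iff (by fun_prop)] at h0
    have h1 : ∀ᵐ w : V, w ≠ 0 := by
      rw [ae_iff]; simp
    obtain ⟨w, hw0, hw⟩ := (h0.and h1).exists
    simp only [Pi.zero_apply, ENNReal.ofReal_eq_zero, sub_zero] at hw0
    have := hpos w
    have h2 := Real.rpow_pos_of_pos (norm_pos_iff.2 hw) (-γ)
    have h3 := japanese_pos w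
    exact absurd hw0 (not_le.2 (by positivity))

namespace IsRegular

variable {ε κ γ : ℝ} {g : V → ℝ}

/-- Uniform ellipticity of the weighted second moment tensor. -/
theorem exists_pos_le_lintegral_inner (hg : IsRegular ε κ g) : ∃ c : ℝ, 0 < c ∧ ∀ x : V, ‖x‖ = 1 →
    ENNReal.ofReal c ≤ ∫⁻ v, ENNReal.ofReal (g v * (inner ℝ x v / japanese v) ^ 2) := by
  have hc := hg.smooth.continuous
  have hj := continuous_japanese
  have hj0 : ∀ v, japanese v ≠ 0 := fun v => (japanese_pos v).ne'
  have hcont : ∀ x : V, Continuous fun v => g v * (inner ℝ x v / japanese v) ^ 2 := fun x => by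
    fun_prop (disch := assumption)
  have hbd : ∀ x : V, ‖x‖ = 1 → ∀ v, ‖g v * (inner ℝ x v / japanese v) ^ 2‖ ≤ g v := by
    intro x hx v
    have h1 : |inner ℝ x v / japanese v| ≤ 1 := by
      rw [abs_div, abs_of_pos (japanese_pos v), div_le_one (japanese_pos v)]
      exact abs_inner_le_japanese hx v
    rw [Real.norm_of_nonneg (mul_nonneg (hg.pos v).le (sq_nonneg _)), ← sq_abs]
    exact mul_le_of_le_one_right (hg.pos v).le (pow_le_one₀ (abs_nonneg _) h1)
  have hint : ∀ x : V, ‖x‖ = 1 → Integrable fun v => g v * (inner ℝ x v / japanese v) ^ 2 :=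
    fun x hx => hg.integrable.mono' (hcont x).aestronglyMeasurable (Eventually.of_forall (hbd x hx))
  set Q : Metric.sphere (0 : V) 1 → ℝ :=
    fun x => ∫ v, g v * (inner ℝ x.1 v / japanese v) ^ 2 with hQ
  -- The form is continuous in the direction by domination by `g`, so compactness of the sphere
  -- gives a minimizer, at which the form is positive.
  have hQc : Continuous Q := by
    refine continuous_of_dominated (bound := g) (fun x => (hcont x).aestronglyMeasurable)
      (fun x => Eventually.of_forall (hbd x (mem_sphere_zero_iff_norm.1 x.2))) hg.integrable
      (Eventually.of_forall fun v => ?_)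
    fun_prop
  have hne : (univ : Set (Metric.sphere (0 : V) 1)).Nonempty :=
    ⟨⟨EuclideanSpace.single 0 1, by simp⟩, mem_univ _⟩
  obtain ⟨x₀, -, hx₀⟩ := isCompact_univ.exists_isMinOn hne hQc.continuousOn
  have hn₀ : ‖x₀.1‖ = 1 := mem_sphere_zero_iff_norm.1 x₀.2
  have hnz : x₀.1 ≠ 0 := fun h => by rw [h, norm_zero] at hn₀; norm_num at hn₀
  refine ⟨Q x₀, ?_, fun x hx => ?_⟩
  · refine integral_pos_of_integrable_nonneg_nonzero (hcont x₀.1) (hint x₀.1 hn₀)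
      (fun v => mul_nonneg (hg.pos v).le (sq_nonneg _)) (x := x₀.1) ?_
    have h1 := (hg.pos x₀.1).ne'
    have h2 : inner ℝ x₀.1 x₀.1 ≠ (0 : ℝ) := inner_self_ne_zero.2 hnz
    have h3 := hj0 x₀.1
    positivity
  · rw [← ofReal_integral_eq_lintegral_ofReal (hint x hx)
      (Eventually.of_forall fun v => mul_nonneg (hg.pos v).le (sq_nonneg _))]
    refine ENNReal.ofReal_le_ofReal ?_
    exact (isMinOn_iff.1 hx₀) (⟨x, mem_sphere_zero_iff_norm.2 hx⟩ : Metric.sphere (0 : V) 1)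
      (mem_univ _)

theorem constE_lt_top (hg : IsRegular ε κ g) : constE g < ⊤ := by
  obtain ⟨c, hc, h⟩ := hg.exists_pos_le_lintegral_inner
  unfold constE
  rw [ENNReal.inv_lt_top]
  have hc' : 0 < 3⁻¹ * ENNReal.ofReal c :=
    ENNReal.mul_pos (by simp) (ENNReal.ofReal_pos.2 hc).ne'
  refine hc'.trans_le (le_iInf fun i => ?_)
  gcongr
  refine (h (EuclideanSpace.single i 1) (by simp)).trans
    (lintegral_mono fun v => ENNReal.ofReal_le_ofReal ?_)
  have := (hg.pos v).le
  rw [EuclideanSpace.inner_single_left, div_pow]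
  simp only [map_one, one_mul]
  gcongr
  exact div_le_self (sq_nonneg _) (one_le_pow₀ (one_le_japanese v))

theorem constB_lt_top (hg : IsRegular ε κ g) : constB g < ⊤ := by
  obtain ⟨c, hc, h⟩ := hg.exists_pos_le_lintegral_inner
  unfold constB
  rw [ENNReal.inv_lt_top]
  refine (ENNReal.ofReal_pos.2 hc).trans_le (le_iInf fun i => le_iInf fun j => le_iInf fun hij =>
    le_iInf fun σ => ?_)
  have hσ : σ.1 0 ^ 2 + σ.1 1 ^ 2 = 1 := by
    have := mem_sphere_zero_iff_norm.1 σ.2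
    have h2 := EuclideanSpace.norm_sq_eq σ.1
    rw [this, Fin.sum_univ_two, Real.norm_eq_abs, Real.norm_eq_abs, sq_abs, sq_abs] at h2
    linarith
  set n : V := EuclideanSpace.single i (σ.1 0) - EuclideanSpace.single j (σ.1 1) with hn
  have hinner : ∀ v : V, inner ℝ n v = σ.1 0 * v i - σ.1 1 * v j := by
    intro v
    rw [hn, inner_sub_left, EuclideanSpace.inner_single_left, EuclideanSpace.inner_single_left]
    simp
  have hn1 : ‖n‖ = 1 := by
    have h2 : ‖n‖ ^ 2 = 1 := by
      rw [← real_inner_self_eq_norm_sq, hinner, hn]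
      simp only [PiLp.sub_apply, PiLp.single_apply, if_true, if_neg hij, if_neg hij.symm]
      linarith
    nlinarith [norm_nonneg n]
  refine (h n hn1).trans (lintegral_mono fun v => ENNReal.ofReal_le_ofReal (le_of_eq ?_))
  rw [hinner, sq_abs]
  ring

/-- The entropy - entropy production inequality away from saturation. -/
theorem relEntropy_le (hg : IsRegular ε κ g) (hγ : 0 ≤ γ) {a b : ℝ} (h : IsFermiDiracParam ε a b)
    (hhalf : ∀ v, ε * g v ≤ 1 / 2) (hent : Integrable fun v => entropyDensity ε (g v))
    (hD : entropyProduction γ ε g ≠ ⊤) (hI : supI γ g ≠ ⊤) :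
    ENNReal.ofReal (relEntropy ε g (fermiDirac ε a b)) ≤
      3 * (2 * entropyProduction γ ε g / ENNReal.ofReal (κ ^ 2) * supI γ g) * constB g := by
  have hκ2 : ENNReal.ofReal (κ ^ 2) ≠ 0 :=
    (ENNReal.ofReal_pos.2 (pow_pos hg.kappa_pos 2)).ne'
  set E := 2 * entropyProduction γ ε g / ENNReal.ofReal (κ ^ 2) with hE
  have hEtop : E ≠ ⊤ := ENNReal.div_ne_top (ENNReal.mul_ne_top (by norm_num) hD) hκ2
  set X := (E * supI γ g).toReal with hX
  have hXE : ENNReal.ofReal X = E * supI γ g := ENNReal.ofReal_toReal (ENNReal.mul_ne_top hEtop hI)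
  have hX0 : 0 ≤ X := ENNReal.toReal_nonneg
  obtain ⟨T, hT, hB, hle⟩ := hg.lintegral_score_le hγ hX0 hI fun u u' hu hu' huu => by
    have h1 : crossDissipation γ g (score ε g) u u' ≤ E := by
      rw [hE, ENNReal.le_div_iff_mul_le (Or.inl hκ2) (Or.inl ENNReal.ofReal_ne_top), mul_comm]
      exact hg.crossDissipation_le hu hu' huu
    exact ⟨(h1.trans_lt hEtop.lt_top).ne, by rw [hXE]; gcongr⟩
  set K := ∫ v, pressure ε (g v) with hK
  have hK1 : 1 ≤ K := hg.one_le_integral_pressure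
  have hK0 : 0 < K := by linarith
  -- The variance for which the Gaussian drift `v / θ` is the slope `(K / T) v` of the Fisher bound.
  set θ : ℝ≥0 := ⟨T / K, (div_pos hT hK0).le⟩ with hθ
  have hθv : (θ : ℝ) = T / K := rfl
  have hθ0 : θ ≠ 0 := by
    rw [← NNReal.coe_ne_zero, hθv]
    exact (div_pos hT hK0).ne'
  have hgd := hg.smooth.differentiable one_ne_zero
  set φ : V → ℝ := fun v => g v / (1 - ε * g v) with hφ
  have hφc : ContDiff ℝ 1 φ := hg.smooth.div (contDiff_const.sub (contDiff_const.mul hg.smooth))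
    fun v => (hg.one_sub_pos v).ne'
  have hφpos : ∀ v, 0 < φ v := fun v => div_pos (hg.pos v) (hg.one_sub_pos v)
  -- Distance `1/2` from saturation replaces `φ` by `2g`, and this `2` cancels the one in `θ / 2`.
  have hφ2 : ∀ v, φ v ≤ 2 * g v := by
    intro v
    rw [hφ, div_le_iff₀ (hg.one_sub_pos v)]
    nlinarith [hg.pos v, hhalf v]
  have hφi : Integrable φ := (hg.integrable.const_mul 2).mono'
    hφc.continuous.aestronglyMeasurable (Eventually.of_forall fun v => by
      rw [Real.norm_of_nonneg (hφpos v).le]; exact hφ2 v)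
  have hgrad : ∀ v, (φ v)⁻¹ • gradient φ v = score ε g v := by
    intro v
    have h1 := (hg.one_sub_pos v).ne'
    have h2 := (hg.pos v).ne'
    have hd : HasDerivAt (fun x => x / (1 - ε * x)) (((1 - ε * g v) ^ 2)⁻¹) (g v) := by
      refine ((hasDerivAt_id (g v)).div (((hasDerivAt_id (g v)).const_mul ε).const_sub 1) h1
        ).congr_deriv ?_
      simp only [id]
      field_simp
      ring
    have hf : fderiv ℝ φ v = ((1 - ε * g v) ^ 2)⁻¹ • fderiv ℝ g v :=
      (hd.comp_hasFDerivAt v (hgd v).hasFDerivAt).fderiv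
    rw [score, gradient, gradient, hf, map_smul, smul_smul, hφ]
    congr 1
    field_simp
  have hZ : 0 < ∫ v, φ v := integral_pos_of_pos hφpos hφi
  calc ENNReal.ofReal (relEntropy ε g (fermiDirac ε a b))
      ≤ ∫⁻ v, ENNReal.ofReal (relEnt (φ v) ((∫ v, φ v) * gaussDensity θ v)) :=
        relEntropy_le_lintegral_relEnt hg.nonneg_param h hg.pos
          (fun v => by linarith [hg.one_sub_pos v]) hg.integrable hg.integrable_energy hg.mass
          hg.energy hent hZ hθ0
    _ ≤ ∫⁻ v, ENNReal.ofReal (θ / 2 * (φ v * ‖(φ v)⁻¹ • gradient φ v + (θ : ℝ)⁻¹ • v‖ ^ 2)) :=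
        logSobolev hθ0 hφc hφpos hφi
    _ ≤ ∫⁻ v, ENNReal.ofReal (T / K) *
          ENNReal.ofReal (g v * ‖score ε g v + (K / T) • v‖ ^ 2) := by
        refine lintegral_mono fun v => ?_
        rw [← ENNReal.ofReal_mul (div_pos hT hK0).le, hgrad, hθv, inv_div]
        refine ENNReal.ofReal_le_ofReal ?_
        have h1 : T / K / 2 * (φ v * ‖score ε g v + (K / T) • v‖ ^ 2) ≤
            T / K / 2 * (2 * g v * ‖score ε g v + (K / T) • v‖ ^ 2) := by
          gcongr
          exact hφ2 v
        linarith
    _ = ENNReal.ofReal (T / K) *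
          ∫⁻ v, ENNReal.ofReal (g v * ‖score ε g v + (K / T) • v‖ ^ 2) :=
        lintegral_const_mul' _ _ ENNReal.ofReal_ne_top
    _ ≤ ENNReal.ofReal (T / K) * ENNReal.ofReal (3 * X / T ^ 2) := by gcongr
    _ ≤ ENNReal.ofReal (3 * X * T⁻¹) := by
        rw [← ENNReal.ofReal_mul (div_pos hT hK0).le]
        refine ENNReal.ofReal_le_ofReal ?_
        calc T / K * (3 * X / T ^ 2) ≤ T * (3 * X / T ^ 2) := by
              gcongr
              exact div_le_self hT.le hK1
          _ = 3 * X * T⁻¹ := by field_simp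
    _ ≤ 3 * (E * supI γ g) * constB g := by
        rw [ENNReal.ofReal_mul (by positivity), ENNReal.ofReal_mul (by norm_num), hXE,
          ENNReal.ofReal_inv_of_pos hT]
        rw [show ENNReal.ofReal 3 = 3 by simp]
        gcongr
        exact ENNReal.inv_le_iff_inv_le.1 hB

end IsRegular

end LFD

/-! ### The entropy production inequality -/

theorem theorem1p4 (γ : ℝ) (hγ : 0 ≤ γ)
    (ε₀ ε : ℝ) (hε : 0 ≤ ε) (hεε₀ : ε ≤ ε₀)
    (fin g : LFD.V → ℝ)
    (hfin : LFD.IsDatum ε₀ fin) (hnorm : LFD.IsNormalized fin)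
    (hg : LFD.MemY ε fin g)
    -- the entropy production is defined for smooth positive functions
    (hgsmooth : ContDiff ℝ 1 g) (hgpos : ∀ v, 0 < g v)
    (κ₀ : ℝ) (hκ₀ : 0 < κ₀) (hinf : ∀ v, κ₀ ≤ 1 - ε * g v)
    (a b : ℝ) (hab : LFD.IsFermiDiracParam ε a b) :
    -- `λ(g)` is finite, and positive when the quantities that define it are finite
    LFD.lam γ κ₀ g < ⊤ ∧
    (LFD.moment (2 + γ) g < ⊤ → LFD.supI γ g < ⊤ → 0 < LFD.lam γ κ₀ g) ∧
    -- both sides lie in `[0, ∞]`; a negative right side is replaced by zero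
    2 * LFD.lam γ κ₀ g *
        ENNReal.ofReal
          ((b - 12 * ε ^ 2 / κ₀ ^ 4 *
              max (LFD.supNorm g ^ 2) (LFD.supNorm (LFD.fermiDirac ε a b) ^ 2)) *
            LFD.relEntropy ε g (LFD.fermiDirac ε a b))
      ≤ LFD.entropyProduction γ ε g := by
  have hgi : Integrable g := hg.memL1.1
  have hge : Integrable fun v => g v * ‖v‖ ^ 2 := by
    have hc := hgsmooth.continuous
    refine hg.memL1.2.mono' (by fun_prop) (Filter.Eventually.of_forall fun v => ?_)
    rw [norm_mul, norm_pow, norm_norm, Real.norm_eq_abs, mul_comm, Real.rpow_two, LFD.japanese_sq]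
    gcongr
    linarith
  have hmass : ∫ v, g v = 1 := by rw [hg.mass_eq, hnorm.mass]
  have henergy : ∫ v, g v * ‖v‖ ^ 2 = 3 := by rw [hg.energy_eq, hnorm.energy]
  have hvi : Integrable fun v => g v • v := by
    have hc := hgsmooth.continuous
    refine (hgi.norm.add hge.norm).mono' (by fun_prop) (Filter.Eventually.of_forall fun v => ?_)
    simp only [Pi.add_apply]
    rw [norm_smul, norm_mul, norm_pow, norm_norm]
    nlinarith [norm_nonneg (g v), mul_nonneg (norm_nonneg (g v)) (sq_nonneg (‖v‖ - 1)),
      mul_nonneg (norm_nonneg (g v)) (sq_nonneg (‖v‖))]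
  have hmom : ∀ x : LFD.V, ∫ v, g v * inner ℝ x v = 0 := by
    intro x
    have h0 : ∫ v, g v • v = 0 := by rw [hg.momentum_eq, hnorm.momentum]
    have h1 := integral_inner (𝕜 := ℝ) hvi x
    rw [h0, inner_zero_right] at h1
    rw [← h1]
    refine integral_congr_ae (Filter.Eventually.of_forall fun v => ?_)
    simp only [inner_smul_right]
  have hreg : LFD.IsRegular ε κ₀ g :=
    ⟨hε, hgsmooth, hgpos, hκ₀, hinf, hgi, hge, hmass, hmom, henergy⟩
  have hE1 := hreg.constE_ge_one
  have hκ2 : ENNReal.ofReal (κ₀ ^ 2) ≠ 0 := (ENNReal.ofReal_pos.2 (pow_pos hκ₀ 2)).ne'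
  have hI0 := LFD.supI_ne_zero (γ := γ) hgsmooth.continuous hgpos
  have hE0 : LFD.constE g ^ 3 / ENNReal.ofReal (κ₀ ^ 2) ≠ 0 :=
    ENNReal.div_ne_zero.2 ⟨pow_ne_zero 3 (zero_lt_one.trans_le hE1).ne', ENNReal.ofReal_ne_top⟩
  have hmax : ∀ x : ℝ≥0∞, max 1 x ≠ 0 := fun x => (zero_lt_one.trans_le (le_max_left 1 x)).ne'
  have hlam : LFD.lam γ κ₀ g < ⊤ := by
    rw [LFD.lam, ENNReal.inv_lt_top, pos_iff_ne_zero]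
    exact mul_ne_zero (mul_ne_zero (mul_ne_zero (mul_ne_zero (by norm_num) hE0) (hmax _))
      (hmax _)) hI0
  refine ⟨hlam, fun hm hI => ?_, ?_⟩
  · rw [LFD.lam, ENNReal.inv_pos]
    refine ENNReal.mul_ne_top (ENNReal.mul_ne_top (ENNReal.mul_ne_top (ENNReal.mul_ne_top
      (by norm_num) (ENNReal.div_ne_top (ENNReal.pow_ne_top hreg.constE_lt_top.ne) hκ2)) ?_) ?_)
      hI.ne
    · exact (max_lt ENNReal.one_lt_top hreg.constB_lt_top).ne
    · exact (max_lt ENNReal.one_lt_top hm).ne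
  -- The other factors of `1/λ` are nonzero, so an infinite `supI` gives `λ = 0` and a trivial
  -- inequality.
  rcases eq_or_ne (LFD.supI γ g) ⊤ with hI | hI
  · have : LFD.lam γ κ₀ g = 0 := by
      rw [LFD.lam, hI, ENNReal.mul_top, ENNReal.inv_top]
      exact mul_ne_zero (mul_ne_zero (mul_ne_zero (by norm_num) hE0) (hmax _)) (hmax _)
    rw [this, mul_zero, zero_mul]
    exact zero_le
  rcases eq_or_ne (LFD.entropyProduction γ ε g) ⊤ with hD | hD
  · rw [hD]; exact le_top
  have hH := LFD.relEntropy_nonneg hε hab hgpos (fun v => by linarith [hreg.one_sub_pos v]) hgi hge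
    hmass henergy hg.finite_entropy
  set P := 12 * ε ^ 2 / κ₀ ^ 4 *
    max (LFD.supNorm g ^ 2) (LFD.supNorm (LFD.fermiDirac ε a b) ^ 2) with hP
  have hP0 : 0 ≤ P := by positivity
  rcases le_or_gt (b - P) 0 with hbr | hbr
  · rw [ENNReal.ofReal_of_nonpos (mul_nonpos_of_nonpos_of_nonneg hbr hH), mul_zero]
    exact zero_le
  obtain ⟨hb1, hhalf⟩ := hab.of_bracket_pos hε hgsmooth.continuous hgpos hκ₀ hinf hgi hge hmass
    henergy hbr
  have hmain := hreg.relEntropy_le hγ hab hhalf hg.finite_entropy hD hI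
  -- Once positive, the bracket is simply bounded by `b ≤ 1`.
  have hY : ENNReal.ofReal ((b - P) * LFD.relEntropy ε g (LFD.fermiDirac ε a b)) ≤
      ENNReal.ofReal (LFD.relEntropy ε g (LFD.fermiDirac ε a b)) :=
    ENNReal.ofReal_le_ofReal (mul_le_of_le_one_left hH (by linarith))
  have hle : 2 * ENNReal.ofReal ((b - P) * LFD.relEntropy ε g (LFD.fermiDirac ε a b)) ≤
      (LFD.lam γ κ₀ g)⁻¹ * LFD.entropyProduction γ ε g := by
    refine (mul_le_mul_right (hY.trans hmain) 2).trans ?_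
    rw [LFD.lam, inv_inv]
    set D := LFD.entropyProduction γ ε g
    set I := LFD.supI γ g
    set B := LFD.constB g
    set k := ENNReal.ofReal (κ₀ ^ 2)
    -- The estimates produce the constant `12`; the factors `constE g ^ 3` and `max 1 (moment (2 +
    -- γ) g)` enter only through being at least `1`.
    calc 2 * (3 * (2 * D / k * I) * B) = 12 * (1 / k) * B * 1 * I * D := by
          rw [div_eq_mul_inv, div_eq_mul_inv]
          ring
      _ ≤ 510 * (LFD.constE g ^ 3 / k) * max 1 B * max 1 (LFD.moment (2 + γ) g) * I * D := by
          gcongr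
          · norm_num
          · exact one_le_pow₀ hE1
          · exact le_max_right _ _
          · exact le_max_left _ _
  calc 2 * LFD.lam γ κ₀ g *
        ENNReal.ofReal ((b - P) * LFD.relEntropy ε g (LFD.fermiDirac ε a b))
      = LFD.lam γ κ₀ g *
        (2 * ENNReal.ofReal ((b - P) * LFD.relEntropy ε g (LFD.fermiDirac ε a b))) := by ring
    _ ≤ LFD.lam γ κ₀ g * ((LFD.lam γ κ₀ g)⁻¹ * LFD.entropyProduction γ ε g) := by gcongr
    _ = LFD.lam γ κ₀ g * (LFD.lam γ κ₀ g)⁻¹ * LFD.entropyProduction γ ε g := by ring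
    -- An inequality rather than an equality, so as to cover `λ = 0`, where the product with the
    -- infinite inverse is `0`.
    _ ≤ 1 * LFD.entropyProduction γ ε g := by
        gcongr
        exact ENNReal.mul_inv_le_one _
    _ = LFD.entropyProduction γ ε g := one_mul _
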